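/- Let $k$ be a field, let $t\ge 1$ and let $1\le n_1\le\cdots\le n_t$ be integers. Let $S=k[y_{i,j} : 1\le i\le t,\ 1\le j\le n_i+1]$ be the standard graded polynomial ring, let $X$ be the $2\times(n_1+\cdots+n_t)$ matrix that is the concatenation, for $i=1,\dots,t$, of the blocks $$\begin{pmatrix} y_{i,1} & y_{i,2} & \cdots & y_{i,n_i}\\ y_{i,2} & y_{i,3} & \cdots & y_{i,n_i+1}\end{pmatrix},$$ and let $R=S/I_2(X)$, where $I_2(X)$ is the ideal generated by the $2$-minors of $X$ (the rational normal scroll of type $(n_1,\dots,n_t)$). The natural coordinates of $R$ are the classes of the variables $y_{i,j}$. For a standard graded $k$-algebra $A$ and a finitely generated graded $A$-module $M$ put $\operatorname{reg}_A M=\sup\{j-i : \operatorname{Tor}^A_i(k,M)_j\neq 0\}$; write $\operatorname{reg} M=\operatorname{reg}_S M$ for graded $S$-modules $M$; and call $A$ Koszul if $k$ has a linear resolution over $A$, that is, $\operatorname{Tor}^A_i(k,k)_j=0$ for all $j\ne i$. Then: (i) $\operatorname{reg} R/(Y)\le \operatorname{reg} R$ for every subset $Y$ of the set of natural coordinates of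 $R$ if and only if $R$ is balanced, i.e. $n_t\le n_1+1$. (ii) $R/(Y)$ is a Koszul algebra for every subset $Y$ of the set of natural coordinates of $R$ if and only if $n_t\le 2n_1$. -/

import Mathlib

open scoped TensorProduct

universe u

noncomputable section

/-! ### Graded Tor and Castelnuovo–Mumford regularity

`R` is a commutative algebra over a field `k` with homogeneous components `𝒜 d` (`d : ℕ`), and `M`
is a graded `R`-module with homogeneous components `ℳ d`. The definitions are meant for gradings
with `𝒜 0 = k`; then `Tor^R(k, M)` is the homology of the normalized bar complex. -/

section Tor

variable {k : Type u} [Field k] {R : Type u} [CommRing R] [Algebra k R] (𝒜 : ℕ → Submodule k R)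
  {M : Type u} [AddCommGroup M] [Module k M] [Module R M] [IsScalarTower k R M]
  (ℳ : ℕ → Submodule k M)

/-- The graded maximal ideal `R₊`, generated by the homogeneous elements of positive degree. -/
def irrelevantIdeal : Ideal R :=
  Ideal.span {x | ∃ d, 0 < d ∧ x ∈ 𝒜 d}

variable (M) in
/-- The terms `R₊ ⊗ₖ ⋯ ⊗ₖ R₊ ⊗ₖ M` (with `i` factors `R₊`) of the normalized bar complex. -/
abbrev barObj : ℕ → ModuleCat.{u} k
  | 0 => ModuleCat.of k M
  | i + 1 => ModuleCat.of k (irrelevantIdeal 𝒜 ⊗[k] barObj i)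

variable (M) in
/-- The action of `R₊` on an `R`-module, as a `k`-bilinear map. -/
def irrelevantMul : irrelevantIdeal 𝒜 →ₗ[k] M →ₗ[k] M :=
  LinearMap.mk₂ k (fun r m => (r : R) • m)
    (fun r s m => add_smul (r : R) (s : R) m) (fun c r m => smul_assoc c (r : R) m)
    (fun r m m' => smul_add (r : R) m m') (fun c r m => smul_comm (r : R) c m)

variable (M) in
/-- Multiplication by elements of `R₊` on the leftmost tensor factor:
`r · m` is the module action for `i = 0`, and `r · (s ⊗ b) = (r * s) ⊗ b` for `i > 0`. -/
def barMul : (i : ℕ) → irrelevantIdeal 𝒜 →ₗ[k] barObj 𝒜 M i →ₗ[k] barObj 𝒜 M i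
  | 0 => irrelevantMul 𝒜 M
  | i + 1 => LinearMap.rTensorHom (barObj 𝒜 M i) ∘ₗ irrelevantMul 𝒜 (irrelevantIdeal 𝒜)

variable (M) in
/-- The differential of the bar complex. It is given by `d (r ⊗ m) = r m` and, recursively, by
`d (r ⊗ b) = r · b - r ⊗ d b`, so that `d (r₁ ⊗ ⋯ ⊗ rᵢ ⊗ m)` is the sum of the terms
`(-1)^(s-1) r₁ ⊗ ⋯ ⊗ rₛ rₛ₊₁ ⊗ ⋯ ⊗ rᵢ ⊗ m` for `1 ≤ s < i` and of
`(-1)^(i-1) r₁ ⊗ ⋯ ⊗ rᵢ₋₁ ⊗ rᵢ m`. -/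
def barD : (i : ℕ) → barObj 𝒜 M (i + 1) →ₗ[k] barObj 𝒜 M i
  | 0 => TensorProduct.lift (barMul 𝒜 M 0)
  | i + 1 => TensorProduct.lift (barMul 𝒜 M (i + 1)) - (barD i).lTensor (irrelevantIdeal 𝒜)

/-- The component of internal degree `j` of the `i`-th term of the bar complex, where the degree of
`r₁ ⊗ ⋯ ⊗ rᵢ ⊗ m` is `deg r₁ + ⋯ + deg rᵢ + deg m`. -/
def barDeg : (i : ℕ) → ℕ → Submodule k (barObj 𝒜 M i)
  | 0 => ℳ
  | i + 1 => fun j => Submodule.span k {x : irrelevantIdeal 𝒜 ⊗[k] barObj 𝒜 M i |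
      ∃ a b : ℕ, a + b = j ∧ ∃ r : irrelevantIdeal 𝒜, (r : R) ∈ 𝒜 a ∧
        ∃ y ∈ barDeg i b, x = r ⊗ₜ[k] y}

/-- The cycles of the bar complex in homological degree `i` and internal degree `j`. -/
def barCycles : (i : ℕ) → ℕ → Submodule k (barObj 𝒜 M i)
  | 0 => fun j => barDeg 𝒜 ℳ 0 j
  | i + 1 => fun j => LinearMap.ker (barD 𝒜 M i) ⊓ barDeg 𝒜 ℳ (i + 1) j

/-- The boundaries of the bar complex in homological degree `i` and internal degree `j`. -/
def barBoundaries (i j : ℕ) : Submodule k (barObj 𝒜 M i) :=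
  (barDeg 𝒜 ℳ (i + 1) j).map (barD 𝒜 M i)

/-- The vector space `Tor_i^R(k, M)_j`. -/
abbrev GradedTor (i j : ℕ) : Type u :=
  barCycles 𝒜 ℳ i j ⧸ (barBoundaries 𝒜 ℳ i j).comap (barCycles 𝒜 ℳ i j).subtype

/-- The Castelnuovo–Mumford regularity `reg_R M = sup {j - i : Tor_i^R(k, M)_j ≠ 0}`. -/
def regularity : EReal :=
  sSup {x | ∃ i j : ℕ, Nontrivial (GradedTor 𝒜 ℳ i j) ∧ x = (((j : ℝ) - (i : ℝ) : ℝ) : EReal)}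

/-- The grading of the residue field `k = R / R₊`. -/
def residueGrading (d : ℕ) : Submodule k (R ⧸ irrelevantIdeal 𝒜) :=
  (𝒜 d).map (Ideal.Quotient.mkₐ k (irrelevantIdeal 𝒜)).toLinearMap

/-- The graded algebra `R` is Koszul: `k` has a linear resolution over `R`, that is,
`Tor_i^R(k, k)_j = 0` whenever `j ≠ i`. -/
def IsKoszul : Prop :=
  ∀ i j : ℕ, j ≠ i → Subsingleton (GradedTor 𝒜 (residueGrading 𝒜) i j)

/-- The bar differential squares to zero. -/
theorem barD_comp_barD (i : ℕ) : barD 𝒜 M i ∘ₗ barD 𝒜 M (i + 1) = 0 := by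
  have hm : ∀ (i : ℕ) (r : irrelevantIdeal 𝒜) (b : barObj 𝒜 M (i + 1)),
      barD 𝒜 M i (barMul 𝒜 M (i + 1) r b) = barMul 𝒜 M i r (barD 𝒜 M i b) := by
    intro i r b
    induction b using TensorProduct.induction_on with
    | zero => simp
    | add x y hx hy => rw [map_add, map_add, hx, hy, map_add, map_add]
    | tmul s c =>
      cases i with
      | zero => exact mul_smul (r : R) (s : R) (c : M)
      | succ i =>
        have h1 : barMul 𝒜 M (i + 1) ((r : R) • s) c
            = barMul 𝒜 M (i + 1) r (barMul 𝒜 M (i + 1) s c) := by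
          induction c using TensorProduct.induction_on with
          | zero => simp
          | add x y hx hy => rw [map_add, hx, hy, map_add, map_add]
          | tmul u v =>
            exact congrArg (· ⊗ₜ[k] v) (mul_smul (r : R) (s : R) u)
        change barMul 𝒜 M (i + 1) ((r : R) • s) c - ((r : R) • s) ⊗ₜ[k] (barD 𝒜 M i c)
          = barMul 𝒜 M (i + 1) r (barMul 𝒜 M (i + 1) s c - s ⊗ₜ[k] (barD 𝒜 M i c))
        rw [h1, map_sub]
        rfl
  induction i with
  | zero =>
    refine TensorProduct.ext' fun r b => ?_
    change barD 𝒜 M 0 (barMul 𝒜 M 1 r b - r ⊗ₜ[k] (barD 𝒜 M 0 b)) = 0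
    rw [map_sub, hm, sub_eq_zero]
    rfl
  | succ i ih =>
    refine TensorProduct.ext' fun r b => ?_
    change barD 𝒜 M (i + 1) (barMul 𝒜 M (i + 2) r b - r ⊗ₜ[k] (barD 𝒜 M (i + 1) b)) = 0
    rw [map_sub, hm, sub_eq_zero]
    change _ = barMul 𝒜 M (i + 1) r (barD 𝒜 M (i + 1) b)
      - r ⊗ₜ[k] (barD 𝒜 M i (barD 𝒜 M (i + 1) b))
    have : barD 𝒜 M i (barD 𝒜 M (i + 1) b) = 0 := LinearMap.congr_fun ih b
    rw [this, TensorProduct.tmul_zero, sub_zero]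

end Tor

/-- The grading that a quotient algebra `A` of the standard graded polynomial ring
`k[x_s : s ∈ σ]` inherits: its components are the images of the spaces of forms. -/
def quotientGrading (k : Type u) [Field k] (σ : Type) (A : Type u) [CommRing A] [Algebra k A]
    [Algebra (MvPolynomial σ k) A] [IsScalarTower k (MvPolynomial σ k) A] (d : ℕ) :
    Submodule k A :=
  (MvPolynomial.homogeneousSubmodule σ k d).map
    (IsScalarTower.toAlgHom k (MvPolynomial σ k) A).toLinearMap

/-- The absolute regularity `reg A = reg_S A` of a quotient algebra `A` of the standard graded
polynomial ring `S = k[x_s : s ∈ σ]`. -/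
def absReg (k : Type u) [Field k] (σ : Type) (A : Type u) [CommRing A] [Algebra k A]
    [Algebra (MvPolynomial σ k) A] [IsScalarTower k (MvPolynomial σ k) A] : EReal :=
  regularity (MvPolynomial.homogeneousSubmodule σ k) (quotientGrading k σ A)

/-! ### Rational normal scrolls -/

section Scroll

variable (k : Type u) [Field k] {t : ℕ} (n : Fin t → ℕ)

/-- The index set of the variables `y_{i,j}`, `1 ≤ i ≤ t`, `1 ≤ j ≤ n_i + 1` (counted from `0`). -/
abbrev ScrollVar : Type := Σ i : Fin t, Fin (n i + 1)

/-- The `2 × (n₁ + ⋯ + n_t)` matrix whose `i`-th block has the first row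
`y_{i,1}, …, y_{i,n_i}` and the second row `y_{i,2}, …, y_{i,n_i+1}`. -/
def scrollMatrix : Matrix (Fin 2) (Σ i : Fin t, Fin (n i)) (MvPolynomial (ScrollVar n) k) :=
  Matrix.of ![fun c => MvPolynomial.X ⟨c.1, c.2.castSucc⟩, fun c => MvPolynomial.X ⟨c.1, c.2.succ⟩]

/-- The ideal `I₂(X)` of the `2`-minors of a matrix `X` with two rows. -/
def minorsIdeal {S : Type*} [CommRing S] {e : Type*} (X : Matrix (Fin 2) e S) : Ideal S :=
  Ideal.span {f | ∃ a b : e, f = (X.submatrix id ![a, b]).det}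

/-- The (homogeneous coordinate ring of the) rational normal scroll of type `(n₁, …, n_t)`. -/
abbrev Scroll : Type u :=
  MvPolynomial (ScrollVar n) k ⧸ minorsIdeal (scrollMatrix k n)

/-- The set of natural coordinates of the scroll: the classes of the variables `y_{i,j}`. -/
def naturalCoordinates : Set (Scroll k n) :=
  Set.range fun v : ScrollVar n => Ideal.Quotient.mk (minorsIdeal (scrollMatrix k n)) (.X v)

end Scroll

end

set_option linter.unusedSectionVars false

noncomputable section

/-! ### The bar complex as a functor -/

section Bar

variable {k : Type u} [Field k] {R : Type u} [CommRing R] [Algebra k R] (𝒜 : ℕ → Submodule k R)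
  {M : Type u} [AddCommGroup M] [Module k M] [Module R M] [IsScalarTower k R M]
  {N : Type u} [AddCommGroup N] [Module k N] [Module R N] [IsScalarTower k R N]
  {P : Type u} [AddCommGroup P] [Module k P] [Module R P] [IsScalarTower k R P]

/-! Write D(d) = Σ dᵢnᵢ (`maxIndex`), counting indices in a block from 0. A monomial has a weight
(d, w): its degrees d in the blocks and the sum w of its indices. A minor moves one unit of index
from one variable to another, so monomials of equal weight agree in R (`scrollMon_eq_of_wt_eq`), and
the weights with w ≤ D(d) form a basis of R. Killing coordinates deletes exactly the weights they
divide, so R/(Y) has the basis `liveSet V` (`monPresentation_of_ker`). All modules needed are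
spanned by convex sets of weights (`MonModule`). An upper set of weights yields a short exact
sequence (`gradedSES_mon`), and Tor, computed by the bar complex, is bounded through long exact
sequences and by dividing out variables that act injectively.

Upper bounds. `liveSet_induction` kills further variables one at a time until each block is either
untouched or killed entirely. The live multiples of the new variable form, up to a shift by one
degree, a `firstSet` (w = 0), a `lastSet` (w = D(d)) or a `shallowSet` (D(d) < w + p and w < q, for
a gap of length p + q between killed indices). Over R, `firstSet`, `lastSet` and the modules
`belowSet` have linear resolutions, by one induction on the homological degree
(`torScroll_belowSet`). So does `shallowSet` when p and q are at most n₁ (`torScroll_shallowSet`),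
and a gap can be cut in this way if n_t ≤ 2n₁. Hence R/(Y) has regularity at most 1 over R. Since k
has a linear resolution over R, it has one over R/(Y) as well (`TorZero.change_of_rings`). Over S,
`firstSet` and `lastSet` are polynomial rings, and n_t ≤ n₁ + 1 reduces `shallowSet` to the single
weight 0. So reg R/(Y) ≤ 1 in the balanced case (`torPoly_liveSet`). Moreover reg R ≤ 1 always, and
a nontrivial minor gives reg R ≥ 1 (`not_torZero_one_two`). The one scroll without such a minor, t =
1 and n₁ = 1, is a polynomial ring and is treated apart.

Lower bounds. Let x and z be the first and the last block. Kill all other blocks and, in z, the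
index 0 and all indices ≥ N (`gapVars`). In degree a in x and b ≥ 1 in z the surviving weights are
those with a·n_x + (b-1)·n_z < w < N. If n_z ≥ n_x + 2, take N = n_x + 2: the single weight in
degree (1,1) is a socle element of degree 2, which forces regularity at least 2
(`exists_not_torZero_of_socle`). If n_z ≥ 2n_x + 1, take N = 2n_x + 1: an explicit cocycle
(`wordValue`) detects a nonzero class in Tor₃(k, k)₄, so the quotient is not Koszul. -/

/-- The vanishing of `Tor_i^R(k, M)_j`. -/
def TorZero (ℳ : ℕ → Submodule k M) (i j : ℕ) : Prop :=
  barCycles 𝒜 ℳ i j ≤ barBoundaries 𝒜 ℳ i j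

theorem torZero_iff (ℳ : ℕ → Submodule k M) (i j : ℕ) :
    TorZero 𝒜 ℳ i j ↔ Subsingleton (GradedTor 𝒜 ℳ i j) := by
  rw [Submodule.Quotient.subsingleton_iff, Submodule.comap_subtype_eq_top]
  rfl

/-- The map of bar complexes induced by a map of modules. -/
def barMap (f : M →ₗ[R] N) : (i : ℕ) → barObj 𝒜 M i →ₗ[k] barObj 𝒜 N i
  | 0 => f.restrictScalars k
  | i + 1 => (barMap f i).lTensor (irrelevantIdeal 𝒜)

theorem barMap_tmul (f : M →ₗ[R] N) (i : ℕ) (r : irrelevantIdeal 𝒜) (b : barObj 𝒜 M i) :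
    barMap 𝒜 f (i + 1) (r ⊗ₜ[k] b) = r ⊗ₜ[k] barMap 𝒜 f i b := rfl

theorem barMap_comp (g : N →ₗ[R] P) (f : M →ₗ[R] N) (i : ℕ) :
    barMap 𝒜 (g ∘ₗ f) i = barMap 𝒜 g i ∘ₗ barMap 𝒜 f i := by
  induction i with
  | zero => rfl
  | succ i ih =>
    refine TensorProduct.ext' fun r b => ?_
    rw [LinearMap.comp_apply, barMap_tmul, barMap_tmul, barMap_tmul, ih]
    rfl

theorem barMap_id (i : ℕ) : barMap 𝒜 (LinearMap.id : M →ₗ[R] M) i = LinearMap.id := by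
  induction i with
  | zero => rfl
  | succ i ih =>
    refine TensorProduct.ext' fun r b => ?_
    rw [barMap_tmul, ih]
    rfl

theorem barMap_add (f g : M →ₗ[R] N) (i : ℕ) :
    barMap 𝒜 (f + g) i = barMap 𝒜 f i + barMap 𝒜 g i := by
  induction i with
  | zero => rfl
  | succ i ih =>
    refine TensorProduct.ext' fun r b => ?_
    rw [LinearMap.add_apply, barMap_tmul, barMap_tmul, barMap_tmul, ih, LinearMap.add_apply,
      TensorProduct.tmul_add]

theorem barMap_zero (i : ℕ) : barMap 𝒜 (0 : M →ₗ[R] N) i = 0 := by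
  have h := barMap_add 𝒜 (0 : M →ₗ[R] N) 0 i
  rw [add_zero] at h
  exact left_eq_add.mp h

theorem barMap_sum {ι : Type*} (s : Finset ι) (f : ι → M →ₗ[R] N) (i : ℕ) :
    barMap 𝒜 (∑ a ∈ s, f a) i = ∑ a ∈ s, barMap 𝒜 (f a) i := by
  classical
  induction s using Finset.induction_on with
  | empty => simp [barMap_zero]
  | insert a s ha ih => rw [Finset.sum_insert ha, Finset.sum_insert ha, barMap_add, ih]

theorem barMul_tmul (i : ℕ) (r s : irrelevantIdeal 𝒜) (b : barObj 𝒜 M i) :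
    barMul 𝒜 M (i + 1) r (s ⊗ₜ[k] b) = ((r : R) • s) ⊗ₜ[k] b := rfl

theorem barD_tmul_zero (r : irrelevantIdeal 𝒜) (m : M) :
    barD 𝒜 M 0 (r ⊗ₜ[k] m) = (r : R) • m := rfl

theorem barD_tmul (i : ℕ) (r : irrelevantIdeal 𝒜) (b : barObj 𝒜 M (i + 1)) :
    barD 𝒜 M (i + 1) (r ⊗ₜ[k] b) = barMul 𝒜 M (i + 1) r b - r ⊗ₜ[k] barD 𝒜 M i b := rfl

theorem barMap_barMul (f : M →ₗ[R] N) (i : ℕ) (r : irrelevantIdeal 𝒜) (b : barObj 𝒜 M i) :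
    barMap 𝒜 f i (barMul 𝒜 M i r b) = barMul 𝒜 N i r (barMap 𝒜 f i b) := by
  cases i with
  | zero => exact f.map_smul (r : R) b
  | succ i =>
    induction b using TensorProduct.induction_on with
    | zero => simp
    | add x y hx hy => rw [map_add, map_add, hx, hy, map_add, map_add]
    | tmul s c => rfl

theorem barMap_barD (f : M →ₗ[R] N) (i : ℕ) (b : barObj 𝒜 M (i + 1)) :
    barMap 𝒜 f i (barD 𝒜 M i b) = barD 𝒜 N i (barMap 𝒜 f (i + 1) b) := by
  induction i with
  | zero =>
    induction b using TensorProduct.induction_on with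
    | zero => simp
    | add x y hx hy => rw [map_add, map_add, hx, hy, map_add, map_add]
    | tmul s c => exact f.map_smul (s : R) c
  | succ i ih =>
    induction b using TensorProduct.induction_on with
    | zero => simp
    | add x y hx hy => rw [map_add, map_add, hx, hy, map_add, map_add]
    | tmul s c =>
      rw [barD_tmul, map_sub, barMap_tmul, barMap_tmul, barD_tmul, ih, barMap_barMul]

theorem barD_barD (i : ℕ) (b : barObj 𝒜 M (i + 2)) : barD 𝒜 M i (barD 𝒜 M (i + 1) b) = 0 :=
  LinearMap.congr_fun (barD_comp_barD 𝒜 (M := M) i) b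

/-- Everything is flat over the field `k`, so the bar complex is an exact functor of the module.
This is the source of all long exact sequences of Tor below. -/
theorem barMap_exact {f : M →ₗ[R] N} {g : N →ₗ[R] P} (h : Function.Exact f g) (i : ℕ) :
    Function.Exact (barMap 𝒜 f i) (barMap 𝒜 g i) := by
  induction i with
  | zero => exact h
  | succ i ih => exact Module.Flat.lTensor_exact (irrelevantIdeal 𝒜) ih

theorem barMap_injective {f : M →ₗ[R] N} (h : Function.Injective f) (i : ℕ) :
    Function.Injective (barMap 𝒜 f i) := by
  induction i with
  | zero => exact h
  | succ i ih => exact Module.Flat.lTensor_preserves_injective_linearMap _ ih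

theorem tmul_mem_barDeg {ℳ : ℕ → Submodule k M} {i a b : ℕ} {r : irrelevantIdeal 𝒜}
    (hr : (r : R) ∈ 𝒜 a) {y : barObj 𝒜 M i} (hy : y ∈ barDeg 𝒜 ℳ i b) :
    (r ⊗ₜ[k] y : irrelevantIdeal 𝒜 ⊗[k] barObj 𝒜 M i) ∈ barDeg 𝒜 ℳ (i + 1) (a + b) :=
  Submodule.subset_span ⟨a, b, rfl, r, hr, y, hy, rfl⟩

/-- To map `barDeg (i + 1) j` into a subspace it suffices to map the homogeneous tensors. -/
theorem barDeg_succ_le {ℳ : ℕ → Submodule k M} {i j : ℕ} {X : Type*} [AddCommGroup X] [Module k X]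
    {φ : barObj 𝒜 M (i + 1) →ₗ[k] X} {Q : Submodule k X}
    (h : ∀ a b : ℕ, a + b = j → ∀ r : irrelevantIdeal 𝒜, (r : R) ∈ 𝒜 a →
      ∀ y ∈ barDeg 𝒜 ℳ i b, φ (r ⊗ₜ[k] y) ∈ Q) {z : barObj 𝒜 M (i + 1)}
    (hz : z ∈ barDeg 𝒜 ℳ (i + 1) j) : φ z ∈ Q := by
  have : barDeg 𝒜 ℳ (i + 1) j ≤ Q.comap φ := by
    refine Submodule.span_le.mpr ?_
    rintro _ ⟨a, b, hab, r, hr, y, hy, rfl⟩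
    exact h a b hab r hr y hy
  exact this hz

theorem barMap_mem_barDeg {ℳ : ℕ → Submodule k M} {𝒩 : ℕ → Submodule k N} {f : M →ₗ[R] N}
    (hf : ∀ j, ∀ m ∈ ℳ j, f m ∈ 𝒩 j) {i j : ℕ} {z : barObj 𝒜 M i} (hz : z ∈ barDeg 𝒜 ℳ i j) :
    barMap 𝒜 f i z ∈ barDeg 𝒜 𝒩 i j := by
  induction i generalizing j with
  | zero => exact hf j z hz
  | succ i ih =>
    refine barDeg_succ_le 𝒜 (fun a b hab r hr y hy => ?_) hz
    subst hab
    exact tmul_mem_barDeg 𝒜 hr (ih hy)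

theorem barMap_surj_barDeg {ℳ : ℕ → Submodule k M} {𝒩 : ℕ → Submodule k N} {f : M →ₗ[R] N}
    (hf : ∀ j, ∀ y ∈ 𝒩 j, ∃ x ∈ ℳ j, f x = y) {i j : ℕ} {z : barObj 𝒜 N i}
    (hz : z ∈ barDeg 𝒜 𝒩 i j) : ∃ y ∈ barDeg 𝒜 ℳ i j, barMap 𝒜 f i y = z := by
  induction i generalizing j with
  | zero => exact hf j z hz
  | succ i ih =>
    change z ∈ (barDeg 𝒜 ℳ (i + 1) j).map (barMap 𝒜 f (i + 1))
    refine barDeg_succ_le 𝒜 (φ := LinearMap.id) (fun a b hab r hr y hy => ?_) hz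
    subst hab
    obtain ⟨x, hx, rfl⟩ := ih hy
    exact ⟨_, tmul_mem_barDeg 𝒜 hr hx, rfl⟩

theorem barMap_mem_barCycles {ℳ : ℕ → Submodule k M} {𝒩 : ℕ → Submodule k N} {f : M →ₗ[R] N}
    (hf : ∀ j, ∀ m ∈ ℳ j, f m ∈ 𝒩 j) {i j : ℕ} {z : barObj 𝒜 M i} (hz : z ∈ barCycles 𝒜 ℳ i j) :
    barMap 𝒜 f i z ∈ barCycles 𝒜 𝒩 i j := by
  cases i with
  | zero => exact hf j z hz
  | succ i =>
    refine ⟨?_, barMap_mem_barDeg 𝒜 hf hz.2⟩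
    change barD 𝒜 N i _ = 0
    rw [← barMap_barD, show barD 𝒜 M i z = 0 from hz.1, map_zero]

theorem barCycles_le_barDeg (ℳ : ℕ → Submodule k M) (i j : ℕ) :
    barCycles 𝒜 ℳ i j ≤ barDeg 𝒜 ℳ i j := by
  cases i with
  | zero => exact le_rfl
  | succ i => exact inf_le_right

theorem mem_barCycles_of_barMap {ℳ : ℕ → Submodule k M} {𝒩 : ℕ → Submodule k N} {f : M →ₗ[R] N}
    (hf : Function.Injective f) {i j : ℕ} {z : barObj 𝒜 M i} (hz : z ∈ barDeg 𝒜 ℳ i j)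
    (h : barMap 𝒜 f i z ∈ barCycles 𝒜 𝒩 i j) : z ∈ barCycles 𝒜 ℳ i j := by
  cases i with
  | zero => exact hz
  | succ i =>
    refine ⟨barMap_injective 𝒜 hf i ?_, hz⟩
    rw [barMap_barD, map_zero]
    exact h.1

theorem barMap_mem_barBoundaries {ℳ : ℕ → Submodule k M} {𝒩 : ℕ → Submodule k N} {f : M →ₗ[R] N}
    (hf : ∀ j, ∀ m ∈ ℳ j, f m ∈ 𝒩 j) {i j : ℕ} {z : barObj 𝒜 M i}
    (hz : z ∈ barBoundaries 𝒜 ℳ i j) : barMap 𝒜 f i z ∈ barBoundaries 𝒜 𝒩 i j := by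
  obtain ⟨c, hc, rfl⟩ := hz
  exact ⟨_, barMap_mem_barDeg 𝒜 hf hc, (barMap_barD 𝒜 f i c).symm⟩

theorem TorZero.of_equiv {ℳ : ℕ → Submodule k M} {𝒩 : ℕ → Submodule k N} {i j : ℕ}
    (h : TorZero 𝒜 ℳ i j) (e : M ≃ₗ[R] N) (he : ∀ j m, m ∈ ℳ j ↔ e m ∈ 𝒩 j) :
    TorZero 𝒜 𝒩 i j := by
  intro z hz
  have hz' : barMap 𝒜 (e.symm : N →ₗ[R] M) i z ∈ barCycles 𝒜 ℳ i j :=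
    barMap_mem_barCycles 𝒜 (fun j m hm => by rw [he]; simpa using hm) hz
  have := barMap_mem_barBoundaries 𝒜 (f := (e : M →ₗ[R] N)) (fun j m hm => (he j m).mp hm) (h hz')
  rwa [← LinearMap.comp_apply, ← barMap_comp, LinearEquiv.comp_coe, LinearEquiv.symm_trans_self,
    LinearEquiv.refl_toLinearMap, barMap_id] at this

/-- `Tor` commutes with finite direct sums. -/
theorem TorZero.of_decomposition {ι : Type*} (s : Finset ι) {ℳ : ℕ → Submodule k M}
    {𝒩 : ℕ → Submodule k N} {i j : ℕ} (h : TorZero 𝒜 ℳ i j) (p : ι → N →ₗ[R] M)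
    (q : ι → M →ₗ[R] N) (hp : ∀ a j, ∀ m ∈ 𝒩 j, p a m ∈ ℳ j) (hq : ∀ a j, ∀ m ∈ ℳ j, q a m ∈ 𝒩 j)
    (hpq : ∑ a ∈ s, q a ∘ₗ p a = LinearMap.id) : TorZero 𝒜 𝒩 i j := by
  intro z hz
  have : z = ∑ a ∈ s, barMap 𝒜 (q a) i (barMap 𝒜 (p a) i z) := by
    conv_lhs => rw [← LinearMap.id_apply (R := k) (x := z), ← barMap_id 𝒜 (M := N), ← hpq,
      barMap_sum, LinearMap.sum_apply]
    exact Finset.sum_congr rfl fun a _ => by rw [barMap_comp]; rfl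
  rw [this]
  exact Submodule.sum_mem _ fun a _ =>
    barMap_mem_barBoundaries 𝒜 (hq a) (h (barMap_mem_barCycles 𝒜 (hp a) hz))

end Bar

/-! ### Connected gradings and long exact sequences -/

section Graded

variable {k : Type u} [Field k] {R : Type u} [CommRing R] [Algebra k R] {𝒜 : ℕ → Submodule k R}
  {M : Type u} [AddCommGroup M] [Module k M] [Module R M] [IsScalarTower k R M]
  {N : Type u} [AddCommGroup N] [Module k N] [Module R N] [IsScalarTower k R N]
  {P : Type u} [AddCommGroup P] [Module k P] [Module R P] [IsScalarTower k R P]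

/-- An algebra grading over `ℕ` whose component of degree `0` is the base field. -/
structure ConnectedGrading (𝒜 : ℕ → Submodule k R) where
  /-- The projections to the homogeneous components. -/
  pr : ℕ → R →ₗ[k] R
  pr_mem : ∀ d r, pr d r ∈ 𝒜 d
  pr_same : ∀ d, ∀ r ∈ 𝒜 d, pr d r = r
  pr_ne : ∀ d e, d ≠ e → ∀ r ∈ 𝒜 e, pr d r = 0
  one_mem : (1 : R) ∈ 𝒜 0
  mul_mem : ∀ a b, ∀ x ∈ 𝒜 a, ∀ y ∈ 𝒜 b, x * y ∈ 𝒜 (a + b)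
  zero_le : ∀ x ∈ 𝒜 0, ∃ c : k, x = algebraMap k R c
  iSup_eq_top : ⨆ d, 𝒜 d = ⊤

/-- The ring `R` acts on the graded module by homogeneous maps. -/
def GradedAction (𝒜 : ℕ → Submodule k R) (ℳ : ℕ → Submodule k M) : Prop :=
  ∀ a b, ∀ x ∈ 𝒜 a, ∀ m ∈ ℳ b, x • m ∈ ℳ (a + b)

theorem mem_irrelevantIdeal {d : ℕ} (hd : 0 < d) {r : R} (hr : r ∈ 𝒜 d) :
    r ∈ irrelevantIdeal 𝒜 :=
  Ideal.subset_span ⟨d, hd, hr⟩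

namespace ConnectedGrading

variable (G : ConnectedGrading 𝒜)
include G

theorem pr_zero_eq_zero {r : R} (hr : r ∈ irrelevantIdeal 𝒜) : G.pr 0 r = 0 := by
  induction hr using Submodule.span_induction with
  | zero => exact map_zero _
  | add x y _ _ hx hy => rw [map_add, hx, hy, add_zero]
  | mem x hx =>
    obtain ⟨d, hd, hx⟩ := hx
    exact G.pr_ne 0 d hd.ne _ hx
  | smul a x hx _ =>
    -- `pr 0` is only `k`-linear, so its vanishing on `x` does not pass to `a * x`; the vanishing is
    -- proved for all multiples at once.
    have hx' : ∀ y ∈ irrelevantIdeal 𝒜, ∀ a, G.pr 0 (a * y) = 0 := by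
      intro y hy
      induction hy using Submodule.span_induction with
      | zero => simp
      | add x y _ _ hx hy => intro a; rw [mul_add, map_add, hx, hy, add_zero]
      | smul b x _ hx => intro a; rw [smul_eq_mul, ← mul_assoc, hx]
      | mem x hx =>
        obtain ⟨d, hd, hx⟩ := hx
        intro a
        have ha : a ∈ ⨆ d, 𝒜 d := by rw [G.iSup_eq_top]; trivial
        induction ha using Submodule.iSup_induction' with
        | zero => simp
        | add x y _ _ hx hy => rw [add_mul, map_add, hx, hy, add_zero]
        | mem e b hb => exact G.pr_ne 0 (e + d) (by omega) _ (G.mul_mem _ _ _ hb _ hx)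
    exact hx' x hx a

theorem eq_zero_of_mem_zero {r : R} (hr : r ∈ irrelevantIdeal 𝒜) (h0 : r ∈ 𝒜 0) : r = 0 := by
  rw [← G.pr_same 0 r h0, G.pr_zero_eq_zero hr]

theorem sub_pr_zero_mem (r : R) : r - G.pr 0 r ∈ irrelevantIdeal 𝒜 := by
  have hr : r ∈ ⨆ d, 𝒜 d := by rw [G.iSup_eq_top]; trivial
  induction hr using Submodule.iSup_induction' with
  | zero => simp
  | add x y _ _ hx hy =>
    rw [map_add, add_sub_add_comm]
    exact Ideal.add_mem _ hx hy
  | mem e b hb =>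
    rcases Nat.eq_zero_or_pos e with rfl | he
    · rw [G.pr_same 0 b hb, sub_self]
      exact Ideal.zero_mem _
    · rw [G.pr_ne 0 e he.ne b hb, sub_zero]
      exact mem_irrelevantIdeal he hb

/-- The projections to the components of the graded maximal ideal. -/
def prPlus (d : ℕ) : irrelevantIdeal 𝒜 →ₗ[k] irrelevantIdeal 𝒜 :=
  if hd : 0 < d then
    { toFun := fun r => ⟨G.pr d r, mem_irrelevantIdeal hd (G.pr_mem d r)⟩
      map_add' := fun r s => Subtype.ext (map_add (G.pr d) (r : R) (s : R))
      map_smul' := fun c r => Subtype.ext (map_smul (G.pr d) c (r : R)) }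
  else 0

theorem prPlus_mem (d : ℕ) (r : irrelevantIdeal 𝒜) : (G.prPlus d r : R) ∈ 𝒜 d := by
  unfold prPlus
  split_ifs with hd
  · exact G.pr_mem d r
  · exact Submodule.zero_mem _

theorem prPlus_same {d : ℕ} {r : irrelevantIdeal 𝒜} (hr : (r : R) ∈ 𝒜 d) : G.prPlus d r = r := by
  unfold prPlus
  split_ifs with hd
  · exact Subtype.ext (G.pr_same d r hr)
  · obtain rfl : d = 0 := by omega
    exact (Subtype.ext (G.eq_zero_of_mem_zero r.2 hr)).symm

theorem prPlus_ne {d e : ℕ} (hde : d ≠ e) {r : irrelevantIdeal 𝒜} (hr : (r : R) ∈ 𝒜 e) :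
    G.prPlus d r = 0 := by
  unfold prPlus
  split_ifs with hd
  · exact Subtype.ext (G.pr_ne d e hde r hr)
  · rfl

/-- The projection of the bar complex to a component, induced by projections on the module. -/
def barPr (p : ℕ → M →ₗ[k] M) : (i : ℕ) → ℕ → barObj 𝒜 M i →ₗ[k] barObj 𝒜 M i
  | 0 => p
  | i + 1 => fun j => ∑ c ∈ Finset.HasAntidiagonal.antidiagonal j, TensorProduct.map (G.prPlus c.1) (barPr p i c.2)

theorem barPr_tmul (p : ℕ → M →ₗ[k] M) (i j : ℕ) (r : irrelevantIdeal 𝒜) (b : barObj 𝒜 M i) :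
    G.barPr p (i + 1) j (r ⊗ₜ[k] b)
      = ∑ c ∈ Finset.HasAntidiagonal.antidiagonal j, (G.prPlus c.1 r) ⊗ₜ[k] (G.barPr p i c.2 b) := by
  change (∑ c ∈ Finset.HasAntidiagonal.antidiagonal j, TensorProduct.map (G.prPlus c.1) (G.barPr p i c.2)) _ = _
  rw [LinearMap.sum_apply]
  rfl

theorem barPr_mem {ℳ : ℕ → Submodule k M} {p : ℕ → M →ₗ[k] M} (hp : ∀ j m, p j m ∈ ℳ j) (i j : ℕ)
    (b : barObj 𝒜 M i) : G.barPr p i j b ∈ barDeg 𝒜 ℳ i j := by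
  induction i generalizing j with
  | zero => exact hp j b
  | succ i ih =>
    induction b using TensorProduct.induction_on with
    | zero => rw [map_zero]; exact Submodule.zero_mem _
    | add x y hx hy => rw [map_add]; exact Submodule.add_mem _ hx hy
    | tmul r b =>
      rw [barPr_tmul]
      refine Submodule.sum_mem _ fun c hc => ?_
      rw [← Finset.HasAntidiagonal.mem_antidiagonal.mp hc]
      exact tmul_mem_barDeg 𝒜 (G.prPlus_mem _ _) (ih _ _)

theorem barPr_same {ℳ : ℕ → Submodule k M} {p : ℕ → M →ₗ[k] M} (hp : ∀ j, ∀ m ∈ ℳ j, p j m = m)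
    {i j : ℕ} {b : barObj 𝒜 M i} (hb : b ∈ barDeg 𝒜 ℳ i j) : G.barPr p i j b = b := by
  induction i generalizing j with
  | zero => exact hp j b hb
  | succ i ih =>
    refine sub_eq_zero.mp ((Submodule.mem_bot k).mp (barDeg_succ_le 𝒜
      (φ := G.barPr p (i + 1) j - LinearMap.id) (Q := ⊥) (fun a b hab r hr y hy => ?_) hb))
    rw [Submodule.mem_bot, LinearMap.sub_apply, barPr_tmul, LinearMap.id_apply, sub_eq_zero,
      Finset.sum_eq_single (a, b), G.prPlus_same hr, ih hy]
    · rintro ⟨a', b'⟩ h hne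
      rw [Finset.HasAntidiagonal.mem_antidiagonal] at h
      have : a' ≠ a := by
        rintro rfl
        exact hne (Prod.ext rfl (by simp at h ⊢; omega))
      rw [G.prPlus_ne this hr, TensorProduct.zero_tmul]
    · intro h
      exact absurd (Finset.HasAntidiagonal.mem_antidiagonal.mpr hab) h

theorem barMap_barPr {f : M →ₗ[R] N} {p : ℕ → M →ₗ[k] M} {q : ℕ → N →ₗ[k] N}
    (h : ∀ j m, f (p j m) = q j (f m)) (i j : ℕ) (b : barObj 𝒜 M i) :
    barMap 𝒜 f i (G.barPr p i j b) = G.barPr q i j (barMap 𝒜 f i b) := by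
  induction i generalizing j with
  | zero => exact h j b
  | succ i ih =>
    induction b using TensorProduct.induction_on with
    | zero => simp
    | add x y hx hy => rw [map_add, map_add, hx, hy, map_add, map_add]
    | tmul r b =>
      rw [barPr_tmul, barMap_tmul, barPr_tmul, map_sum]
      exact Finset.sum_congr rfl fun c _ => by rw [barMap_tmul, ih]

theorem barMul_mem_barDeg {ℳ : ℕ → Submodule k M} (hM : GradedAction 𝒜 ℳ) {i a b : ℕ}
    {r : irrelevantIdeal 𝒜} (hr : (r : R) ∈ 𝒜 a) {y : barObj 𝒜 M i} (hy : y ∈ barDeg 𝒜 ℳ i b) :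
    barMul 𝒜 M i r y ∈ barDeg 𝒜 ℳ i (a + b) := by
  cases i with
  | zero => exact hM a b _ hr _ hy
  | succ i =>
    refine barDeg_succ_le 𝒜 (φ := barMul 𝒜 M (i + 1) r) (fun c d hcd s hs y hy => ?_) hy
    rw [barMul_tmul, ← hcd, ← add_assoc]
    exact tmul_mem_barDeg 𝒜 (G.mul_mem _ _ _ hr _ hs) hy

theorem barD_mem_barDeg {ℳ : ℕ → Submodule k M} (hM : GradedAction 𝒜 ℳ) {i j : ℕ}
    {z : barObj 𝒜 M (i + 1)} (hz : z ∈ barDeg 𝒜 ℳ (i + 1) j) :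
    barD 𝒜 M i z ∈ barDeg 𝒜 ℳ i j := by
  induction i generalizing j with
  | zero =>
    refine barDeg_succ_le 𝒜 (fun a b hab r hr y hy => ?_) hz
    rw [← hab]
    exact hM a b _ hr _ hy
  | succ i ih =>
    refine barDeg_succ_le 𝒜 (fun a b hab r hr y hy => ?_) hz
    subst hab
    rw [barD_tmul]
    exact Submodule.sub_mem _ (G.barMul_mem_barDeg hM hr hy) (tmul_mem_barDeg 𝒜 hr (ih hy))

theorem barBoundaries_le_barCycles {ℳ : ℕ → Submodule k M} (hM : GradedAction 𝒜 ℳ) (i j : ℕ) :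
    barBoundaries 𝒜 ℳ i j ≤ barCycles 𝒜 ℳ i j := by
  rintro _ ⟨c, hc, rfl⟩
  cases i with
  | zero => exact G.barD_mem_barDeg hM hc
  | succ i => exact ⟨barD_barD 𝒜 i c, G.barD_mem_barDeg hM hc⟩

end ConnectedGrading

/-- A short exact sequence of graded modules. -/
structure GradedSES (𝒜 : ℕ → Submodule k R) (ℳ : ℕ → Submodule k M) (𝒩 : ℕ → Submodule k N)
    (𝒬 : ℕ → Submodule k P) (f : M →ₗ[R] N) (g : N →ₗ[R] P) : Prop where
  inj : Function.Injective f
  exact : Function.Exact f g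
  f_mem : ∀ j, ∀ m ∈ ℳ j, f m ∈ 𝒩 j
  g_mem : ∀ j, ∀ m ∈ 𝒩 j, g m ∈ 𝒬 j
  g_surj : ∀ j, ∀ y ∈ 𝒬 j, ∃ x ∈ 𝒩 j, g x = y
  action : GradedAction 𝒜 𝒩
  exists_proj : ∃ (p : ℕ → M →ₗ[k] M) (q : ℕ → N →ₗ[k] N), (∀ j m, p j m ∈ ℳ j) ∧
    (∀ j, ∀ m ∈ 𝒩 j, q j m = m) ∧ ∀ j m, f (p j m) = q j (f m)

namespace GradedSES

variable {ℳ : ℕ → Submodule k M} {𝒩 : ℕ → Submodule k N} {𝒬 : ℕ → Submodule k P}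
  {f : M →ₗ[R] N} {g : N →ₗ[R] P}

/-- Exactness provides a preimage that need not be homogeneous. Its projection to degree `j` has the
same image, because the projections of `exists_proj` commute with `f`. -/
theorem exists_lift_of_barMap_eq_zero (G : ConnectedGrading 𝒜) (h : GradedSES 𝒜 ℳ 𝒩 𝒬 f g)
    {i j : ℕ} {z : barObj 𝒜 N i} (hz : z ∈ barDeg 𝒜 𝒩 i j) (h0 : barMap 𝒜 g i z = 0) :
    ∃ y ∈ barDeg 𝒜 ℳ i j, barMap 𝒜 f i y = z := by
  obtain ⟨p, q, hp, hq, hpq⟩ := h.exists_proj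
  obtain ⟨y, rfl⟩ := (barMap_exact 𝒜 h.exact i z).mp h0
  exact ⟨G.barPr p i j y, G.barPr_mem hp i j y, by rw [G.barMap_barPr hpq, G.barPr_same hq hz]⟩

/-- This and the next three lemmas are the diagram chases for the long exact sequence of Tor in a
fixed internal degree, each stated as a vanishing of one term between two neighbours. -/
theorem torZero_mid (G : ConnectedGrading 𝒜) (h : GradedSES 𝒜 ℳ 𝒩 𝒬 f g) {i j : ℕ}
    (h1 : TorZero 𝒜 ℳ i j) (h2 : TorZero 𝒜 𝒬 i j) : TorZero 𝒜 𝒩 i j := by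
  intro z hz
  obtain ⟨c, hc, hcz⟩ := h2 (barMap_mem_barCycles 𝒜 h.g_mem hz)
  obtain ⟨b, hb, rfl⟩ := barMap_surj_barDeg 𝒜 h.g_surj hc
  have hz' : z - barD 𝒜 N i b ∈ barCycles 𝒜 𝒩 i j :=
    Submodule.sub_mem _ hz (G.barBoundaries_le_barCycles h.action i j ⟨b, hb, rfl⟩)
  obtain ⟨y, hy, hyz⟩ := h.exists_lift_of_barMap_eq_zero G
    (barCycles_le_barDeg 𝒜 _ _ _ hz') (by rw [map_sub, ← hcz, barMap_barD, sub_self])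
  rw [← hyz] at hz'
  have := barMap_mem_barBoundaries 𝒜 h.f_mem (h1 (mem_barCycles_of_barMap 𝒜 h.inj hy hz'))
  rw [hyz] at this
  have h3 : barD 𝒜 N i b ∈ barBoundaries 𝒜 𝒩 i j := ⟨b, hb, rfl⟩
  simpa using Submodule.add_mem _ this h3

theorem torZero_right_zero (h : GradedSES 𝒜 ℳ 𝒩 𝒬 f g) {j : ℕ}
    (h1 : TorZero 𝒜 𝒩 0 j) : TorZero 𝒜 𝒬 0 j := by
  intro z hz
  obtain ⟨y, hy, rfl⟩ := h.g_surj j z hz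
  exact barMap_mem_barBoundaries 𝒜 (i := 0) h.g_mem (h1 hy)

theorem torZero_right (G : ConnectedGrading 𝒜) (h : GradedSES 𝒜 ℳ 𝒩 𝒬 f g) {i j : ℕ}
    (h1 : TorZero 𝒜 𝒩 (i + 1) j) (h2 : TorZero 𝒜 ℳ i j) : TorZero 𝒜 𝒬 (i + 1) j := by
  intro z hz
  obtain ⟨y, hy, rfl⟩ := barMap_surj_barDeg 𝒜 h.g_surj (barCycles_le_barDeg 𝒜 _ _ _ hz)
  have hdy : barD 𝒜 N i y ∈ barCycles 𝒜 𝒩 i j :=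
    G.barBoundaries_le_barCycles h.action i j ⟨y, hy, rfl⟩
  obtain ⟨x, hx, hxy⟩ := h.exists_lift_of_barMap_eq_zero G (barCycles_le_barDeg 𝒜 _ _ _ hdy)
    (by rw [barMap_barD]; exact hz.1)
  rw [← hxy] at hdy
  obtain ⟨c, hc, rfl⟩ := h2 (mem_barCycles_of_barMap 𝒜 h.inj hx hdy)
  have hc' := barMap_mem_barDeg 𝒜 h.f_mem hc
  have h3 : y - barMap 𝒜 f (i + 1) c ∈ barCycles 𝒜 𝒩 (i + 1) j := by
    refine ⟨?_, Submodule.sub_mem _ hy hc'⟩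
    change barD 𝒜 N i _ = 0
    rw [map_sub, ← barMap_barD, hxy, sub_self]
  have h4 := barMap_mem_barBoundaries 𝒜 h.g_mem (h1 h3)
  rwa [map_sub, show barMap 𝒜 g (i + 1) (barMap 𝒜 f (i + 1) c) = 0 from
    (barMap_exact 𝒜 h.exact (i + 1)).apply_apply_eq_zero c, sub_zero] at h4

theorem torZero_left (G : ConnectedGrading 𝒜) (h : GradedSES 𝒜 ℳ 𝒩 𝒬 f g) {i j : ℕ}
    (h1 : TorZero 𝒜 𝒩 i j) (h2 : TorZero 𝒜 𝒬 (i + 1) j) : TorZero 𝒜 ℳ i j := by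
  intro z hz
  obtain ⟨c, hc, hcz⟩ := h1 (barMap_mem_barCycles 𝒜 h.f_mem hz)
  have hgc : barMap 𝒜 g (i + 1) c ∈ barCycles 𝒜 𝒬 (i + 1) j := by
    refine ⟨?_, barMap_mem_barDeg 𝒜 h.g_mem hc⟩
    change barD 𝒜 P i _ = 0
    rw [← barMap_barD, hcz]
    exact (barMap_exact 𝒜 h.exact i).apply_apply_eq_zero z
  obtain ⟨e, he, hec⟩ := h2 hgc
  obtain ⟨b, hb, rfl⟩ := barMap_surj_barDeg 𝒜 h.g_surj he
  obtain ⟨x, hx, hxc⟩ := h.exists_lift_of_barMap_eq_zero G (i := i + 1) (j := j)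
    (z := c - barD 𝒜 N (i + 1) b) (Submodule.sub_mem _ hc (G.barD_mem_barDeg h.action hb))
    (by rw [map_sub, ← hec, barMap_barD, sub_self])
  refine ⟨x, hx, barMap_injective 𝒜 h.inj i ?_⟩
  rw [barMap_barD, hxc, map_sub, barD_barD, sub_zero, hcz]

end GradedSES

/-! ### Free modules -/

/-- The contracting homotopy of the bar complex of a free module. -/
def barContraction (𝒜 : ℕ → Submodule k R) (s : M →ₗ[k] irrelevantIdeal 𝒜 ⊗[k] M) :
    (i : ℕ) → barObj 𝒜 M i →ₗ[k] barObj 𝒜 M (i + 1)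
  | 0 => s
  | i + 1 => -(barContraction 𝒜 s i).lTensor (irrelevantIdeal 𝒜)

theorem barContraction_tmul (s : M →ₗ[k] irrelevantIdeal 𝒜 ⊗[k] M) (i : ℕ) (r : irrelevantIdeal 𝒜)
    (b : barObj 𝒜 M i) :
    barContraction 𝒜 s (i + 1) (r ⊗ₜ[k] b) = -(r ⊗ₜ[k] barContraction 𝒜 s i b) := rfl

/-- The hypothesis `hs` is the homotopy identity on R₊ ⊗ M. It propagates to longer tensors because
the contraction acts on the last factor, hence commutes with multiplication on the first one, and
the sign matches that of the differential. -/
theorem barContraction_homotopy {s : M →ₗ[k] irrelevantIdeal 𝒜 ⊗[k] M}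
    (hs : ∀ (r : irrelevantIdeal 𝒜) (m : M), s ((r : R) • m)
      = barMul 𝒜 M 1 r (s m) + r ⊗ₜ[k] (m - barD 𝒜 M 0 (s m))) (i : ℕ) (b : barObj 𝒜 M (i + 1)) :
    barD 𝒜 M (i + 1) (barContraction 𝒜 s (i + 1) b) + barContraction 𝒜 s i (barD 𝒜 M i b) = b := by
  induction i with
  | zero =>
    induction b using TensorProduct.induction_on with
    | zero => simp
    | add x y hx hy =>
      conv_rhs => rw [← hx, ← hy]
      simp only [map_add]
      abel
    | tmul r m =>
      rw [barContraction_tmul, map_neg, barD_tmul, barD_tmul_zero]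
      change -(barMul 𝒜 M 1 r (s m) - r ⊗ₜ[k] barD 𝒜 M 0 (s m)) + s ((r : R) • m) = _
      rw [hs, TensorProduct.tmul_sub]
      abel
  | succ i ih =>
    induction b using TensorProduct.induction_on with
    | zero => simp
    | add x y hx hy =>
      conv_rhs => rw [← hx, ← hy]
      simp only [map_add]
      abel
    | tmul r b =>
      have h1 : barContraction 𝒜 s (i + 1) (barMul 𝒜 M (i + 1) r b)
          = barMul 𝒜 M (i + 2) r (barContraction 𝒜 s (i + 1) b) := by
        induction b using TensorProduct.induction_on with
        | zero => simp
        | add x y hx hy => rw [map_add, map_add, hx, hy, map_add, map_add]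
        | tmul u v => rw [barMul_tmul, barContraction_tmul, barContraction_tmul, map_neg]; rfl
      rw [barContraction_tmul, map_neg, barD_tmul, barD_tmul, map_sub, h1, barContraction_tmul]
      conv_rhs => rw [← ih b, TensorProduct.tmul_add]
      abel

theorem torZero_of_contraction {ℳ : ℕ → Submodule k M} {s : M →ₗ[k] irrelevantIdeal 𝒜 ⊗[k] M}
    (hs : ∀ (r : irrelevantIdeal 𝒜) (m : M), s ((r : R) • m)
      = barMul 𝒜 M 1 r (s m) + r ⊗ₜ[k] (m - barD 𝒜 M 0 (s m)))
    (hdeg : ∀ j, ∀ m ∈ ℳ j, s m ∈ barDeg 𝒜 ℳ 1 j) (i j : ℕ) : TorZero 𝒜 ℳ (i + 1) j := by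
  have hd : ∀ i j, ∀ z ∈ barDeg 𝒜 ℳ i j, barContraction 𝒜 s i z ∈ barDeg 𝒜 ℳ (i + 1) j := by
    intro i
    induction i with
    | zero => exact hdeg
    | succ i ih =>
      intro j z hz
      refine barDeg_succ_le 𝒜 (fun a b hab r hr y hy => ?_) hz
      subst hab
      rw [barContraction_tmul]
      exact Submodule.neg_mem _ (tmul_mem_barDeg 𝒜 hr (ih b y hy))
  intro z hz
  refine ⟨_, hd _ _ _ hz.2, ?_⟩
  have := barContraction_homotopy hs i z
  rwa [show barD 𝒜 M i z = 0 from hz.1, map_zero, add_zero] at this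

theorem ConnectedGrading.gradedAction (G : ConnectedGrading 𝒜) : GradedAction 𝒜 𝒜 := G.mul_mem

/-- A graded algebra is a free module over itself. -/
theorem ConnectedGrading.torZero_self (G : ConnectedGrading 𝒜) {i j : ℕ} (h : (i, j) ≠ (0, 0)) :
    TorZero 𝒜 𝒜 i j := by
  cases i with
  | zero =>
    have hj : 0 < j := by
      rcases Nat.eq_zero_or_pos j with rfl | hj
      · exact absurd rfl h
      · exact hj
    intro z hz
    refine ⟨(⟨z, mem_irrelevantIdeal hj hz⟩ : irrelevantIdeal 𝒜) ⊗ₜ[k] (1 : R), ?_, ?_⟩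
    · exact tmul_mem_barDeg 𝒜 (i := 0) (ℳ := 𝒜) (a := j) (b := 0)
        (r := ⟨z, mem_irrelevantIdeal hj hz⟩) hz G.one_mem
    · exact mul_one z
  | succ i =>
    -- The contraction sends m to (m - m₀) ⊗ 1, where m₀ is the component of degree 0. As m₀ is a
    -- scalar c, the correction r ⊗ m₀ equals (c r) ⊗ 1, which gives the homotopy identity.
    let q : R →ₗ[k] irrelevantIdeal 𝒜 :=
      { toFun := fun r => ⟨r - G.pr 0 r, G.sub_pr_zero_mem r⟩
        map_add' := fun r s => Subtype.ext (by simp [add_sub_add_comm])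
        map_smul' := fun c r => Subtype.ext (by simp [smul_sub]) }
    refine torZero_of_contraction (s := (TensorProduct.mk k (irrelevantIdeal 𝒜) R).flip 1 ∘ₗ q)
      (fun r m => ?_) (fun j m hm => ?_) i j
    · obtain ⟨c, hc⟩ := G.zero_le _ (G.pr_mem 0 m)
      change q ((r : R) * m) ⊗ₜ[k] (1 : R) = ((r : R) • q m) ⊗ₜ[k] (1 : R)
        + r ⊗ₜ[k] (m - (m - G.pr 0 m) * 1)
      have h1 : q ((r : R) * m) = (r : R) • q m + c • r := by
        apply Subtype.ext
        change (r : R) * m - G.pr 0 (r * m) = r * (m - G.pr 0 m) + c • (r : R)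
        rw [G.pr_zero_eq_zero (Ideal.mul_mem_right _ _ r.2), hc, Algebra.smul_def]
        ring
      rw [h1, mul_one, sub_sub_cancel, hc, Algebra.algebraMap_eq_smul_one, TensorProduct.add_tmul,
        TensorProduct.smul_tmul c r (1 : R)]
    · refine tmul_mem_barDeg 𝒜 (i := 0) (ℳ := 𝒜) (b := 0) (r := q m) (a := j) ?_ G.one_mem
      change m - G.pr 0 m ∈ 𝒜 j
      rcases Nat.eq_zero_or_pos j with rfl | hj
      · exact Submodule.sub_mem _ hm (G.pr_mem 0 m)
      · rwa [G.pr_ne 0 j hj.ne m hm, sub_zero]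

/-! ### Multiplication acts trivially on Tor -/

/-- Insertion of an element of `R₊` into the bar complex at all places, with signs. -/
def barInsert (M : Type u) [AddCommGroup M] [Module k M] [Module R M] [IsScalarTower k R M]
    (x : irrelevantIdeal 𝒜) : (i : ℕ) → barObj 𝒜 M i →ₗ[k] barObj 𝒜 M (i + 1)
  | 0 => TensorProduct.mk k (irrelevantIdeal 𝒜) M x
  | i + 1 => TensorProduct.mk k (irrelevantIdeal 𝒜) (barObj 𝒜 M (i + 1)) x
      - (barInsert M x i).lTensor (irrelevantIdeal 𝒜)

theorem barInsert_zero (x : irrelevantIdeal 𝒜) (m : M) : barInsert M x 0 m = x ⊗ₜ[k] m := rfl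

theorem barInsert_tmul (x r : irrelevantIdeal 𝒜) (i : ℕ) (b : barObj 𝒜 M i) :
    barInsert M x (i + 1) (r ⊗ₜ[k] b)
      = x ⊗ₜ[k] (r ⊗ₜ[k] b : irrelevantIdeal 𝒜 ⊗[k] barObj 𝒜 M i)
        - r ⊗ₜ[k] barInsert M x i b := rfl

/-- Inserting x at all places is a null-homotopy of multiplication by x on the module: by
commutativity the terms in which x merges with a neighbour cancel in pairs, and only the term in
which x acts on M remains. -/
theorem barInsert_homotopy (x : irrelevantIdeal 𝒜) (i : ℕ) (b : barObj 𝒜 M (i + 1)) :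
    barD 𝒜 M (i + 1) (barInsert M x (i + 1) b) + barInsert M x i (barD 𝒜 M i b)
      = barMap 𝒜 (LinearMap.lsmul R M (x : R)) (i + 1) b := by
  -- Insertion commutes with left multiplication by r except at the first place, where x stands to
  -- the left of r.
  have key : ∀ (i : ℕ) (r : irrelevantIdeal 𝒜) (b : barObj 𝒜 M i),
      barInsert M x i (barMul 𝒜 M i r b) - barMul 𝒜 M (i + 1) r (barInsert M x i b)
        = x ⊗ₜ[k] barMul 𝒜 M i r b - ((r : R) • x) ⊗ₜ[k] b := by
    intro i r b
    cases i with
    | zero => rfl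
    | succ i =>
      induction b using TensorProduct.induction_on with
      | zero => simp
      | add y z hy hz =>
        simp only [map_add, TensorProduct.tmul_add]
        rw [add_sub_add_comm, hy, hz]
        abel
      | tmul s c =>
        rw [barMul_tmul, barInsert_tmul, barInsert_tmul, map_sub, barMul_tmul, barMul_tmul]
        abel
  have hcomm : ∀ r : irrelevantIdeal 𝒜, (x : R) • r = (r : R) • x := fun r =>
    Subtype.ext (mul_comm (x : R) (r : R))
  induction i with
  | zero =>
    induction b using TensorProduct.induction_on with
    | zero => simp
    | add y z hy hz =>
      rw [map_add (barMap _ _ _), ← hy, ← hz]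
      simp only [map_add]
      abel
    | tmul r m =>
      rw [barInsert_tmul, map_sub, barD_tmul, barD_tmul, barMap_tmul, barInsert_zero, barMul_tmul,
        barD_tmul_zero, barD_tmul_zero, barInsert_zero, barMul_tmul, hcomm]
      change _ = r ⊗ₜ[k] ((x : R) • m)
      abel
  | succ i ih =>
    induction b using TensorProduct.induction_on with
    | zero => simp
    | add y z hy hz =>
      rw [map_add (barMap _ _ _), ← hy, ← hz]
      simp only [map_add]
      abel
    | tmul r b =>
      rw [barMap_tmul, ← ih b, barInsert_tmul, map_sub, barD_tmul, barD_tmul, barD_tmul, map_sub,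
        barInsert_tmul, TensorProduct.tmul_add, TensorProduct.tmul_sub, barMul_tmul, hcomm]
      have := key (i + 1) r b
      rw [sub_eq_sub_iff_add_eq_add] at this
      rw [eq_sub_of_add_eq this]
      abel

theorem barInsert_mem_barDeg {ℳ : ℕ → Submodule k M} {x : irrelevantIdeal 𝒜}
    {e : ℕ} (hx : (x : R) ∈ 𝒜 e) {i j : ℕ} {b : barObj 𝒜 M i} (hb : b ∈ barDeg 𝒜 ℳ i j) :
    barInsert M x i b ∈ barDeg 𝒜 ℳ (i + 1) (e + j) := by
  induction i generalizing j with
  | zero => exact tmul_mem_barDeg 𝒜 (i := 0) hx hb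
  | succ i ih =>
    refine barDeg_succ_le 𝒜 (φ := barInsert M x (i + 1)) (fun a c hac r hr y hy => ?_) hb
    subst hac
    rw [barInsert_tmul]
    refine Submodule.sub_mem _ (tmul_mem_barDeg 𝒜 hx (tmul_mem_barDeg 𝒜 hr hy)) ?_
    rw [add_left_comm]
    exact tmul_mem_barDeg 𝒜 hr (ih hy)

/-- The grading of the shifted module `M(-e)`. -/
def shiftGrading {M : Type u} [AddCommGroup M] [Module k M] (e : ℕ) (ℳ : ℕ → Submodule k M)
    (j : ℕ) : Submodule k M :=
  if e ≤ j then ℳ (j - e) else ⊥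

theorem shiftGrading_add {M : Type u} [AddCommGroup M] [Module k M] (e : ℕ)
    (ℳ : ℕ → Submodule k M) (j : ℕ) : shiftGrading e ℳ (j + e) = ℳ j := by
  rw [shiftGrading, if_pos (Nat.le_add_left e j), Nat.add_sub_cancel]

theorem barDeg_shiftGrading (e : ℕ) (ℳ : ℕ → Submodule k M) (i j : ℕ) :
    barDeg 𝒜 (shiftGrading e ℳ) i j = shiftGrading (M := barObj 𝒜 M i) e (barDeg 𝒜 ℳ i) j := by
  induction i generalizing j with
  | zero => rfl
  | succ i ih =>
    apply le_antisymm
    · refine Submodule.span_le.mpr ?_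
      rintro _ ⟨a, b, hab, r, hr, y, hy, rfl⟩
      rw [ih] at hy
      by_cases hb : e ≤ b
      · rw [shiftGrading, if_pos hb] at hy
        rw [SetLike.mem_coe, shiftGrading, if_pos (by omega), show j - e = a + (b - e) by omega]
        exact tmul_mem_barDeg 𝒜 hr hy
      · rw [shiftGrading, if_neg hb, Submodule.mem_bot] at hy
        rw [hy, TensorProduct.tmul_zero]
        exact Submodule.zero_mem _
    · by_cases hj : e ≤ j
      · rw [shiftGrading, if_pos hj]
        refine Submodule.span_le.mpr ?_
        rintro _ ⟨a, b, hab, r, hr, y, hy, rfl⟩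
        rw [show j = a + (b + e) by omega]
        refine tmul_mem_barDeg 𝒜 hr ?_
        rwa [ih, shiftGrading_add]
      · rw [shiftGrading, if_neg hj]
        exact bot_le

theorem TorZero.shift {ℳ : ℕ → Submodule k M} {i j : ℕ} (h : TorZero 𝒜 ℳ i j) (e : ℕ) :
    TorZero 𝒜 (shiftGrading e ℳ) i (j + e) := by
  have h1 : ∀ i, barDeg 𝒜 (shiftGrading e ℳ) i (j + e) = barDeg 𝒜 ℳ i j := fun i => by
    rw [barDeg_shiftGrading, shiftGrading_add]
  have h2 : barCycles 𝒜 (shiftGrading e ℳ) i (j + e) = barCycles 𝒜 ℳ i j := by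
    cases i with
    | zero => exact h1 0
    | succ i =>
      change _ ⊓ barDeg 𝒜 (shiftGrading e ℳ) (i + 1) (j + e) = _
      rw [h1]
      rfl
  rw [TorZero, h2, barBoundaries, h1]
  exact h

/-- If `x` is a homogeneous nonzerodivisor on `M`, then vanishing of `Tor` passes from `M / xM`
to `M`. -/
theorem TorZero.of_nonzerodivisor (G : ConnectedGrading 𝒜) {ℳ : ℕ → Submodule k M}
    {𝒬 : ℕ → Submodule k P} {x : irrelevantIdeal 𝒜} {e : ℕ} (hx : (x : R) ∈ 𝒜 e) {g : M →ₗ[R] P}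
    (h : GradedSES 𝒜 (shiftGrading e ℳ) ℳ 𝒬 (LinearMap.lsmul R M (x : R)) g) {i j : ℕ}
    (h2 : TorZero 𝒜 𝒬 i j) : TorZero 𝒜 ℳ i j := by
  intro z hz
  obtain ⟨c, hc, hcz⟩ := h2 (barMap_mem_barCycles 𝒜 h.g_mem hz)
  obtain ⟨b, hb, rfl⟩ := barMap_surj_barDeg 𝒜 h.g_surj hc
  have hz' : z - barD 𝒜 M i b ∈ barCycles 𝒜 ℳ i j :=
    Submodule.sub_mem _ hz (G.barBoundaries_le_barCycles h.action i j ⟨b, hb, rfl⟩)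
  obtain ⟨y, hy, hyz⟩ := h.exists_lift_of_barMap_eq_zero G
    (barCycles_le_barDeg 𝒜 _ _ _ hz') (by rw [map_sub, ← hcz, barMap_barD, sub_self])
  rw [← hyz] at hz'
  have hyc := mem_barCycles_of_barMap 𝒜 h.inj hy hz'
  have h3 : barInsert M x i y ∈ barDeg 𝒜 ℳ (i + 1) j := by
    rw [barDeg_shiftGrading, shiftGrading] at hy
    split_ifs at hy with hej
    · obtain ⟨l, rfl⟩ := Nat.exists_eq_add_of_le hej
      rw [Nat.add_sub_cancel_left] at hy
      exact barInsert_mem_barDeg hx hy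
    · rw [(Submodule.mem_bot k).mp hy, map_zero]
      exact Submodule.zero_mem _
  -- The cycle z differs by a boundary from x times a cycle y, and the insertion of x into y has
  -- boundary x y. So z itself is a boundary, with no assumption on the Tor of the submodule x M.
  have h4 : barD 𝒜 M i (barInsert M x i y) = z - barD 𝒜 M i b := by
    rw [← hyz]
    cases i with
    | zero => rfl
    | succ i =>
      rw [← barInsert_homotopy, show barD 𝒜 M i y = 0 from hyc.1, map_zero, add_zero]
  exact ⟨barInsert M x i y + b, Submodule.add_mem _ h3 hb, by rw [map_add, h4, sub_add_cancel]⟩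

end Graded

/-! ### Change of rings -/

section ChangeOfRings

variable {k : Type u} [Field k] {R : Type u} [CommRing R] [Algebra k R] {𝓡 : ℕ → Submodule k R}
  {A : Type u} [CommRing A] [Algebra k A] [Algebra R A] [IsScalarTower k R A]
  {𝒜 : ℕ → Submodule k A}

/-- Projections to the homogeneous components of a graded vector space. -/
structure GradedProj {N : Type u} [AddCommGroup N] [Module k N] (𝒩 : ℕ → Submodule k N) where
  /-- The projections. -/
  pr : ℕ → N →ₗ[k] N
  pr_mem : ∀ d r, pr d r ∈ 𝒩 d
  pr_same : ∀ d, ∀ r ∈ 𝒩 d, pr d r = r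
  pr_ne : ∀ d e, d ≠ e → ∀ r ∈ 𝒩 e, pr d r = 0

/-- The grading of a finite free module with generators of degree `e`. -/
def freeGrading (𝒜 : ℕ → Submodule k A) (e r j : ℕ) : Submodule k (Fin r → A) :=
  Submodule.pi Set.univ fun _ => shiftGrading e 𝒜 j

theorem mem_freeGrading {e r j : ℕ} {f : Fin r → A} :
    f ∈ freeGrading 𝒜 e r j ↔ ∀ s, f s ∈ shiftGrading e 𝒜 j := by
  simp [freeGrading, Submodule.mem_pi]

/-- The projections of a shifted module. -/
def GradedProj.shift {N : Type u} [AddCommGroup N] [Module k N] {𝒩 : ℕ → Submodule k N}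
    (p : GradedProj 𝒩) (e : ℕ) : GradedProj (shiftGrading e 𝒩) where
  pr j := if e ≤ j then p.pr (j - e) else 0
  pr_mem j r := by
    unfold shiftGrading
    split_ifs
    · exact p.pr_mem _ _
    · exact Submodule.zero_mem _
  pr_same j r hr := by
    unfold shiftGrading at hr
    split_ifs at hr ⊢
    · exact p.pr_same _ _ hr
    · exact ((Submodule.mem_bot k).mp hr).symm
  pr_ne d j hdj r hr := by
    unfold shiftGrading at hr
    split_ifs at hr ⊢
    · exact p.pr_ne _ _ (by omega) _ hr
    · rw [(Submodule.mem_bot k).mp hr, map_zero]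
    · rfl
    · rfl

/-- The projections of a finite free module. -/
def GradedProj.free (p : GradedProj 𝒜) (e r : ℕ) : GradedProj (freeGrading 𝒜 e r) where
  pr j := LinearMap.pi fun s => (p.shift e).pr j ∘ₗ LinearMap.proj s
  pr_mem j _ := mem_freeGrading.mpr fun _ => (p.shift e).pr_mem j _
  pr_same j _ hf := funext fun s => (p.shift e).pr_same j _ (mem_freeGrading.mp hf s)
  pr_ne d j hdj _ hf := funext fun s => (p.shift e).pr_ne d j hdj _ (mem_freeGrading.mp hf s)

/-- The projections of a connected grading. -/
def ConnectedGrading.proj (G : ConnectedGrading 𝒜) : GradedProj 𝒜 :=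
  ⟨G.pr, G.pr_mem, G.pr_same, G.pr_ne⟩

theorem GradedAction.shift {N : Type u} [AddCommGroup N] [Module k N] [Module A N]
    [IsScalarTower k A N] {𝒩 : ℕ → Submodule k N} (h : GradedAction 𝒜 𝒩) (e : ℕ) :
    GradedAction 𝒜 (shiftGrading e 𝒩) := by
  intro a b x hx m hm
  unfold shiftGrading at hm ⊢
  split_ifs at hm with hb
  · rw [if_pos (by omega), Nat.add_sub_assoc hb]
    exact h a _ x hx m hm
  · rw [(Submodule.mem_bot k).mp hm, smul_zero]
    exact Submodule.zero_mem _

theorem ConnectedGrading.gradedAction_free (G : ConnectedGrading 𝒜) (e r : ℕ) :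
    GradedAction 𝒜 (freeGrading 𝒜 e r) := fun a b x hx f hf =>
  mem_freeGrading.mpr fun s => G.gradedAction.shift e a b x hx (f s) (mem_freeGrading.mp hf s)

theorem TorZero.free {i j : ℕ} (h : TorZero 𝓡 𝒜 i j) (e r : ℕ) :
    TorZero 𝓡 (freeGrading 𝒜 e r) i (j + e) := by
  refine TorZero.of_decomposition 𝓡 Finset.univ (h.shift e) (fun s => LinearMap.proj s)
    (fun s => LinearMap.single R (fun _ => A) s) (fun s j m hm => mem_freeGrading.mp hm s)
    (fun s j m hm => mem_freeGrading.mpr fun s' => ?_) ?_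
  · by_cases hs : s' = s
    · subst hs; simpa using hm
    · simp [Pi.single_eq_of_ne hs]
  · refine LinearMap.ext fun f => ?_
    simp only [LinearMap.sum_apply, LinearMap.comp_apply, LinearMap.proj_apply,
      LinearMap.id_apply]
    exact Finset.univ_sum_single f

/-- If `R → A` is a homomorphism of graded algebras such that `A` has regularity at most one over
`R`, then the regularity over `A` of a module generated in a single degree, if it has a linear
resolution over `R`, is that degree. -/
theorem TorZero.change_of_rings (GR : ConnectedGrading 𝓡) (GA : ConnectedGrading 𝒜)
    (halg : ∀ d, ∀ r ∈ 𝓡 d, algebraMap R A r ∈ 𝒜 d) (hfin : ∀ d, Module.Finite k (𝒜 d))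
    (hA : ∀ i j, i + 1 < j → TorZero 𝓡 𝒜 i j) (i : ℕ) :
    ∀ (e : ℕ) (N : Type u) [AddCommGroup N] [Module k N] [Module R N] [Module A N]
      [IsScalarTower k R N] [IsScalarTower k A N] [IsScalarTower R A N] (𝒩 : ℕ → Submodule k N)
      (_ : GradedProj 𝒩), GradedAction 𝒜 𝒩 → (∀ d, Module.Finite k (𝒩 d)) →
      (∀ j < e, 𝒩 j = ⊥) → (∀ i j, i + e < j → TorZero 𝓡 𝒩 i j) →
      ∀ j, i + e < j → TorZero 𝒜 𝒩 i j := by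
  induction i with
  | zero =>
    intro e N _ _ _ _ _ _ _ 𝒩 p hact hfinN hlow hN j hj z hz
    obtain ⟨c, hc, hcz⟩ := hN 0 j hj hz
    -- In homological degree 0: what is generated from lower degrees by R₊ is so a fortiori by A₊.
    rw [← hcz]
    refine barDeg_succ_le 𝓡 (φ := barD 𝓡 N 0) (fun a b hab r hr y hy => ?_) hc
    rw [barD_tmul_zero]
    rcases Nat.eq_zero_or_pos a with rfl | ha
    · rw [GR.eq_zero_of_mem_zero r.2 hr, zero_smul]
      exact Submodule.zero_mem _
    · rw [← hab]
      refine ⟨(⟨algebraMap R A r, mem_irrelevantIdeal ha (halg a _ hr)⟩ : irrelevantIdeal 𝒜) ⊗ₜ[k]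
        (y : N), tmul_mem_barDeg 𝒜 (i := 0) (ℳ := 𝒩) (halg a _ hr) hy, ?_⟩
      exact algebraMap_smul A (r : R) (y : N)
  | succ i ih =>
    intro e N _ _ _ _ _ _ _ 𝒩 p hact hfinN hlow hN j hj
    have := hfinN e
    -- Cover N by the free module F with one generator of degree e for each basis vector of N_e. The
    -- kernel K starts in degree e + 1 and inherits all hypotheses with e + 1 in place of e, so the
    -- induction on i applies to it.
    let b := Module.finBasis k (𝒩 e)
    let r := Module.finrank k (𝒩 e)
    let F := Fin r → A
    let ℱ := freeGrading 𝒜 e r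
    let pF : GradedProj ℱ := GA.proj.free e r
    let g : F →ₗ[A] N := Fintype.linearCombination A fun s => ((b s : 𝒩 e) : N)
    have hg : ∀ f, g f = ∑ s, f s • ((b s : 𝒩 e) : N) := fun f => rfl
    have hFA : GradedAction 𝒜 ℱ := GA.gradedAction_free e r
    have hgmem : ∀ j, ∀ f ∈ ℱ j, g f ∈ 𝒩 j := by
      intro j f hf
      rw [hg]
      refine Submodule.sum_mem _ fun s _ => ?_
      have := mem_freeGrading.mp hf s
      unfold shiftGrading at this
      split_ifs at this with hej
      · have h1 := hact _ _ _ this _ (b s).2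
        rwa [Nat.sub_add_cancel hej] at h1
      · rw [(Submodule.mem_bot k).mp this, zero_smul]
        exact Submodule.zero_mem _
    have hgpr : ∀ j f, g (pF.pr j f) = p.pr j (g f) := by
      intro j f
      rw [hg, hg, map_sum]
      refine Finset.sum_congr rfl fun s _ => ?_
      change (GA.proj.shift e).pr j (f s) • _ = _
      generalize f s = x
      have hr : x ∈ ⨆ d, 𝒜 d := by rw [GA.iSup_eq_top]; trivial
      induction hr using Submodule.iSup_induction' with
      | zero => simp
      | add x y _ _ hx hy => rw [map_add, add_smul, hx, hy, add_smul, map_add]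
      | mem d a ha =>
        have h1 := hact _ _ _ ha _ (b s).2
        have ha' : a ∈ shiftGrading e 𝒜 (d + e) := by rwa [shiftGrading_add]
        by_cases hjd : j = d + e
        · subst hjd
          rw [p.pr_same _ _ h1, (GA.proj.shift e).pr_same _ _ ha']
        · rw [p.pr_ne _ _ hjd _ h1, (GA.proj.shift e).pr_ne _ _ hjd _ ha', zero_smul]
    have hgsurj : ∀ j, ∀ y ∈ 𝒩 j, ∃ f ∈ ℱ j, g f = y := by
      -- Surjectivity in degree j: the degree e is covered by construction, and above it N is
      -- generated from lower degrees since Tor₀ over R vanishes there.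
      intro j
      induction j using Nat.strong_induction_on with
      | _ j ihj =>
        intro y hy
        rcases lt_trichotomy j e with hlt | rfl | hgt
        · rw [hlow j hlt, Submodule.mem_bot] at hy
          exact ⟨0, Submodule.zero_mem _, by rw [map_zero, hy]⟩
        · refine ⟨fun s => algebraMap k A (b.repr ⟨y, hy⟩ s), mem_freeGrading.mpr fun s => ?_, ?_⟩
          · have := shiftGrading_add j 𝒜 0
            rw [zero_add] at this
            rw [this, Algebra.algebraMap_eq_smul_one]
            exact Submodule.smul_mem _ _ GA.one_mem
          · rw [hg]
            have h1 := congrArg Subtype.val (b.sum_repr ⟨y, hy⟩)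
            rw [AddSubmonoidClass.coe_finsetSum] at h1
            refine Eq.trans ?_ h1
            exact Finset.sum_congr rfl fun s _ => by rw [algebraMap_smul]; rfl
        · obtain ⟨c, hc, hcz⟩ := hN 0 j (by omega) (show y ∈ barCycles 𝓡 𝒩 0 j from hy)
          rw [← hcz]
          change barD 𝓡 N 0 c ∈ (ℱ j).map (g.restrictScalars k)
          refine barDeg_succ_le 𝓡 (φ := barD 𝓡 N 0) (fun a b hab r hr y hy => ?_) hc
          rw [barD_tmul_zero]
          rcases Nat.eq_zero_or_pos a with rfl | ha
          · rw [GR.eq_zero_of_mem_zero r.2 hr, zero_smul]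
            exact Submodule.zero_mem _
          · obtain ⟨f, hf, hfy⟩ := ihj b (by omega) y hy
            refine ⟨algebraMap R A r • f, ?_, ?_⟩
            · rw [← hab]
              exact hFA a b _ (halg a _ hr) f hf
            · change g (algebraMap R A r • f) = _
              rw [map_smul, hfy]
              exact algebraMap_smul A (r : R) (y : N)
    let K := LinearMap.ker g
    let 𝒦 : ℕ → Submodule k K := fun j => (ℱ j).comap (K.subtype.restrictScalars k)
    have hKpr : ∀ j (x : K), pF.pr j (x : F) ∈ K := fun j x => by
      change g _ = 0
      rw [hgpr, show g (x : F) = 0 from x.2, map_zero]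
    let pK : GradedProj 𝒦 :=
      { pr := fun j =>
          { toFun := fun x => ⟨pF.pr j (x : F), hKpr j x⟩
            map_add' := fun x y => Subtype.ext (map_add (pF.pr j) (x : F) (y : F))
            map_smul' := fun c x => Subtype.ext (map_smul (pF.pr j) c (x : F)) }
        pr_mem := fun j x => pF.pr_mem j (x : F)
        pr_same := fun j x hx => Subtype.ext (pF.pr_same j (x : F) hx)
        pr_ne := fun d j hdj x hx => Subtype.ext (pF.pr_ne d j hdj (x : F) hx) }
    have hses : GradedSES 𝒜 𝒦 ℱ 𝒩 K.subtype g :=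
      { inj := K.injective_subtype
        exact := LinearMap.exact_subtype_ker_map g
        f_mem := fun j m hm => hm
        g_mem := hgmem
        g_surj := hgsurj
        action := hFA
        exists_proj := ⟨pK.pr, pF.pr, pK.pr_mem, pF.pr_same, fun j m => rfl⟩ }
    have hsesR : GradedSES 𝓡 𝒦 ℱ 𝒩 (K.subtype.restrictScalars R) (g.restrictScalars R) :=
      { inj := hses.inj
        exact := hses.exact
        f_mem := hses.f_mem
        g_mem := hses.g_mem
        g_surj := hses.g_surj
        action := fun a b x hx m hm => by
          rw [← algebraMap_smul A x m]
          exact hFA a b _ (halg a x hx) m hm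
        exists_proj := hses.exists_proj }
    have hjF : ∀ {i j}, (i, j) ≠ (0, e) → i + e ≤ j → TorZero 𝒜 ℱ i j := by
      intro i j hij hle
      obtain ⟨l, rfl⟩ := Nat.exists_eq_add_of_le' (show e ≤ j by omega)
      refine TorZero.free (GA.torZero_self fun h => hij ?_) e r
      rw [Prod.mk.injEq] at h ⊢
      omega
    refine hses.torZero_right GA (hjF (by simp) (by omega)) ?_
    refine ih (e + 1) K 𝒦 pK (fun a b x hx m hm => hFA a b x hx _ hm) (fun d => ?_) ?_ ?_ j (by omega)
    · have := hfin (d - e)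
      have : Module.Finite k (shiftGrading e 𝒜 d) := by
        by_cases hed : e ≤ d
        · rwa [shiftGrading, if_pos hed]
        · rw [shiftGrading, if_neg hed]
          infer_instance
      let φ : 𝒦 d →ₗ[k] (Fin r → shiftGrading e 𝒜 d) :=
        { toFun := fun x s => ⟨(x : K).1 s, mem_freeGrading.mp x.2 s⟩
          map_add' := fun x y => rfl
          map_smul' := fun c x => rfl }
      refine Module.Finite.of_injective φ fun x y hxy => ?_
      refine Subtype.ext (Subtype.ext (funext fun s => ?_))
      exact congrArg Subtype.val (congrFun hxy s)
    · intro j hj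
      rw [eq_bot_iff]
      intro x hx
      rw [Submodule.mem_bot]
      apply Subtype.ext
      rcases Nat.lt_succ_iff_lt_or_eq.mp hj with hlt | rfl
      · funext s
        have := mem_freeGrading.mp hx s
        rw [shiftGrading, if_neg (by omega)] at this
        exact (Submodule.mem_bot k).mp this
      -- In degree e the map F → N is the isomorphism given by the basis `b`, so K vanishes there
      -- too.
      · have h0 : ∀ s, ∃ c : k, (x : F) s = algebraMap k A c := fun s => by
          have h1 := mem_freeGrading.mp hx s
          have := shiftGrading_add j 𝒜 0
          rw [zero_add] at this
          rw [this] at h1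
          exact GA.zero_le _ h1
        choose c hc using h0
        have h1 : ∑ s, c s • b s = 0 := by
          apply Subtype.ext
          rw [AddSubmonoidClass.coe_finsetSum]
          refine Eq.trans ?_ (show g (x : F) = 0 from x.2)
          rw [hg]
          exact Finset.sum_congr rfl fun s _ => by rw [hc, algebraMap_smul]; rfl
        funext s
        rw [hc, Fintype.linearIndependent_iff.mp b.linearIndependent c h1 s, map_zero]
        rfl
    · intro i j hij
      -- Over R, Tor_i(K) lies between Tor_{i+1}(N) and Tor_i(F). Since reg_R A ≤ 1, both vanish in
      -- degrees above i + e + 1.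
      refine hsesR.torZero_left GR ?_ (hN (i + 1) j (by omega))
      obtain ⟨l, rfl⟩ := Nat.exists_eq_add_of_le' (show e ≤ j by omega)
      exact TorZero.free (hA i l (by omega)) e r

end ChangeOfRings

/-! ### The polynomial ring -/

section Polynomial

variable (σ : Type) (k : Type u) [Field k]

/-- The standard grading of the polynomial ring. -/
def polynomialGrading : ConnectedGrading (MvPolynomial.homogeneousSubmodule σ k) where
  pr := MvPolynomial.homogeneousComponent
  pr_mem := MvPolynomial.homogeneousComponent_isHomogeneous
  pr_same d r hr := by rw [MvPolynomial.homogeneousComponent_of_mem hr, if_pos rfl]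
  pr_ne d e hde r hr := by rw [MvPolynomial.homogeneousComponent_of_mem hr, if_neg hde]
  one_mem := MvPolynomial.isHomogeneous_one σ k
  mul_mem _ _ _ hx _ hy := MvPolynomial.IsHomogeneous.mul hx hy
  zero_le x hx := ⟨x.coeff 0, MvPolynomial.totalDegree_eq_zero_iff_eq_C.mp
    (Nat.le_zero.mp hx.totalDegree_le)⟩
  iSup_eq_top := by
    refine eq_top_iff.mpr fun p _ => ?_
    rw [← MvPolynomial.sum_homogeneousComponent p]
    exact Submodule.sum_mem _ fun d _ => Submodule.mem_iSup_of_mem d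
      (MvPolynomial.homogeneousComponent_isHomogeneous d p)

variable {σ k}

theorem X_mem_irrelevantIdeal (v : σ) :
    (MvPolynomial.X v : MvPolynomial σ k) ∈
      irrelevantIdeal (MvPolynomial.homogeneousSubmodule σ k) :=
  mem_irrelevantIdeal one_pos (MvPolynomial.isHomogeneous_X k v)

/-- A variable, as an element of the graded maximal ideal. -/
def varPlus (v : σ) : irrelevantIdeal (MvPolynomial.homogeneousSubmodule σ k) :=
  ⟨MvPolynomial.X v, X_mem_irrelevantIdeal v⟩

open Classical in
/-- The substitution of `0` for the variables in a list. -/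
def killVars (l : List σ) : MvPolynomial σ k →ₐ[k] MvPolynomial σ k :=
  MvPolynomial.aeval fun w => if w ∈ l then 0 else MvPolynomial.X w

theorem killVars_nil : killVars (k := k) ([] : List σ) = AlgHom.id k _ := by
  ext; simp [killVars]

theorem X_dvd_killVars_sub (v : σ) (l : List σ) (p : MvPolynomial σ k) :
    MvPolynomial.X v ∣ killVars l p - killVars (v :: l) p := by
  rw [← Ideal.mem_span_singleton, ← Ideal.Quotient.eq]
  change ((Ideal.Quotient.mkₐ k (Ideal.span {MvPolynomial.X v})).comp (killVars l)) p
    = ((Ideal.Quotient.mkₐ k (Ideal.span {MvPolynomial.X v})).comp (killVars (v :: l))) p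
  congr 1
  refine MvPolynomial.algHom_ext fun w => ?_
  simp only [AlgHom.comp_apply, killVars, MvPolynomial.aeval_X]
  by_cases hw : w = v
  · subst hw
    by_cases hl : w ∈ l
    · simp [hl]
    · rw [if_neg hl, if_pos List.mem_cons_self, map_zero]
      exact Ideal.Quotient.eq_zero_iff_mem.mpr (Ideal.mem_span_singleton_self _)
  · congr 2
    simp [hw]

/-- The twisted difference quotient with respect to a variable. -/
def diffQuot (v : σ) (l : List σ) : MvPolynomial σ k →ₗ[k] MvPolynomial σ k where
  toFun p := (X_dvd_killVars_sub v l p).choose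
  map_add' p q := by
    refine mul_left_cancel₀ (MvPolynomial.X_ne_zero (R := k) v) ?_
    rw [mul_add, ← (X_dvd_killVars_sub v l p).choose_spec, ← (X_dvd_killVars_sub v l q).choose_spec,
      ← (X_dvd_killVars_sub v l (p + q)).choose_spec, map_add, map_add]
    ring
  map_smul' c p := by
    refine mul_left_cancel₀ (MvPolynomial.X_ne_zero (R := k) v) ?_
    rw [RingHom.id_apply, mul_smul_comm, ← (X_dvd_killVars_sub v l p).choose_spec,
      ← (X_dvd_killVars_sub v l (c • p)).choose_spec, map_smul, map_smul, smul_sub]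

theorem X_mul_diffQuot (v : σ) (l : List σ) (p : MvPolynomial σ k) :
    MvPolynomial.X v * diffQuot v l p = killVars l p - killVars (v :: l) p :=
  (X_dvd_killVars_sub v l p).choose_spec.symm

/-- A Leibniz rule twisted by two substitutions. It makes the terms of the bar differential
telescope in `koszulTop_barD`. -/
theorem diffQuot_mul (v : σ) (l : List σ) (p q : MvPolynomial σ k) :
    diffQuot v l (p * q) = diffQuot v l p * killVars l q + killVars (v :: l) p * diffQuot v l q := by
  refine mul_left_cancel₀ (MvPolynomial.X_ne_zero (R := k) v) ?_
  rw [mul_add, ← mul_assoc, mul_left_comm, X_mul_diffQuot, X_mul_diffQuot, X_mul_diffQuot, map_mul,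
    map_mul]
  ring

theorem diffQuot_X_self {v : σ} {l : List σ} (hv : v ∉ l) :
    diffQuot v l (MvPolynomial.X v : MvPolynomial σ k) = 1 := by
  refine mul_left_cancel₀ (MvPolynomial.X_ne_zero (R := k) v) ?_
  rw [X_mul_diffQuot]
  simp [killVars, hv]

theorem diffQuot_X_of_mem (v : σ) {w : σ} {l : List σ} (hw : w ∈ l) :
    diffQuot v l (MvPolynomial.X w : MvPolynomial σ k) = 0 := by
  refine mul_left_cancel₀ (MvPolynomial.X_ne_zero (R := k) v) ?_
  rw [X_mul_diffQuot]
  simp [killVars, hw]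

theorem killVars_eq_zero {l : List σ} (hl : ∀ v, v ∈ l) {p : MvPolynomial σ k}
    (hp : p ∈ irrelevantIdeal (MvPolynomial.homogeneousSubmodule σ k)) : killVars l p = 0 := by
  have h : ∀ p : MvPolynomial σ k, killVars l p = MvPolynomial.C (MvPolynomial.constantCoeff p) := by
    intro p
    have : killVars l = MvPolynomial.aeval (R := k) (0 : σ → MvPolynomial σ k) :=
      MvPolynomial.algHom_ext fun w => by simp [killVars, hl w]
    rw [this, MvPolynomial.aeval_zero]
    rfl
  rw [h, MvPolynomial.C_eq_zero]
  have := (polynomialGrading σ k).pr_zero_eq_zero hp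
  change MvPolynomial.homogeneousComponent 0 p = 0 at this
  rwa [MvPolynomial.homogeneousComponent_zero, MvPolynomial.C_eq_zero] at this

variable {M : Type u} [AddCommGroup M] [Module k M] [Module (MvPolynomial σ k) M]
  [IsScalarTower k (MvPolynomial σ k) M]

local notation "𝒮" => MvPolynomial.homogeneousSubmodule σ k

variable (M) in
/-- The comparison of the bar complex with the Koszul complex on a list of variables, in the
top degree. -/
def koszulTop : (l : List σ) → barObj 𝒮 M l.length →ₗ[k] M
  | [] => LinearMap.id
  | v :: l => TensorProduct.lift (LinearMap.mk₂ k
      (fun r b => diffQuot v l (r : MvPolynomial σ k) • koszulTop l b)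
      (fun r s b => by rw [Submodule.coe_add, map_add, add_smul])
      (fun c r b => by rw [← smul_assoc c _ (koszulTop l b), ← map_smul (diffQuot v l)]; rfl)
      (fun r b b' => by rw [map_add, smul_add])
      (fun c r b => by rw [map_smul, smul_comm]))

theorem koszulTop_tmul (v : σ) (l : List σ) (r : irrelevantIdeal 𝒮) (b : barObj 𝒮 M l.length) :
    koszulTop M (v :: l) (r ⊗ₜ[k] b) = diffQuot v l (r : MvPolynomial σ k) • koszulTop M l b := rfl

/-- By the twisted Leibniz rule the alternating sum collapses to the value of r with the variables
of `l` set to 0. If `l` lists all variables this value is 0 for r in R₊, so `koszulTop` vanishes on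
boundaries. -/
theorem koszulTop_barD (l : List σ) (r : irrelevantIdeal 𝒮) (b : barObj 𝒮 M l.length) :
    koszulTop M l (barD 𝒮 M l.length (r ⊗ₜ[k] b)) = killVars l (r : MvPolynomial σ k) •
      koszulTop M l b := by
  induction l generalizing r with
  | nil => rw [killVars_nil]; rfl
  | cons v l ih =>
    induction b using TensorProduct.induction_on with
    | zero => simp
    | add x y hx hy => rw [TensorProduct.tmul_add, map_add, map_add, hx, hy, map_add, smul_add]
    | tmul s c =>
      have : barD 𝒮 M (v :: l).length (r ⊗ₜ[k] (s ⊗ₜ[k] c : irrelevantIdeal 𝒮 ⊗[k] _))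
        = ((r : MvPolynomial σ k) • s) ⊗ₜ[k] c - r ⊗ₜ[k] barD 𝒮 M l.length (s ⊗ₜ[k] c) := rfl
      rw [this, map_sub, koszulTop_tmul, koszulTop_tmul, koszulTop_tmul, ih]
      change diffQuot v l ((r : MvPolynomial σ k) * (s : MvPolynomial σ k)) • _ - _ = _
      rw [diffQuot_mul, add_smul, mul_smul, mul_smul, add_sub_cancel_left]

/-- The cycle of the bar complex defined by a socle element. -/
def socleCycle (u : M) : (l : List σ) → barObj 𝒮 M l.length
  | [] => u
  | v :: l => barInsert M (varPlus v) l.length (socleCycle u l)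

theorem barMap_barInsert {N : Type u} [AddCommGroup N] [Module k N] [Module (MvPolynomial σ k) N]
    [IsScalarTower k (MvPolynomial σ k) N] (f : M →ₗ[MvPolynomial σ k] N) (x : irrelevantIdeal 𝒮)
    (i : ℕ) (b : barObj 𝒮 M i) :
    barMap 𝒮 f (i + 1) (barInsert M x i b) = barInsert N x i (barMap 𝒮 f i b) := by
  induction i with
  | zero => rfl
  | succ i ih =>
    induction b using TensorProduct.induction_on with
    | zero => simp
    | add y z hy hz => rw [map_add, map_add, hy, hz, map_add, map_add]
    | tmul r b =>
      rw [barInsert_tmul, barMap_tmul, barInsert_tmul, map_sub, barMap_tmul, barMap_tmul,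
        barMap_tmul, ih]

theorem barMap_socleCycle {u : M} (hu : ∀ v : σ, (MvPolynomial.X v : MvPolynomial σ k) • u = 0)
    (v : σ) (l : List σ) :
    barMap 𝒮 (LinearMap.lsmul (MvPolynomial σ k) M (MvPolynomial.X v)) l.length (socleCycle u l)
      = 0 := by
  induction l with
  | nil => exact hu v
  | cons w l ih =>
    change barMap 𝒮 _ (l.length + 1) (barInsert M (varPlus w) l.length (socleCycle u l)) = 0
    rw [barMap_barInsert, ih, map_zero]

/-- Multiplication by each variable vanishes on the iterated insertions of a socle element, so by
`barInsert_homotopy` inserting a variable into a cycle gives a cycle again. The result is the bar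
version of a Koszul cycle e₁ ∧ ⋯ ∧ e_N ⊗ u. -/
theorem socleCycle_mem_barCycles {ℳ : ℕ → Submodule k M} {u : M}
    (hu : ∀ v : σ, (MvPolynomial.X v : MvPolynomial σ k) • u = 0) {d : ℕ} (hd : u ∈ ℳ d)
    (l : List σ) : socleCycle u l ∈ barCycles 𝒮 ℳ l.length (l.length + d) := by
  induction l with
  | nil => rw [show ([] : List σ).length + d = d from Nat.zero_add d]; exact hd
  | cons v l ih =>
    refine ⟨?_, ?_⟩
    · change barD 𝒮 M l.length (barInsert M (varPlus v) l.length (socleCycle u l)) = 0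
      have h := barMap_socleCycle hu v l
      cases l with
      | nil => exact h
      | cons w l =>
        have h1 := barInsert_homotopy (varPlus (k := k) v) l.length (socleCycle u (w :: l))
        rw [show barD 𝒮 M l.length (socleCycle u (w :: l)) = 0 from ih.1, map_zero, add_zero] at h1
        exact h1.trans h
    · have := barInsert_mem_barDeg (𝒜 := 𝒮) (x := varPlus (k := k) v) (MvPolynomial.isHomogeneous_X k v)
        (barCycles_le_barDeg 𝒮 _ _ _ ih)
      rwa [show (v :: l).length + d = 1 + (l.length + d) by simp; ring]

variable (k M) in
/-- The span of the tensors whose first factor is one of the given variables. -/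
def headSpan (W : Set σ) : (i : ℕ) → Submodule k (barObj 𝒮 M i)
  | 0 => ⊤
  | i + 1 => Submodule.span k {x | ∃ w ∈ W, ∃ b : barObj 𝒮 M i, x = (varPlus w) ⊗ₜ[k] b}

theorem headSpan_succ_le {W : Set σ} {i : ℕ} {X : Type*} [AddCommGroup X] [Module k X]
    {φ : barObj 𝒮 M (i + 1) →ₗ[k] X} {Q : Submodule k X}
    (h : ∀ w ∈ W, ∀ b : barObj 𝒮 M i, φ ((varPlus w) ⊗ₜ[k] b) ∈ Q) {z : barObj 𝒮 M (i + 1)}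
    (hz : z ∈ headSpan k M W (i + 1)) : φ z ∈ Q := by
  have : headSpan k M W (i + 1) ≤ Q.comap φ := by
    refine Submodule.span_le.mpr ?_
    rintro _ ⟨w, hw, b, rfl⟩
    exact h w hw b
  exact this hz

theorem socleCycle_mem_headSpan (u : M) (l : List σ) :
    socleCycle u l ∈ headSpan k M {w | w ∈ l} l.length := by
  induction l with
  | nil => trivial
  | cons v l ih =>
    change barInsert M (varPlus v) l.length (socleCycle u l) ∈ _
    have hv : ∀ b : barObj 𝒮 M l.length,
        (varPlus v ⊗ₜ[k] b : irrelevantIdeal 𝒮 ⊗[k] barObj 𝒮 M l.length) ∈ headSpan k M {w | w ∈ v :: l} (l.length + 1) :=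
      fun b => Submodule.subset_span ⟨v, List.mem_cons_self, b, rfl⟩
    cases l with
    | nil => exact hv _
    | cons w l =>
      refine headSpan_succ_le (φ := barInsert M (varPlus v) (l.length + 1)) (fun x hx b => ?_) ih
      rw [barInsert_tmul]
      exact Submodule.sub_mem _ (hv _) (Submodule.subset_span ⟨x, List.mem_cons_of_mem _ hx, _, rfl⟩)

/-- Only the insertion of v at the first place contributes: otherwise the first factor is a variable
of `l`, on which the difference quotient in v vanishes. This computes `koszulTop` on the socle cycle
as u itself. -/
theorem koszulTop_barInsert {v : σ} {l : List σ} (hv : v ∉ l) {z : barObj 𝒮 M l.length}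
    (hz : z ∈ headSpan k M {w | w ∈ l} l.length) :
    koszulTop M (v :: l) (barInsert M (varPlus v) l.length z) = koszulTop M l z := by
  have hx : ∀ b : barObj 𝒮 M l.length, koszulTop M (v :: l) ((varPlus v) ⊗ₜ[k] b)
      = koszulTop M l b := fun b => by
    rw [koszulTop_tmul, show ((varPlus v : irrelevantIdeal 𝒮) : MvPolynomial σ k)
      = MvPolynomial.X v from rfl, diffQuot_X_self hv, one_smul]
  cases l with
  | nil => exact hx z
  | cons w l =>
    rw [← sub_eq_zero, ← Submodule.mem_bot k]
    refine headSpan_succ_le (φ := koszulTop M (v :: w :: l) ∘ₗ barInsert M (varPlus v) (l.length + 1)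
      - koszulTop M (w :: l)) (fun y hy b => ?_) hz
    rw [Submodule.mem_bot, LinearMap.sub_apply, LinearMap.comp_apply, barInsert_tmul, map_sub, hx,
      sub_sub, sub_eq_zero, right_eq_add, koszulTop_tmul,
      show ((varPlus y : irrelevantIdeal 𝒮) : MvPolynomial σ k) = MvPolynomial.X y from rfl,
      diffQuot_X_of_mem v hy, zero_smul]

theorem koszulTop_socleCycle (u : M) {l : List σ} (hl : l.Nodup) :
    koszulTop M (k := k) l (socleCycle u l) = u := by
  induction l with
  | nil => rfl
  | cons v l ih =>
    rw [List.nodup_cons] at hl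
    exact (koszulTop_barInsert hl.1 (socleCycle_mem_headSpan u l)).trans (ih hl.2)

/-- A socle element of degree `d` forces regularity at least `d`. -/
theorem exists_not_torZero_of_socle [Finite σ] {ℳ : ℕ → Submodule k M} {u : M} (hu0 : u ≠ 0)
    (hu : ∀ v : σ, (MvPolynomial.X v : MvPolynomial σ k) • u = 0) {d : ℕ} (hd : u ∈ ℳ d) :
    ∃ i, ¬ TorZero (MvPolynomial.homogeneousSubmodule σ k) ℳ i (i + d) := by
  have := Fintype.ofFinite σ
  let l := (Finset.univ : Finset σ).toList
  refine ⟨l.length, fun h => ?_⟩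
  obtain ⟨c, -, hc⟩ := h (socleCycle_mem_barCycles hu hd l)
  -- With all variables in the list, `koszulTop` is zero on boundaries but takes the value u on the
  -- socle cycle.
  have h0 : ∀ c : barObj 𝒮 M (l.length + 1), koszulTop M l (barD 𝒮 M l.length c) = 0 := by
    intro c
    induction c using TensorProduct.induction_on with
    | zero => simp
    | add x y hx hy => rw [map_add, map_add, hx, hy, add_zero]
    | tmul r b =>
      rw [koszulTop_barD, killVars_eq_zero (fun v => Finset.mem_toList.mpr (Finset.mem_univ v)) r.2,
        zero_smul]
  have h1 := h0 c
  rw [hc, koszulTop_socleCycle u (Finset.nodup_toList _)] at h1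
  exact hu0 h1

end Polynomial

/-! ### Modules with a basis of monomials -/

/-- A grading of the monomials in the variables `σ` by a monoid `G`, refining the degree. -/
structure WeightMap (σ G : Type) [AddCommMonoid G] where
  /-- The weight of a monomial. -/
  wt : (σ →₀ ℕ) →+ G
  /-- The degree of a weight. -/
  deg : G →+ ℕ
  deg_wt : ∀ h, deg (wt h) = h.degree

section MonModule

variable {σ G : Type} [AddCommMonoid G]

theorem WeightMap.eq_zero_of_wt_eq_zero (W : WeightMap σ G) {h : σ →₀ ℕ} (hh : W.wt h = 0) :
    h = 0 := by
  have := congrArg W.deg hh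
  rw [W.deg_wt, map_zero] at this
  exact (Finsupp.degree_eq_zero_iff h).mp this

/-- A set of weights is convex if it is convex for the divisibility order. -/
def WeightMap.IsConvex (W : WeightMap σ G) (Ω : Set G) : Prop :=
  ∀ ω ∈ Ω, ∀ h h', W.wt h + (W.wt h' + ω) ∈ Ω → W.wt h' + ω ∈ Ω

/-- A convex set of weights. -/
structure ConvexSet (W : WeightMap σ G) where
  /-- The underlying set. -/
  carrier : Set G
  convex : W.IsConvex carrier

variable {W : WeightMap σ G} {G' : Type} [AddCommMonoid G'] {W' : WeightMap σ G'}

/-- The module with basis a convex set `Ω` of weights, on which a monomial acts by translation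
where this is possible within `Ω`, and by zero elsewhere. -/
def MonModule (k : Type u) [Field k] (Ω : ConvexSet W) : Type u := Ω.carrier →₀ k

variable {k : Type u} [Field k] {Ω : ConvexSet W} {Ω' : ConvexSet W'}

instance : AddCommGroup (MonModule k Ω) := inferInstanceAs (AddCommGroup (Ω.carrier →₀ k))

instance : Module k (MonModule k Ω) := inferInstanceAs (Module k (Ω.carrier →₀ k))

open Classical in
variable (k Ω) in
/-- The basis element of weight `ω`, or zero. -/
def bas (ω : G) : MonModule k Ω :=
  if h : ω ∈ Ω.carrier then (Finsupp.single ⟨ω, h⟩ 1 : Ω.carrier →₀ k) else 0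

theorem bas_eq_zero {ω : G} (h : ω ∉ Ω.carrier) : bas k Ω ω = 0 := dif_neg h

theorem bas_of_mem {ω : G} (h : ω ∈ Ω.carrier) :
    bas k Ω ω = (Finsupp.single ⟨ω, h⟩ 1 : Ω.carrier →₀ k) := dif_pos h

open Classical in
/-- The coefficient at a weight. -/
def coef (ω : G) : MonModule k Ω →ₗ[k] k where
  toFun m := if h : ω ∈ Ω.carrier then (show Ω.carrier →₀ k from m) ⟨ω, h⟩ else 0
  map_add' m m' := by
    split_ifs with h
    · rfl
    · rw [add_zero]
  map_smul' c m := by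
    split_ifs with h
    · rfl
    · rw [smul_zero]

theorem coef_eq_zero {ω : G} (h : ω ∉ Ω.carrier) (m : MonModule k Ω) : coef ω m = 0 := dif_neg h

theorem coef_of_mem {ω : G} (h : ω ∈ Ω.carrier) (m : MonModule k Ω) :
    coef ω m = (show Ω.carrier →₀ k from m) ⟨ω, h⟩ := dif_pos h

open Classical in
theorem coef_bas (ω η : G) :
    coef ω (bas k Ω η) = if ω = η ∧ η ∈ Ω.carrier then 1 else 0 := by
  by_cases hη : η ∈ Ω.carrier
  · by_cases h1 : ω ∈ Ω.carrier
    · rw [coef_of_mem h1, bas_of_mem hη]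
      refine (Finsupp.single_apply).trans ?_
      simp [hη, eq_comm]
    · rw [coef_eq_zero h1, if_neg]
      exact fun h2 => h1 (h2.1 ▸ hη)
  · rw [bas_eq_zero hη, map_zero, if_neg fun h => hη h.2]

theorem MonModule.ext_coef {m m' : MonModule k Ω} (h : ∀ ω ∈ Ω.carrier, coef ω m = coef ω m') :
    m = m' := by
  refine Finsupp.ext fun ω => ?_
  have := h ω.1 ω.2
  rwa [coef_of_mem ω.2, coef_of_mem ω.2] at this

theorem MonModule.induction {p : MonModule k Ω → Prop} (m : MonModule k Ω) (h0 : p 0)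
    (hadd : ∀ m m', p m → p m' → p (m + m'))
    (hsingle : ∀ ω ∈ Ω.carrier, ∀ c : k, p (c • bas k Ω ω)) : p m := by
  refine Finsupp.induction_linear (motive := p) m h0 hadd fun ω c => ?_
  have h := hsingle ω.1 ω.2 c
  rw [bas_of_mem ω.2] at h
  have h2 : Finsupp.single ω c = c • Finsupp.single ω 1 := (Finsupp.smul_single_one ω c).symm
  rw [h2]
  exact h

theorem MonModule.linearMap_ext {X : Type*} [AddCommMonoid X] [Module k X]
    {f g : MonModule k Ω →ₗ[k] X} (h : ∀ ω ∈ Ω.carrier, f (bas k Ω ω) = g (bas k Ω ω)) : f = g := by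
  refine LinearMap.ext fun m => ?_
  induction m using MonModule.induction with
  | h0 => rw [map_zero, map_zero]
  | hadd m m' h1 h2 => rw [map_add, map_add, h1, h2]
  | hsingle ω hω c => rw [map_smul, map_smul, h ω hω]

/-- The linear map with prescribed values on the basis. -/
def MonModule.lift {X : Type*} [AddCommMonoid X] [Module k X] (f : G → X) :
    MonModule k Ω →ₗ[k] X :=
  Finsupp.linearCombination k fun ω : Ω.carrier => f ω

theorem MonModule.lift_bas {X : Type*} [AddCommMonoid X] [Module k X] (f : G → X) {ω : G}
    (hω : ω ∈ Ω.carrier) : (MonModule.lift f : MonModule k Ω →ₗ[k] X) (bas k Ω ω) = f ω := by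
  rw [bas_of_mem hω]
  exact (Finsupp.linearCombination_single k 1 _).trans (one_smul k _)

/-- Translation by the weight of a monomial. -/
def transl (Ω : ConvexSet W) (h : σ →₀ ℕ) : MonModule k Ω →ₗ[k] MonModule k Ω :=
  MonModule.lift fun ω => bas k Ω (W.wt h + ω)

theorem transl_bas (h : σ →₀ ℕ) {ω : G} (hω : ω ∈ Ω.carrier) :
    transl (k := k) Ω h (bas k Ω ω) = bas k Ω (W.wt h + ω) := MonModule.lift_bas _ hω

/-- The action of the polynomial ring. -/
def monAction (Ω : ConvexSet W) : MvPolynomial σ k →ₐ[k] Module.End k (MonModule k Ω) :=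
  AddMonoidAlgebra.lift k (Module.End k (MonModule k Ω)) (σ →₀ ℕ)
    { toFun := fun h => transl Ω h.toAdd
      map_one' := MonModule.linearMap_ext fun ω hω => by
        rw [transl_bas _ hω, toAdd_one, map_zero, zero_add]
        rfl
      map_mul' := fun h h' => MonModule.linearMap_ext fun ω hω => by
        rw [transl_bas _ hω, Module.End.mul_apply, transl_bas _ hω, toAdd_mul, map_add, add_assoc]
        by_cases h1 : W.wt h'.toAdd + ω ∈ Ω.carrier
        · rw [transl_bas _ h1]
        -- Convexity is what makes the action multiplicative: a product that has left Ω at an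
        -- intermediate weight cannot return.
        · rw [bas_eq_zero h1, map_zero, bas_eq_zero fun h2 => h1 (Ω.convex ω hω _ _ h2)] }

instance : Module (MvPolynomial σ k) (MonModule k Ω) :=
  Module.compHom (MonModule k Ω) (monAction Ω).toRingHom

theorem smul_eq_monAction (p : MvPolynomial σ k) (m : MonModule k Ω) : p • m = monAction Ω p m := rfl

instance : IsScalarTower k (MvPolynomial σ k) (MonModule k Ω) where
  smul_assoc c p m := by rw [smul_eq_monAction, map_smul]; rfl

theorem monomial_smul (h : σ →₀ ℕ) (c : k) (m : MonModule k Ω) :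
    MvPolynomial.monomial h c • m = c • transl Ω h m := by
  rw [smul_eq_monAction, monAction, ← MvPolynomial.single_eq_monomial, AddMonoidAlgebra.lift_single]
  rfl

theorem monomial_smul_bas (h : σ →₀ ℕ) (c : k) {ω : G} (hω : ω ∈ Ω.carrier) :
    MvPolynomial.monomial h c • bas k Ω ω = c • bas k Ω (W.wt h + ω) := by
  rw [monomial_smul, transl_bas _ hω]

/-- The grading of a monomial module. -/
def monGrading (k : Type u) [Field k] (Ω : ConvexSet W) (j : ℕ) : Submodule k (MonModule k Ω) where
  carrier := {m | ∀ ω, W.deg ω ≠ j → coef ω m = 0}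
  add_mem' ha hb ω hω := by rw [map_add, ha ω hω, hb ω hω, add_zero]
  zero_mem' _ _ := map_zero _
  smul_mem' c m hm ω hω := by rw [map_smul, hm ω hω, smul_zero]

theorem bas_mem_monGrading (ω : G) : bas k Ω ω ∈ monGrading k Ω (W.deg ω) := fun η hη => by
  classical
  rw [coef_bas, if_neg]
  rintro ⟨rfl, -⟩
  exact hη rfl

open Classical in
/-- The projections of a monomial module to its homogeneous components. -/
def monProj (k : Type u) [Field k] (Ω : ConvexSet W) (j : ℕ) : MonModule k Ω →ₗ[k] MonModule k Ω :=
  MonModule.lift fun ω => if W.deg ω = j then bas k Ω ω else 0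

open Classical in
theorem coef_monProj (j : ℕ) (ω : G) (m : MonModule k Ω) :
    coef ω (monProj k Ω j m) = if W.deg ω = j then coef ω m else 0 := by
  induction m using MonModule.induction with
  | h0 => simp
  | hadd m m' h1 h2 => rw [map_add, map_add, h1, h2, map_add]; split_ifs <;> simp
  | hsingle η hη c =>
    rw [map_smul, map_smul, monProj, MonModule.lift_bas _ hη, map_smul]
    split_ifs with h1 h2 h2
    · rfl
    · rw [coef_bas, if_neg, smul_zero]
      rintro ⟨rfl, -⟩
      exact h2 h1
    · rw [map_zero, coef_bas, if_neg, smul_zero]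
      rintro ⟨rfl, -⟩
      exact h1 h2
    · rw [map_zero, smul_zero]

/-- The projections of a monomial module. -/
def monGradedProj (k : Type u) [Field k] (Ω : ConvexSet W) : GradedProj (monGrading k Ω) where
  pr := monProj k Ω
  pr_mem j m ω hω := by rw [coef_monProj, if_neg hω]
  pr_same j m hm := MonModule.ext_coef fun ω _ => by
    rw [coef_monProj]
    split_ifs with h
    · rfl
    · rw [hm ω h]
  pr_ne d e hde m hm := MonModule.ext_coef fun ω _ => by
    rw [coef_monProj, map_zero]
    split_ifs with h
    · exact hm ω (h ▸ hde)
    · rfl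

theorem monGrading_induction {j : ℕ} {p : MonModule k Ω → Prop} {m : MonModule k Ω}
    (hm : m ∈ monGrading k Ω j) (h0 : p 0) (hadd : ∀ m m', p m → p m' → p (m + m'))
    (hsingle : ∀ ω ∈ Ω.carrier, W.deg ω = j → ∀ c : k, p (c • bas k Ω ω)) : p m := by
  rw [← (monGradedProj k Ω).pr_same j m hm]
  clear hm
  induction m using MonModule.induction with
  | h0 => rw [map_zero]; exact h0
  | hadd m m' h1 h2 => rw [map_add]; exact hadd _ _ h1 h2
  | hsingle ω hω c =>
    change p (monProj k Ω j _)
    rw [map_smul, monProj, MonModule.lift_bas _ hω]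
    split_ifs with h
    · exact hsingle ω hω h c
    · rw [smul_zero]; exact h0

theorem homogeneous_smul_mem {a b : ℕ} {p : MvPolynomial σ k} (hp : p.IsHomogeneous a)
    {m : MonModule k Ω} (hm : m ∈ monGrading k Ω b) : p • m ∈ monGrading k Ω (a + b) := by
  rw [MvPolynomial.as_sum p, Finset.sum_smul]
  refine Submodule.sum_mem _ fun h hh => ?_
  have hd : h.degree = a := by
    have := hp (MvPolynomial.mem_support_iff.mp hh)
    rwa [show (1 : σ → ℕ) = fun _ => 1 from rfl, ← Finsupp.degree_eq_weight_one] at this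
  refine monGrading_induction (p := fun m => MvPolynomial.monomial h (p.coeff h) • m ∈ _) hm ?_
    (fun m m' h1 h2 => ?_) (fun ω hω hωb c => ?_)
  · rw [smul_zero]; exact Submodule.zero_mem _
  · rw [smul_add]; exact Submodule.add_mem _ h1 h2
  · rw [smul_comm, monomial_smul_bas _ _ hω]
    refine Submodule.smul_mem _ _ (Submodule.smul_mem _ _ ?_)
    have := bas_mem_monGrading (k := k) (Ω := Ω) (W.wt h + ω)
    rwa [map_add, W.deg_wt, hd, hωb] at this

/-- The linear map induced by a map of weights. -/
def push (Ω : ConvexSet W) (Ω' : ConvexSet W') (φ : G → G') : MonModule k Ω →ₗ[k] MonModule k Ω' :=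
  MonModule.lift fun ω => bas k Ω' (φ ω)

theorem push_bas (φ : G → G') {ω : G} (hω : ω ∈ Ω.carrier) :
    push (k := k) Ω Ω' φ (bas k Ω ω) = bas k Ω' (φ ω) := MonModule.lift_bas _ hω

/-- Besides compatibility with translations, linearity requires that no product be nonzero in the
target after one of its constituents was lost; this is the condition `hc`. -/
theorem push_smul {φ : G → G'}
    (hφ : ∀ ω ∈ Ω.carrier, ∀ h, φ (W.wt h + ω) = W'.wt h + φ ω)
    (hc : ∀ ω ∈ Ω.carrier, ∀ h, W'.wt h + φ ω ∈ Ω'.carrier →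
      W.wt h + ω ∈ Ω.carrier ∧ φ ω ∈ Ω'.carrier) (p : MvPolynomial σ k) (m : MonModule k Ω) :
    push Ω Ω' φ (p • m) = p • push Ω Ω' φ m := by
  rw [MvPolynomial.as_sum p, Finset.sum_smul, Finset.sum_smul, map_sum]
  refine Finset.sum_congr rfl fun h _ => ?_
  induction m using MonModule.induction with
  | h0 => simp
  | hadd m m' h1 h2 => rw [smul_add, map_add, h1, h2, map_add, smul_add]
  | hsingle ω hω c =>
    rw [smul_comm, map_smul (push Ω Ω' φ) c, map_smul (push Ω Ω' φ) c, smul_comm _ c,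
      monomial_smul_bas _ _ hω, map_smul, push_bas _ hω]
    congr 1
    by_cases h1 : W'.wt h + φ ω ∈ Ω'.carrier
    · obtain ⟨h2, h3⟩ := hc ω hω h h1
      rw [push_bas _ h2, monomial_smul_bas _ _ h3, hφ ω hω]
    · have h4 : push (k := k) Ω Ω' φ (bas k Ω (W.wt h + ω)) = 0 := by
        by_cases h2 : W.wt h + ω ∈ Ω.carrier
        · rw [push_bas _ h2, hφ ω hω, bas_eq_zero h1]
        · rw [bas_eq_zero h2, map_zero]
      rw [h4, smul_zero]
      by_cases h3 : φ ω ∈ Ω'.carrier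
      · rw [monomial_smul_bas _ _ h3, bas_eq_zero h1, smul_zero]
      · rw [bas_eq_zero h3, smul_zero]

theorem push_push {G'' : Type} [AddCommMonoid G''] {W'' : WeightMap σ G''} {Ω'' : ConvexSet W''}
    {φ : G → G'} {ψ : G' → G''}
    (h : ∀ ω ∈ Ω.carrier, ψ (φ ω) ∈ Ω''.carrier → φ ω ∈ Ω'.carrier) (m : MonModule k Ω) :
    push Ω' Ω'' ψ (push Ω Ω' φ m) = push Ω Ω'' (ψ ∘ φ) m := by
  refine LinearMap.congr_fun (f := push Ω' Ω'' ψ ∘ₗ push Ω Ω' φ) ?_ m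
  refine MonModule.linearMap_ext fun ω hω => ?_
  rw [LinearMap.comp_apply, push_bas _ hω, push_bas _ hω]
  by_cases h1 : φ ω ∈ Ω'.carrier
  · rw [push_bas _ h1]; rfl
  · rw [bas_eq_zero h1, map_zero]
    exact (bas_eq_zero fun h2 => h1 (h ω hω h2)).symm

open Classical in
theorem coef_push_id {Ω Ω' : ConvexSet W} (ω : G) (m : MonModule k Ω) :
    coef ω (push Ω Ω' id m) = if ω ∈ Ω'.carrier then coef ω m else 0 := by
  induction m using MonModule.induction with
  | h0 => simp
  | hadd m m' h1 h2 => rw [map_add, map_add, h1, h2, map_add]; split_ifs <;> simp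
  | hsingle η hη c =>
    rw [map_smul, map_smul, push_bas _ hη, map_smul, coef_bas, coef_bas]
    simp only [id_eq, hη, and_true]
    split_ifs with h1 h2 h2 <;> simp_all

theorem push_mem_monGrading {φ : G → G'} {e : ℕ} (hφ : ∀ ω ∈ Ω.carrier, W'.deg (φ ω) = W.deg ω + e)
    {j : ℕ} {m : MonModule k Ω} (hm : m ∈ monGrading k Ω j) :
    push Ω Ω' φ m ∈ monGrading k Ω' (j + e) := by
  refine monGrading_induction (p := fun m => push Ω Ω' φ m ∈ monGrading k Ω' (j + e)) hm ?_
    (fun m m' h1 h2 => ?_) (fun ω hω hωb c => ?_)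
  · rw [map_zero]; exact Submodule.zero_mem _
  · rw [map_add]; exact Submodule.add_mem _ h1 h2
  · rw [map_smul, push_bas _ hω]
    refine Submodule.smul_mem _ _ ?_
    rw [← hωb, ← hφ ω hω]
    exact bas_mem_monGrading _

end MonModule

/-! ### Tor of monomial modules -/

section Presentation

variable {σ G : Type} [AddCommMonoid G] {W : WeightMap σ G} {k : Type u} [Field k]
  {A : Type u} [CommRing A] [Algebra k A] [Algebra (MvPolynomial σ k) A]
  [IsScalarTower k (MvPolynomial σ k) A]

theorem mem_quotientGrading {d : ℕ} {x : A} : x ∈ quotientGrading k σ A d ↔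
    ∃ p : MvPolynomial σ k, p.IsHomogeneous d ∧ algebraMap (MvPolynomial σ k) A p = x := Iff.rfl

/-- The quotient algebra `A` of the polynomial ring is isomorphic to a monomial module. -/
structure MonPresentation (k : Type u) [Field k] (A : Type u) [CommRing A]
    [Algebra (MvPolynomial σ k) A] (Ω : ConvexSet W) : Prop where
  surj : Function.Surjective (algebraMap (MvPolynomial σ k) A)
  zero_mem : (0 : G) ∈ Ω.carrier
  gen : ∀ ω ∈ Ω.carrier, ∃ h, W.wt h = ω
  ker : ∀ p : MvPolynomial σ k, algebraMap (MvPolynomial σ k) A p = 0 ↔ p • bas k Ω 0 = 0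

namespace MonPresentation

variable {Ω : ConvexSet W}

theorem gen_smul (h : MonPresentation k A Ω) {ω : G} (hω : ω ∈ Ω.carrier) :
    ∃ m, W.wt m = ω ∧ MvPolynomial.monomial m (1 : k) • bas k Ω 0 = bas k Ω ω := by
  obtain ⟨m, rfl⟩ := h.gen ω hω
  exact ⟨m, rfl, by rw [monomial_smul_bas _ _ h.zero_mem, one_smul, add_zero]⟩

/-- The evaluation map of the polynomial ring at the generator. -/
def evalMap (k : Type u) [Field k] (Ω : ConvexSet W) :
    MvPolynomial σ k →ₗ[MvPolynomial σ k] MonModule k Ω :=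
  LinearMap.toSpanSingleton _ _ (bas k Ω 0)

/-- The isomorphism of an algebra with a monomial module. -/
def equiv (h : MonPresentation k A Ω) : A ≃ₗ[MvPolynomial σ k] MonModule k Ω :=
  ((LinearMap.quotKerEquivOfSurjective (Algebra.linearMap (MvPolynomial σ k) A) h.surj).symm.trans
    (Submodule.quotEquivOfEq _ (LinearMap.ker (evalMap k Ω)) (by
      ext p
      exact h.ker p))).trans
    (LinearMap.quotKerEquivOfSurjective (evalMap k Ω) fun m => by
      change m ∈ LinearMap.range (evalMap k Ω)
      induction m using MonModule.induction with
      | h0 => exact Submodule.zero_mem _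
      | hadd m m' h1 h2 => exact Submodule.add_mem _ h1 h2
      | hsingle ω hω c =>
        obtain ⟨n, -, hn⟩ := h.gen_smul hω
        refine ⟨c • MvPolynomial.monomial n 1, ?_⟩
        change (c • MvPolynomial.monomial n (1 : k)) • bas k Ω 0 = _
        rw [smul_assoc, hn])

theorem equiv_algebraMap (h : MonPresentation k A Ω) (p : MvPolynomial σ k) :
    h.equiv (algebraMap (MvPolynomial σ k) A p) = p • bas k Ω 0 := by
  have h1 : (LinearMap.quotKerEquivOfSurjective (Algebra.linearMap (MvPolynomial σ k) A)
      h.surj).symm (algebraMap (MvPolynomial σ k) A p) = Submodule.Quotient.mk p := by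
    rw [LinearEquiv.symm_apply_eq]
    rfl
  rw [equiv, LinearEquiv.trans_apply, LinearEquiv.trans_apply, h1]
  rfl

theorem mem_grading_iff (h : MonPresentation k A Ω) (d : ℕ) (x : A) :
    x ∈ quotientGrading k σ A d ↔ h.equiv x ∈ monGrading k Ω d := by
  constructor
  · rintro ⟨p, hp, rfl⟩
    change h.equiv (algebraMap (MvPolynomial σ k) A p) ∈ _
    rw [h.equiv_algebraMap]
    have h0 := bas_mem_monGrading (k := k) (Ω := Ω) 0
    rw [map_zero] at h0
    exact homogeneous_smul_mem hp h0
  · intro hx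
    rw [← h.equiv.symm_apply_apply x]
    refine monGrading_induction (p := fun m => h.equiv.symm m ∈ quotientGrading k σ A d) hx ?_
      (fun m m' h1 h2 => ?_) (fun ω hω hωd c => ?_)
    · rw [map_zero]; exact Submodule.zero_mem _
    · rw [map_add]; exact Submodule.add_mem _ h1 h2
    · obtain ⟨n, hn1, hn2⟩ := h.gen_smul hω
      refine mem_quotientGrading.mpr ⟨c • MvPolynomial.monomial n 1, ?_, ?_⟩
      · refine Submodule.smul_mem (MvPolynomial.homogeneousSubmodule σ k d) c ?_
        refine MvPolynomial.isHomogeneous_monomial _ ?_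
        rw [← W.deg_wt, hn1, hωd]
      · rw [LinearEquiv.eq_symm_apply, h.equiv_algebraMap, smul_assoc, hn2]

theorem equiv_smul (h : MonPresentation k A Ω) (c : k) (x : A) :
    h.equiv (c • x) = c • h.equiv x := by
  rw [← algebraMap_smul (MvPolynomial σ k) c x, map_smul, algebraMap_smul]

/-- The isomorphism of an algebra with a monomial module, over the base field. -/
def equivₖ (h : MonPresentation k A Ω) : A ≃ₗ[k] MonModule k Ω :=
  { h.equiv with map_smul' := h.equiv_smul }

/-- The grading of an algebra with a monomial basis. -/
def grading (h : MonPresentation k A Ω) : ConnectedGrading (quotientGrading k σ A) where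
  pr d := h.equivₖ.symm.toLinearMap ∘ₗ monProj k Ω d ∘ₗ h.equivₖ.toLinearMap
  pr_mem d r := by
    rw [h.mem_grading_iff]
    change h.equivₖ (h.equivₖ.symm _) ∈ _
    rw [LinearEquiv.apply_symm_apply]
    exact (monGradedProj k Ω).pr_mem d _
  pr_same d r hr := by
    rw [h.mem_grading_iff] at hr
    change h.equivₖ.symm (monProj k Ω d (h.equivₖ r)) = r
    rw [LinearEquiv.symm_apply_eq]
    exact (monGradedProj k Ω).pr_same d _ hr
  pr_ne d e hde r hr := by
    rw [h.mem_grading_iff] at hr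
    change h.equivₖ.symm (monProj k Ω d (h.equivₖ r)) = 0
    rw [LinearEquiv.symm_apply_eq, map_zero]
    exact (monGradedProj k Ω).pr_ne d e hde _ hr
  one_mem := ⟨1, MvPolynomial.isHomogeneous_one σ k, map_one (algebraMap (MvPolynomial σ k) A)⟩
  mul_mem := by
    rintro a b _ ⟨p, hp, rfl⟩ _ ⟨q, hq, rfl⟩
    exact ⟨p * q, hp.mul hq, map_mul (algebraMap (MvPolynomial σ k) A) p q⟩
  zero_le := by
    rintro _ ⟨p, hp, rfl⟩
    obtain ⟨c, hc⟩ := (polynomialGrading σ k).zero_le p hp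
    refine ⟨c, ?_⟩
    change algebraMap (MvPolynomial σ k) A p = _
    rw [hc, ← IsScalarTower.algebraMap_apply]
  iSup_eq_top := by
    refine eq_top_iff.mpr fun x _ => ?_
    obtain ⟨p, rfl⟩ := h.surj x
    rw [← MvPolynomial.sum_homogeneousComponent p, map_sum]
    exact Submodule.sum_mem _ fun d _ => Submodule.mem_iSup_of_mem d
      ⟨_, MvPolynomial.homogeneousComponent_isHomogeneous d p, rfl⟩

end MonPresentation

theorem quotientGrading_self : quotientGrading k σ (MvPolynomial σ k)
    = MvPolynomial.homogeneousSubmodule σ k := by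
  funext d
  ext p
  rw [mem_quotientGrading]
  exact ⟨fun ⟨q, hq, h⟩ => h ▸ hq, fun h => ⟨p, h, rfl⟩⟩

end Presentation

section TorMon

variable {σ G : Type} [AddCommMonoid G] {W : WeightMap σ G} {k : Type u} [Field k]
  {G' : Type} [AddCommMonoid G'] {W' : WeightMap σ G'}
  {E : Type u} [CommRing E] [Algebra k E] [Algebra (MvPolynomial σ k) E]
  [IsScalarTower k (MvPolynomial σ k) E]
  [∀ Ω : ConvexSet W, Module E (MonModule k Ω)] [∀ Ω : ConvexSet W, IsScalarTower k E (MonModule k Ω)]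
  [∀ Ω : ConvexSet W, IsScalarTower (MvPolynomial σ k) E (MonModule k Ω)]
  [∀ Ω : ConvexSet W', Module E (MonModule k Ω)]
  [∀ Ω : ConvexSet W', IsScalarTower k E (MonModule k Ω)]
  [∀ Ω : ConvexSet W', IsScalarTower (MvPolynomial σ k) E (MonModule k Ω)]

variable (k E W) in
/-- The vanishing of `Tor` for a monomial module. -/
def TorMon (Ω : Set G) (i j : ℕ) : Prop :=
  ∃ h : W.IsConvex Ω, TorZero (quotientGrading k σ E) (monGrading k ⟨Ω, h⟩) i j

variable (hE : Function.Surjective (algebraMap (MvPolynomial σ k) E))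

include hE in
theorem map_smul_of_surjective {M N : Type*} [AddCommMonoid M] [AddCommMonoid N]
    [Module (MvPolynomial σ k) M] [Module (MvPolynomial σ k) N] [Module E M] [Module E N]
    [IsScalarTower (MvPolynomial σ k) E M] [IsScalarTower (MvPolynomial σ k) E N] {f : M → N}
    (hf : ∀ (p : MvPolynomial σ k) m, f (p • m) = p • f m) (x : E) (m : M) :
    f (x • m) = x • f m := by
  obtain ⟨p, rfl⟩ := hE x
  rw [algebraMap_smul, algebraMap_smul, hf]

/-- The map of modules induced by a map of weights. -/
def pushLin {Ω : ConvexSet W} {Ω' : ConvexSet W'} (φ : G → G')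
    (hφ : ∀ ω ∈ Ω.carrier, ∀ h, φ (W.wt h + ω) = W'.wt h + φ ω)
    (hc : ∀ ω ∈ Ω.carrier, ∀ h, W'.wt h + φ ω ∈ Ω'.carrier →
      W.wt h + ω ∈ Ω.carrier ∧ φ ω ∈ Ω'.carrier) : MonModule k Ω →ₗ[E] MonModule k Ω' :=
  { push Ω Ω' φ with map_smul' := map_smul_of_surjective hE (push_smul hφ hc) }

theorem gradedAction_mon (Ω : ConvexSet W) :
    GradedAction (quotientGrading k σ E) (monGrading k Ω) := by
  rintro a b _ ⟨p, hp, rfl⟩ m hm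
  change algebraMap (MvPolynomial σ k) E p • m ∈ _
  rw [algebraMap_smul]
  exact homogeneous_smul_mem hp hm

theorem push_bijective {Ω : ConvexSet W} {Ω' : ConvexSet W'} {φ : G → G'}
    (hinj : Set.InjOn φ Ω.carrier) (himg : φ '' Ω.carrier = Ω'.carrier) :
    Function.Bijective (push (k := k) Ω Ω' φ) := by
  let ψ : G' → G := Function.invFunOn φ Ω.carrier
  have h1 : ∀ ω ∈ Ω.carrier, ψ (φ ω) = ω := fun ω hω => hinj.leftInvOn_invFunOn hω
  have h2 : ∀ ω ∈ Ω'.carrier, φ (ψ ω) = ω := fun ω hω =>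
    Function.invFunOn_eq (himg.symm ▸ hω : ω ∈ φ '' Ω.carrier)
  refine Function.bijective_iff_has_inverse.mpr ⟨push Ω' Ω ψ, fun m => ?_, fun m => ?_⟩
  · rw [push_push fun ω hω _ => himg ▸ Set.mem_image_of_mem φ hω]
    refine LinearMap.congr_fun (g := LinearMap.id) ?_ m
    exact MonModule.linearMap_ext fun ω hω => by
      rw [push_bas _ hω, Function.comp_apply, h1 ω hω]; rfl
  · rw [push_push fun ω hω _ => Function.invFunOn_mem (himg.symm ▸ hω : ω ∈ φ '' Ω.carrier)]
    refine LinearMap.congr_fun (g := LinearMap.id) ?_ m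
    exact MonModule.linearMap_ext fun ω hω => by
      rw [push_bas _ hω, Function.comp_apply, h2 ω hω]; rfl

include hE in
theorem exists_pushEquiv {Ω : Set G} {Ω' : Set G'} (hΩ : W.IsConvex Ω) {φ : G → G'}
    {e : ℕ} (hconv : W'.IsConvex Ω') (hφ : ∀ ω ∈ Ω, ∀ h, φ (W.wt h + ω) = W'.wt h + φ ω)
    (hc : ∀ ω ∈ Ω, ∀ h, W'.wt h + φ ω ∈ Ω' → W.wt h + ω ∈ Ω) (hinj : Set.InjOn φ Ω)
    (himg : φ '' Ω = Ω') (hdeg : ∀ ω ∈ Ω, W'.deg (φ ω) = W.deg ω + e) :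
    ∃ f : MonModule k ⟨Ω, hΩ⟩ ≃ₗ[E] MonModule k ⟨Ω', hconv⟩,
      (∀ ω ∈ Ω, f (bas k ⟨Ω, hΩ⟩ ω) = bas k ⟨Ω', hconv⟩ (φ ω)) ∧ ∀ l m,
        m ∈ shiftGrading e (monGrading k ⟨Ω, hΩ⟩) l ↔ f m ∈ monGrading k ⟨Ω', hconv⟩ l := by
  have hb := push_bijective (k := k) (Ω := ⟨Ω, hΩ⟩) (Ω' := ⟨Ω', hconv⟩) hinj himg
  let f : MonModule k ⟨Ω, hΩ⟩ →ₗ[E] MonModule k ⟨Ω', hconv⟩ := pushLin hE φ hφ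
    fun ω hω h h1 => ⟨hc ω hω h h1, himg ▸ Set.mem_image_of_mem φ hω⟩
  refine ⟨LinearEquiv.ofBijective f hb, fun ω hω => push_bas φ hω, fun l m => ?_⟩
  have key : ∀ l, ∀ m ∈ monGrading k ⟨Ω, hΩ⟩ l, f m ∈ monGrading k ⟨Ω', hconv⟩ (l + e) :=
    fun l m hm => push_mem_monGrading hdeg hm
  constructor
  · intro hm
    unfold shiftGrading at hm
    split_ifs at hm with hl
    · have := key _ m hm
      rwa [Nat.sub_add_cancel hl] at this
    · rw [(Submodule.mem_bot k).mp hm, map_zero]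
      exact Submodule.zero_mem _
  · intro hm
    change f m ∈ _ at hm
    have hcoef : ∀ ω ∈ Ω, coef (φ ω) (f m) = coef ω m := by
      intro ω hω
      refine LinearMap.congr_fun (f := coef (φ ω) ∘ₗ push ⟨Ω, hΩ⟩ ⟨Ω', hconv⟩ φ) ?_ m
      refine MonModule.linearMap_ext fun η hη => ?_
      classical
      rw [LinearMap.comp_apply, push_bas _ hη, coef_bas, coef_bas]
      have h1 : φ η ∈ Ω' := himg ▸ Set.mem_image_of_mem φ hη
      simp only [h1, hη, and_true]
      exact if_congr ⟨fun h => hinj hω hη h, fun h => h ▸ rfl⟩ rfl rfl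
    have h0 : ∀ ω ∈ Ω, W.deg ω + e ≠ l → coef ω m = 0 := fun ω hω hne => by
      rw [← hcoef ω hω]
      exact hm _ (by rwa [hdeg ω hω])
    unfold shiftGrading
    split_ifs with hl
    · intro ω hω
      by_cases hωΩ : ω ∈ Ω
      · exact h0 ω hωΩ (by omega)
      · exact coef_eq_zero hωΩ m
    · rw [Submodule.mem_bot]
      exact MonModule.ext_coef fun ω hω => by rw [h0 ω hω (by omega), map_zero]

include hE in
/-- Invariance of `Tor` under bijections of the sets of weights. -/
theorem TorMon.of_push {Ω : Set G} {Ω' : Set G'} {i j : ℕ} (h : TorMon W k E Ω i j) {φ : G → G'}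
    {e : ℕ} (hconv : W'.IsConvex Ω') (hφ : ∀ ω ∈ Ω, ∀ h, φ (W.wt h + ω) = W'.wt h + φ ω)
    (hc : ∀ ω ∈ Ω, ∀ h, W'.wt h + φ ω ∈ Ω' → W.wt h + ω ∈ Ω) (hinj : Set.InjOn φ Ω)
    (himg : φ '' Ω = Ω') (hdeg : ∀ ω ∈ Ω, W'.deg (φ ω) = W.deg ω + e) :
    TorMon W' k E Ω' i (j + e) := by
  obtain ⟨hΩ, h⟩ := h
  obtain ⟨f, -, hf⟩ := exists_pushEquiv (k := k) hE hΩ hconv hφ hc hinj himg hdeg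
  exact ⟨hconv, (h.shift e).of_equiv _ f hf⟩

/-- An upper set within `Ω`. -/
def WeightMap.IsUpperIn (W : WeightMap σ G) (Ω U : Set G) : Prop :=
  ∀ ω ∈ Ω, ω ∈ U → ∀ h, W.wt h + ω ∈ Ω → W.wt h + ω ∈ U

theorem WeightMap.IsConvex.inter {Ω U : Set G} (h : W.IsConvex Ω) (hU : W.IsUpperIn Ω U) :
    W.IsConvex (Ω ∩ U) := fun ω hω a b hab =>
  have h1 := h ω hω.1 a b hab.1
  ⟨h1, hU ω hω.1 hω.2 b h1⟩

theorem WeightMap.IsConvex.diff {Ω U : Set G} (h : W.IsConvex Ω) (hU : W.IsUpperIn Ω U) :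
    W.IsConvex (Ω \ U) := fun ω hω a b hab =>
  have h1 := h ω hω.1 a b hab.1
  ⟨h1, fun h2 => hab.2 (hU _ h1 h2 a hab.1)⟩

-- The weights in an upper set span a submodule, and the remaining weights give the quotient. Every
-- module below is taken apart by sequences of this kind.
include hE in
theorem gradedSES_mon {Ω U : Set G} (h : W.IsConvex Ω) (hU : W.IsUpperIn Ω U) :
    ∃ (f : MonModule k ⟨Ω ∩ U, h.inter hU⟩ →ₗ[E] MonModule k ⟨Ω, h⟩)
      (g : MonModule k ⟨Ω, h⟩ →ₗ[E] MonModule k ⟨Ω \ U, h.diff hU⟩),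
      GradedSES (quotientGrading k σ E) (monGrading k ⟨Ω ∩ U, h.inter hU⟩) (monGrading k ⟨Ω, h⟩)
        (monGrading k ⟨Ω \ U, h.diff hU⟩) f g ∧
      ∀ ω ∈ Ω ∩ U, f (bas k ⟨Ω ∩ U, h.inter hU⟩ ω) = bas k ⟨Ω, h⟩ ω := by
  classical
  refine ⟨pushLin hE id (fun _ _ _ => rfl) fun ω hω a ha => ?_,
    pushLin hE id (fun _ _ _ => rfl) fun ω hω a ha => ?_, ?_, fun ω hω => push_bas id hω⟩
  · exact ⟨⟨ha, hU ω hω.1 hω.2 a ha⟩, hω.1⟩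
  · exact ⟨ha.1, hω, fun h1 => ha.2 (hU ω hω h1 a ha.1)⟩
  · have hf : ∀ (m : MonModule k ⟨Ω ∩ U, h.inter hU⟩) ω,
        coef ω (push ⟨Ω ∩ U, h.inter hU⟩ ⟨Ω, h⟩ id m) = coef ω m := by
      intro m ω
      rw [coef_push_id]
      split_ifs with hω
      · rfl
      · exact (coef_eq_zero (fun h1 : ω ∈ Ω ∩ U => hω h1.1) m).symm
    refine ⟨fun m m' hmm => ?_, fun m => ⟨fun hm => ?_, ?_⟩, fun j m hm => ?_, fun j m hm => ?_,
      fun j m hm => ?_, gradedAction_mon _, ⟨monProj k _, monProj k _, (monGradedProj k _).pr_mem,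
      (monGradedProj k _).pr_same, fun j m => ?_⟩⟩
    · refine MonModule.ext_coef fun ω _ => ?_
      rw [← hf, ← hf]
      exact congrArg (coef ω) hmm
    · refine ⟨push ⟨Ω, h⟩ ⟨Ω ∩ U, h.inter hU⟩ id m, MonModule.ext_coef fun ω hω => ?_⟩
      refine (hf _ ω).trans ?_
      rw [coef_push_id]
      split_ifs with h1
      · rfl
      · have h2 := congrArg (coef ω) hm
        rw [show coef ω (pushLin hE id _ _ m) = coef ω (push ⟨Ω, h⟩ ⟨Ω \ U, h.diff hU⟩ id m) from rfl,
          coef_push_id, if_pos ⟨hω, fun h3 => h1 ⟨hω, h3⟩⟩, map_zero] at h2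
        exact h2.symm
    · rintro ⟨m, rfl⟩
      change push _ _ id (push _ _ id m) = 0
      refine MonModule.ext_coef fun ω hω => ?_
      rw [coef_push_id, if_pos hω, hf, map_zero]
      exact coef_eq_zero (fun h1 : ω ∈ Ω ∩ U => hω.2 h1.2) m
    · exact push_mem_monGrading (e := 0) (fun _ _ => rfl) hm
    · exact push_mem_monGrading (e := 0) (fun _ _ => rfl) hm
    · refine ⟨push ⟨Ω \ U, h.diff hU⟩ ⟨Ω, h⟩ id m,
        push_mem_monGrading (e := 0) (fun _ _ => rfl) hm, MonModule.ext_coef fun ω hω => ?_⟩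
      change coef ω (push _ _ id (push _ _ id m)) = _
      rw [coef_push_id, if_pos hω, coef_push_id, if_pos hω.1]
    · refine MonModule.ext_coef fun ω hω => ?_
      change coef ω (push _ _ id (monProj k _ j m)) = coef ω (monProj k _ j (push _ _ id m))
      rw [hf, coef_monProj, coef_monProj, hf]

include hE

theorem TorMon.mid (GE : ConnectedGrading (quotientGrading k σ E)) {Ω U : Set G} {i j : ℕ}
    (h : W.IsConvex Ω) (hU : W.IsUpperIn Ω U) (h1 : TorMon W k E (Ω ∩ U) i j)
    (h2 : TorMon W k E (Ω \ U) i j) : TorMon W k E Ω i j := by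
  obtain ⟨f, g, hfg, -⟩ := gradedSES_mon (k := k) hE h hU
  exact ⟨h, hfg.torZero_mid GE h1.2 h2.2⟩

theorem TorMon.quot_zero {Ω U : Set G} {j : ℕ} (hU : W.IsUpperIn Ω U)
    (h1 : TorMon W k E Ω 0 j) : TorMon W k E (Ω \ U) 0 j := by
  obtain ⟨f, g, hfg, -⟩ := gradedSES_mon (k := k) hE h1.1 hU
  exact ⟨h1.1.diff hU, hfg.torZero_right_zero h1.2⟩

theorem TorMon.quot (GE : ConnectedGrading (quotientGrading k σ E)) {Ω U : Set G} {i j : ℕ}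
    (hU : W.IsUpperIn Ω U) (h1 : TorMon W k E Ω (i + 1) j) (h2 : TorMon W k E (Ω ∩ U) i j) :
    TorMon W k E (Ω \ U) (i + 1) j := by
  obtain ⟨f, g, hfg, -⟩ := gradedSES_mon (k := k) hE h1.1 hU
  exact ⟨h1.1.diff hU, hfg.torZero_right GE h1.2 h2.2⟩

theorem TorMon.translate [IsCancelAdd G] {Ω : Set G} {i j : ℕ} (h : TorMon W k E Ω i j) (g : G) :
    TorMon W k E ((fun ω => g + ω) '' Ω) i (j + W.deg g) := by
  have hc : ∀ ω, ∀ a, W.wt a + (g + ω) ∈ (fun ω => g + ω) '' Ω → W.wt a + ω ∈ Ω := by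
    rintro ω a ⟨η, hη, h1⟩
    have : η = W.wt a + ω := add_left_cancel (a := g) (h1.trans (add_left_comm _ _ _))
    exact this ▸ hη
  refine h.of_push hE (φ := fun ω => g + ω) ?_ (fun ω _ a => add_left_comm _ _ _)
    (fun ω _ a => hc ω a) (fun a _ b _ hab => add_left_cancel hab) rfl
    (fun ω _ => by rw [map_add, add_comm])
  rintro _ ⟨ω, hω, rfl⟩ a b hab
  have h2 : W.wt (a + b) + ω ∈ Ω := hc ω (a + b) (by rwa [map_add, add_assoc])
  rw [map_add, add_assoc] at h2
  exact ⟨_, h.1 ω hω a b h2, add_left_comm _ _ _⟩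

/-- The presentation gives the `Tor` of the algebra itself, as a module over `E`. -/
theorem MonPresentation.torZero_iff {A : Type u} [CommRing A] [Algebra k A] [Algebra E A]
    [Algebra (MvPolynomial σ k) A] [IsScalarTower k (MvPolynomial σ k) A] [IsScalarTower k E A]
    [IsScalarTower (MvPolynomial σ k) E A] {Ω : ConvexSet W} (h : MonPresentation k A Ω) (i j : ℕ) :
    TorZero (quotientGrading k σ E) (quotientGrading k σ A) i j ↔ TorMon W k E Ω.carrier i j := by
  let e : A ≃ₗ[E] MonModule k Ω :=
    { h.equiv with map_smul' := map_smul_of_surjective hE h.equiv.map_smul }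
  constructor
  · intro h1
    exact ⟨Ω.convex, h1.of_equiv _ e h.mem_grading_iff⟩
  · rintro ⟨_, h1⟩
    refine TorZero.of_equiv _ h1 e.symm fun l m => ?_
    rw [h.mem_grading_iff]
    change _ ↔ h.equiv (h.equiv.symm m) ∈ _
    rw [LinearEquiv.apply_symm_apply]

omit hE in
theorem TorZero.of_subsingleton {R : Type u} [CommRing R] [Algebra k R] (𝒜 : ℕ → Submodule k R)
    {M : Type u} [AddCommGroup M] [Module k M] [Module R M] [IsScalarTower k R M]
    (ℳ : ℕ → Submodule k M) [Subsingleton M] (i j : ℕ) : TorZero 𝒜 ℳ i j := by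
  intro z _
  have h : (LinearMap.id : M →ₗ[R] M) = 0 := Subsingleton.elim _ _
  have h1 : z = barMap 𝒜 (LinearMap.id : M →ₗ[R] M) i z := by rw [barMap_id]; rfl
  rw [h1, h, barMap_zero]
  exact Submodule.zero_mem _

omit hE in
theorem torMon_empty (i j : ℕ) : TorMon W k E ∅ i j := by
  refine ⟨fun ω hω => hω.elim, ?_⟩
  have : Subsingleton (MonModule k (⟨∅, fun ω hω => hω.elim⟩ : ConvexSet W)) :=
    ⟨fun m m' => MonModule.ext_coef fun ω hω => hω.elim⟩
  exact TorZero.of_subsingleton _ _ _ _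

theorem MonPresentation.torMon_self (GE : ConnectedGrading (quotientGrading k σ E))
    {Ω : ConvexSet W} (h : MonPresentation k E Ω) {i j : ℕ} (hij : (i, j) ≠ (0, 0)) :
    TorMon W k E Ω.carrier i j :=
  (h.torZero_iff hE i j).mp (GE.torZero_self hij)

omit hE in
theorem GradedSES.precomp {R : Type u} [CommRing R] [Algebra k R] {𝒜 : ℕ → Submodule k R}
    {M M' N P : Type u} [AddCommGroup M] [Module k M] [Module R M] [IsScalarTower k R M]
    [AddCommGroup M'] [Module k M'] [Module R M'] [IsScalarTower k R M']
    [AddCommGroup N] [Module k N] [Module R N] [IsScalarTower k R N]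
    [AddCommGroup P] [Module k P] [Module R P] [IsScalarTower k R P]
    {ℳ : ℕ → Submodule k M} {ℳ' : ℕ → Submodule k M'} {𝒩 : ℕ → Submodule k N}
    {𝒬 : ℕ → Submodule k P} {f : M →ₗ[R] N} {g : N →ₗ[R] P} (h : GradedSES 𝒜 ℳ 𝒩 𝒬 f g)
    (e : M' ≃ₗ[R] M) (he : ∀ j m, m ∈ ℳ' j ↔ e m ∈ ℳ j) :
    GradedSES 𝒜 ℳ' 𝒩 𝒬 (f ∘ₗ e.toLinearMap) g where
  inj := h.inj.comp e.injective
  exact := fun y => (h.exact y).trans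
    ⟨fun ⟨x, hx⟩ => ⟨e.symm x, by simp [hx]⟩, fun ⟨x, hx⟩ => ⟨e x, hx⟩⟩
  f_mem j m hm := h.f_mem j _ ((he j m).mp hm)
  g_mem := h.g_mem
  g_surj := h.g_surj
  action := h.action
  exists_proj := by
    obtain ⟨p, q, hp, hq, hpq⟩ := h.exists_proj
    refine ⟨fun j => (e.symm.toLinearMap.restrictScalars k) ∘ₗ p j ∘ₗ
      (e.toLinearMap.restrictScalars k), q, fun j m => ?_, hq, fun j m => ?_⟩
    · rw [he]
      simpa using hp j (e m)
    · simpa using hpq j (e m)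

/-- A variable that acts injectively on a monomial module may be divided out. -/
theorem TorMon.of_nonzerodivisor [IsCancelAdd G] (GE : ConnectedGrading (quotientGrading k σ E))
    {Ω U : Set G} (v : σ) (hΩ : W.IsConvex Ω)
    (hv : (fun ω => W.wt (Finsupp.single v 1) + ω) '' Ω = Ω ∩ U) {i j : ℕ}
    (h : TorMon W k E (Ω \ U) i j) : TorMon W k E Ω i j := by
  have hmem : ∀ ω ∈ Ω, W.wt (Finsupp.single v 1) + ω ∈ Ω ∩ U := fun ω hω =>
    hv ▸ Set.mem_image_of_mem _ hω
  have hU : W.IsUpperIn Ω U := by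
    intro ω hω hωU a ha
    obtain ⟨η, hη, rfl⟩ : ω ∈ (fun ω => W.wt (Finsupp.single v 1) + ω) '' Ω := hv ▸ ⟨hω, hωU⟩
    have h1 : W.wt a + η ∈ Ω :=
      hΩ η hη (Finsupp.single v 1) a (by rwa [add_left_comm])
    have := (hmem _ h1).2
    rwa [add_left_comm] at this
  obtain ⟨f, hf, hf'⟩ := exists_pushEquiv (k := k) (W' := W) (e := 1) hE hΩ (hΩ.inter hU)
    (φ := fun ω => W.wt (Finsupp.single v 1) + ω)
    (fun ω _ a => add_left_comm _ _ _)
    (fun ω hω a ha => hΩ ω hω (Finsupp.single v 1) a (by rw [add_left_comm]; exact ha.1))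
    (fun a _ b _ hab => add_left_cancel hab) hv
    (fun ω _ => by rw [map_add, W.deg_wt, Finsupp.degree_single, add_comm])
  obtain ⟨f', g, hfg, hf1⟩ := gradedSES_mon (k := k) hE hΩ hU
  have hxmem : algebraMap (MvPolynomial σ k) E (MvPolynomial.X v) ∈ quotientGrading k σ E 1 :=
    ⟨_, MvPolynomial.isHomogeneous_X k v, rfl⟩
  let x : irrelevantIdeal (quotientGrading k σ E) := ⟨_, mem_irrelevantIdeal one_pos hxmem⟩
  -- Multiplication by the variable is the translation isomorphism of Ω onto Ω ∩ U followed by the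
  -- inclusion, so the exact sequence of the upper set U is that of a nonzerodivisor.
  have hx : LinearMap.lsmul E (MonModule k ⟨Ω, hΩ⟩) (x : E) = f' ∘ₗ f.toLinearMap := by
    refine LinearMap.restrictScalars_injective k (MonModule.linearMap_ext fun ω hω => ?_)
    change algebraMap (MvPolynomial σ k) E (MvPolynomial.X v) • bas k ⟨Ω, hΩ⟩ ω
      = f' (f (bas k ⟨Ω, hΩ⟩ ω))
    rw [algebraMap_smul, MvPolynomial.X, monomial_smul_bas _ _ hω, one_smul, hf ω hω,
      hf1 _ (hmem ω hω)]
  refine ⟨hΩ, TorZero.of_nonzerodivisor GE (x := x) (e := 1) hxmem (g := g) ?_ h.2⟩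
  rw [hx]
  exact hfg.precomp f hf'

end TorMon

/-! ### The weights of a scroll -/

section ScrollWeight

variable {t : ℕ} (n : Fin t → ℕ)

/-- The monoid of weights: the degrees in the blocks of variables, and the sum of the indices. -/
abbrev ScrollType (t : ℕ) : Type := (Fin t → ℕ) × ℕ

/-- The maximal sum of the indices of a monomial of given degrees. -/
def maxIndex : (Fin t → ℕ) →+ ℕ where
  toFun d := ∑ i, d i * n i
  map_zero' := by simp
  map_add' d d' := by simp [add_mul, Finset.sum_add_distrib]

/-- The weight of a variable. -/
def varWeight (v : ScrollVar n) : ScrollType t := (Pi.single v.1 1, v.2)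

theorem maxIndex_single (i : Fin t) : maxIndex n (Pi.single i 1) = n i := by
  change ∑ j, (Pi.single i 1 : Fin t → ℕ) j * n j = n i
  rw [Finset.sum_eq_single i (fun j _ hj => by rw [Pi.single_eq_of_ne hj, zero_mul]) (by simp)]
  simp

/-- The weight map of a scroll. -/
def scrollWeight : WeightMap (ScrollVar n) (ScrollType t) where
  wt := (Finsupp.linearCombination ℕ (varWeight n)).toAddMonoidHom
  deg := { toFun := fun g => ∑ i, g.1 i
           map_zero' := by simp
           map_add' := fun a b => by simp [Finset.sum_add_distrib] }
  deg_wt h := by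
    induction h using Finsupp.induction_linear with
    | zero => simp
    | add a b ha hb => rw [map_add, map_add, ha, hb, map_add]
    | single v a =>
      rw [Finsupp.degree_single]
      change ∑ i, (Finsupp.linearCombination ℕ (varWeight n) (Finsupp.single v a)).1 i = a
      rw [Finsupp.linearCombination_single]
      simp [varWeight, ← Finset.mul_sum]

theorem scrollWeight_single (v : ScrollVar n) :
    (scrollWeight n).wt (Finsupp.single v 1) = varWeight n v := by
  change Finsupp.linearCombination ℕ (varWeight n) (Finsupp.single v 1) = _
  rw [Finsupp.linearCombination_single, one_smul]

theorem scrollWeight_deg (g : ScrollType t) : (scrollWeight n).deg g = ∑ i, g.1 i := rfl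

theorem scrollWeight_le (h : ScrollVar n →₀ ℕ) :
    ((scrollWeight n).wt h).2 ≤ maxIndex n ((scrollWeight n).wt h).1 := by
  induction h using Finsupp.induction_linear with
  | zero => simp
  | add a b ha hb =>
    rw [map_add, Prod.fst_add, Prod.snd_add, map_add]
    exact add_le_add ha hb
  | single v a =>
    induction a with
    | zero => simp
    | succ a ih =>
      rw [Finsupp.single_add, map_add, Prod.fst_add, Prod.snd_add, map_add, scrollWeight_single]
      refine add_le_add ih ?_
      rw [varWeight, maxIndex_single]
      exact Nat.lt_succ_iff.mp v.2.2

theorem deg_varWeight (v : ScrollVar n) : (scrollWeight n).deg (varWeight n v) = 1 := by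
  rw [← scrollWeight_single, (scrollWeight n).deg_wt, Finsupp.degree_single]

variable {n} in
theorem maxIndex_of_ne {d : Fin t → ℕ} {i : Fin t} (h : d i ≠ 0) : n i ≤ maxIndex n d := by
  refine le_trans ?_ (Finset.single_le_sum (f := fun i => d i * n i) (fun _ _ => Nat.zero_le _)
    (Finset.mem_univ i))
  exact Nat.le_mul_of_pos_left _ (Nat.pos_of_ne_zero h)

theorem exists_add_single {d : Fin t → ℕ} {i : Fin t} (h : d i ≠ 0) :
    ∃ d' : Fin t → ℕ, d = Pi.single i 1 + d' := by
  refine ⟨d - Pi.single i 1, funext fun j => ?_⟩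
  by_cases hj : j = i
  · subst hj
    simp only [Pi.add_apply, Pi.sub_apply, Pi.single_eq_same]
    omega
  · simp [Pi.single_eq_of_ne hj]

theorem maxIndex_single_add (i : Fin t) (d : Fin t → ℕ) :
    maxIndex n (Pi.single i 1 + d) = n i + maxIndex n d := by rw [map_add, maxIndex_single]

/-- Greedy choice: from a block i in which d is nonzero take the variable of index min(w, n_i). The
rest of w then still fits under the bound for the remaining degrees. -/
theorem exists_wt_eq {d : Fin t → ℕ} {w : ℕ} (h : w ≤ maxIndex n d) :
    ∃ m, (scrollWeight n).wt m = (d, w) := by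
  induction hN : ∑ i, d i generalizing d w with
  | zero =>
    have hd : d = 0 := funext fun i => by
      simpa using (Finset.sum_eq_zero_iff.mp hN) i (Finset.mem_univ i)
    subst hd
    rw [map_zero, Nat.le_zero] at h
    exact ⟨0, by rw [h, map_zero]; rfl⟩
  | succ N ih =>
    obtain ⟨i, hi⟩ : ∃ i, d i ≠ 0 := by
      by_contra! hd
      rw [Finset.sum_eq_zero fun i _ => hd i] at hN
      exact absurd hN (by omega)
    obtain ⟨d, rfl⟩ := exists_add_single hi
    rw [maxIndex_single_add] at h
    have hN' : ∑ i, d i = N := by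
      have : ∑ j, (Pi.single i 1 + d : Fin t → ℕ) j = 1 + ∑ j, d j := by
        simp [Finset.sum_add_distrib]
      omega
    obtain ⟨m, hm⟩ := ih (d := d) (w := w - min w (n i)) (by omega) hN'
    refine ⟨Finsupp.single ⟨i, ⟨min w (n i), by omega⟩⟩ 1 + m, ?_⟩
    rw [map_add, scrollWeight_single, hm]
    refine Prod.ext rfl ?_
    change min w (n i) + (w - min w (n i)) = w
    omega

variable {n}

/-- Every weight that occurs in a sum with the weight of a monomial is described by degrees. -/
theorem forall_wt {p : ScrollType t → Prop} (h : ∀ d w, w ≤ maxIndex n d → p (d, w))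
    (m : ScrollVar n →₀ ℕ) : p ((scrollWeight n).wt m) := h _ _ (scrollWeight_le n m)

end ScrollWeight

/-! ### Monomials in the coordinate ring of a scroll -/

section Straightening

variable (k : Type u) [Field k] {t : ℕ} (n : Fin t → ℕ)

/-- The class of a monomial. -/
def scrollMon (h : ScrollVar n →₀ ℕ) : Scroll k n :=
  Ideal.Quotient.mk (minorsIdeal (scrollMatrix k n)) (MvPolynomial.monomial h 1)

theorem scrollMon_add (h h' : ScrollVar n →₀ ℕ) :
    scrollMon k n (h + h') = scrollMon k n h * scrollMon k n h' := by
  rw [scrollMon, scrollMon, scrollMon, ← map_mul, MvPolynomial.monomial_mul, one_mul]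

theorem scroll_relation {i a : Fin t} {c b : ℕ} (hc : c < n i) (hb : b < n a) :
    (MvPolynomial.X ⟨i, ⟨c, by omega⟩⟩ * MvPolynomial.X ⟨a, ⟨b + 1, by omega⟩⟩ -
      MvPolynomial.X ⟨i, ⟨c + 1, by omega⟩⟩ * MvPolynomial.X ⟨a, ⟨b, by omega⟩⟩ :
      MvPolynomial (ScrollVar n) k) ∈ minorsIdeal (scrollMatrix k n) := by
  refine Ideal.subset_span ⟨⟨i, ⟨c, hc⟩⟩, ⟨a, ⟨b, hb⟩⟩, ?_⟩
  rw [Matrix.det_fin_two]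
  simp only [scrollMatrix, Matrix.submatrix_apply, id_eq, Matrix.of_apply, Matrix.cons_val_zero,
    Matrix.cons_val_one]
  exact congrArg₂ _ rfl (mul_comm _ _)

theorem scrollMon_swap {i a : Fin t} {c b : ℕ} (hc : c < n i) (hb : b < n a) :
    scrollMon k n (Finsupp.single ⟨i, ⟨c, by omega⟩⟩ 1 + Finsupp.single ⟨a, ⟨b + 1, by omega⟩⟩ 1)
      = scrollMon k n
        (Finsupp.single ⟨i, ⟨c + 1, by omega⟩⟩ 1 + Finsupp.single ⟨a, ⟨b, by omega⟩⟩ 1) := by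
  have h := scroll_relation k n hc hb
  rw [scrollMon, scrollMon, Ideal.Quotient.eq]
  simpa only [MvPolynomial.X, MvPolynomial.monomial_mul, one_mul] using h

theorem exists_index_pos {g : ScrollVar n →₀ ℕ} (h : ((scrollWeight n).wt g).2 ≠ 0) :
    ∃ (a : Fin t) (b : ℕ) (hb : b < n a) (g' : ScrollVar n →₀ ℕ),
      g = Finsupp.single ⟨a, ⟨b + 1, by omega⟩⟩ 1 + g' := by
  classical
  by_contra! hg
  refine h ?_
  change (Finsupp.linearCombination ℕ (varWeight n) g).2 = 0
  rw [Finsupp.linearCombination_apply, Finsupp.sum, Prod.snd_sum]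
  refine Finset.sum_eq_zero fun v hv => ?_
  obtain ⟨a, ⟨b, hb⟩⟩ := v
  cases b with
  | zero => simp [varWeight]
  | succ b =>
    exfalso
    refine hg a b (by omega) (g - Finsupp.single ⟨a, ⟨b + 1, hb⟩⟩ 1) ?_
    rw [add_tsub_cancel_of_le]
    exact Finsupp.single_le_iff.mpr (Nat.one_le_iff_ne_zero.mpr (Finsupp.mem_support_iff.mp hv))

/-- A minor raises the index of one variable by one at the expense of another variable, as long as
some index in `g` is positive; repeat this s times. -/
theorem exists_raise_index {i : Fin t} {c s : ℕ} (hs : c + s ≤ n i) {g : ScrollVar n →₀ ℕ}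
    (hg : s ≤ ((scrollWeight n).wt g).2) : ∃ g' : ScrollVar n →₀ ℕ,
      scrollMon k n (Finsupp.single ⟨i, ⟨c, by omega⟩⟩ 1 + g)
        = scrollMon k n (Finsupp.single ⟨i, ⟨c + s, by omega⟩⟩ 1 + g') ∧
      varWeight n ⟨i, ⟨c, by omega⟩⟩ + (scrollWeight n).wt g
        = varWeight n ⟨i, ⟨c + s, by omega⟩⟩ + (scrollWeight n).wt g' := by
  induction s with
  | zero => exact ⟨g, rfl, rfl⟩
  | succ s ih =>
    obtain ⟨g', h1, h2⟩ := ih (by omega) (by omega)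
    have h3 : ((scrollWeight n).wt g').2 ≠ 0 := by
      have := congrArg Prod.snd h2
      simp only [varWeight, Prod.snd_add] at this
      omega
    obtain ⟨a, b, hb, g'', rfl⟩ := exists_index_pos n h3
    refine ⟨Finsupp.single ⟨a, ⟨b, by omega⟩⟩ 1 + g'', ?_, ?_⟩
    · rw [h1, ← add_assoc, scrollMon_add, scrollMon_swap k n (by omega) hb, ← scrollMon_add,
        add_assoc]
      rfl
    · rw [h2, map_add, map_add, scrollWeight_single, scrollWeight_single, ← add_assoc, ← add_assoc]
      congr 1
      refine Prod.ext rfl ?_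
      change c + s + (b + 1) = c + (s + 1) + b
      omega

theorem exists_mem_block {h : ScrollVar n →₀ ℕ} {i : Fin t}
    (hi : ((scrollWeight n).wt h).1 i ≠ 0) :
    ∃ (c : Fin (n i + 1)) (g : ScrollVar n →₀ ℕ), h = Finsupp.single ⟨i, c⟩ 1 + g := by
  classical
  by_contra! hg
  refine hi ?_
  change (Finsupp.linearCombination ℕ (varWeight n) h).1 i = 0
  rw [Finsupp.linearCombination_apply, Finsupp.sum, Prod.fst_sum, Finset.sum_apply]
  refine Finset.sum_eq_zero fun v hv => ?_
  obtain ⟨a, c⟩ := v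
  by_cases ha : a = i
  · subst ha
    exfalso
    refine hg c (h - Finsupp.single ⟨a, c⟩ 1) ?_
    rw [add_tsub_cancel_of_le]
    exact Finsupp.single_le_iff.mpr (Nat.one_le_iff_ne_zero.mpr (Finsupp.mem_support_iff.mp hv))
  · simp [varWeight, Pi.single_eq_of_ne' ha]

/-- Monomials of the same weight agree in the coordinate ring of the scroll. -/
theorem scrollMon_eq_of_wt_eq {h h' : ScrollVar n →₀ ℕ}
    (hh : (scrollWeight n).wt h = (scrollWeight n).wt h') : scrollMon k n h = scrollMon k n h' := by
  induction hN : h.degree generalizing h h' with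
  | zero =>
    have h0 : h = 0 := (Finsupp.degree_eq_zero_iff h).mp hN
    have h1 : h' = 0 := (Finsupp.degree_eq_zero_iff h').mp (by
      rw [← (scrollWeight n).deg_wt, ← hh, (scrollWeight n).deg_wt, hN])
    rw [h0, h1]
  | succ N ih =>
    obtain ⟨i, hi⟩ : ∃ i, ((scrollWeight n).wt h).1 i ≠ 0 := by
      by_contra! hd
      rw [← (scrollWeight n).deg_wt, scrollWeight_deg, Finset.sum_eq_zero fun i _ => hd i] at hN
      omega
    obtain ⟨⟨c, hc⟩, g, rfl⟩ := exists_mem_block n hi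
    rw [hh] at hi
    obtain ⟨⟨c', hc'⟩, g', rfl⟩ := exists_mem_block n hi
    -- Both monomials contain a variable of block i. Raise the smaller index to the larger one,
    -- cancel the common variable, and compare the rest by induction on the degree.
    have key : ∀ (c c' : ℕ) (hc : c < n i + 1) (hc' : c' < n i + 1) (g g' : ScrollVar n →₀ ℕ),
        g.degree = N → g'.degree = N → c ≤ c' →
        varWeight n ⟨i, ⟨c, hc⟩⟩ + (scrollWeight n).wt g
          = varWeight n ⟨i, ⟨c', hc'⟩⟩ + (scrollWeight n).wt g' →
        scrollMon k n (Finsupp.single ⟨i, ⟨c, hc⟩⟩ 1 + g)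
          = scrollMon k n (Finsupp.single ⟨i, ⟨c', hc'⟩⟩ 1 + g') := by
      intro c c' hc hc' g g' hg hg' hcc hw
      obtain ⟨s, rfl⟩ := Nat.exists_eq_add_of_le hcc
      have hs : s ≤ ((scrollWeight n).wt g).2 := by
        have := congrArg Prod.snd hw
        simp only [varWeight, Prod.snd_add] at this
        omega
      obtain ⟨g'', h1, h2⟩ := exists_raise_index k n (Nat.lt_succ_iff.mp hc') hs
      have h3 : (scrollWeight n).wt g' = (scrollWeight n).wt g'' :=
        add_left_cancel (hw.symm.trans h2)
      rw [h1, scrollMon_add, scrollMon_add, ih h3 hg']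
    have hg : g.degree = N := by
      rw [map_add, Finsupp.degree_single] at hN
      omega
    rw [map_add, map_add, scrollWeight_single, scrollWeight_single] at hh
    have hg' : g'.degree = N := by
      have := congrArg (scrollWeight n).deg hh
      rw [map_add, map_add, deg_varWeight, deg_varWeight, (scrollWeight n).deg_wt,
        (scrollWeight n).deg_wt] at this
      omega
    rcases le_total c c' with hcc | hcc
    · exact key _ _ _ _ _ _ hg hg' hcc hh
    · exact (key _ _ _ _ _ _ hg' hg hcc hh.symm).symm

end Straightening

/-! ### Monomial bases of scrolls and their quotients by coordinates -/

section ScrollModule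

variable {k : Type u} [Field k] {t : ℕ} {n : Fin t → ℕ}

theorem monomial_smul_eq {σ G : Type} [AddCommMonoid G] {W : WeightMap σ G} {Ω : ConvexSet W}
    {h h' : σ →₀ ℕ} (hh : W.wt h = W.wt h') (m : MonModule k Ω) :
    MvPolynomial.monomial h (1 : k) • m = MvPolynomial.monomial h' (1 : k) • m := by
  rw [monomial_smul, monomial_smul]
  congr 1
  refine LinearMap.congr_fun (MonModule.linearMap_ext fun ω hω => ?_) m
  rw [transl_bas _ hω, transl_bas _ hω, hh]

/-- The two terms of a minor have the same weight, hence act by the same translation. So every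
monomial module over the polynomial ring is a module over the coordinate ring of the scroll. -/
theorem minorsIdeal_smul (Ω : ConvexSet (scrollWeight n)) {p : MvPolynomial (ScrollVar n) k}
    (hp : p ∈ minorsIdeal (scrollMatrix k n)) (m : MonModule k Ω) : p • m = 0 := by
  have h : minorsIdeal (scrollMatrix k n)
      ≤ (Module.annihilator (MvPolynomial (ScrollVar n) k) (MonModule k Ω)) := by
    refine Ideal.span_le.mpr ?_
    rintro _ ⟨a, b, rfl⟩
    refine Module.mem_annihilator.mpr fun m => ?_
    rw [Matrix.det_fin_two]
    simp only [scrollMatrix, Matrix.submatrix_apply, id_eq, Matrix.of_apply, Matrix.cons_val_zero,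
      Matrix.cons_val_one]
    rw [sub_smul, sub_eq_zero]
    simp only [MvPolynomial.X, MvPolynomial.monomial_mul, one_mul]
    refine monomial_smul_eq ?_ m
    rw [map_add, map_add, scrollWeight_single, scrollWeight_single, scrollWeight_single,
      scrollWeight_single]
    refine Prod.ext (add_comm _ _) ?_
    simp only [varWeight, Prod.snd_add, Fin.val_castSucc, Fin.val_succ]
    omega
  exact Module.mem_annihilator.mp (h hp) m

theorem isTorsionBySet_minorsIdeal (Ω : ConvexSet (scrollWeight n)) :
    Module.IsTorsionBySet (MvPolynomial (ScrollVar n) k) (MonModule k Ω)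
      (minorsIdeal (scrollMatrix k n) : Set (MvPolynomial (ScrollVar n) k)) :=
  fun m p => minorsIdeal_smul Ω p.2 m

instance (Ω : ConvexSet (scrollWeight n)) : Module (Scroll k n) (MonModule k Ω) :=
  (isTorsionBySet_minorsIdeal Ω).module

instance (Ω : ConvexSet (scrollWeight n)) :
    IsScalarTower (MvPolynomial (ScrollVar n) k) (Scroll k n) (MonModule k Ω) :=
  (isTorsionBySet_minorsIdeal Ω).isScalarTower

instance (Ω : ConvexSet (scrollWeight n)) : IsScalarTower k (Scroll k n) (MonModule k Ω) :=
  (isTorsionBySet_minorsIdeal Ω).isScalarTower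

/-- The weights divisible by a variable. -/
def varMultiples (v : ScrollVar n) : Set (ScrollType t) :=
  {g | g.1 v.1 ≠ 0 ∧ (v.2 : ℕ) ≤ g.2 ∧ g.2 + n v.1 ≤ maxIndex n g.1 + v.2}

/-- The weights of the monomials that are not in the ideal generated by the variables in `V`. -/
def liveSet (V : Set (ScrollVar n)) : Set (ScrollType t) :=
  {g | g.2 ≤ maxIndex n g.1 ∧ ∀ v ∈ V, g ∉ varMultiples v}

theorem add_mem_varMultiples {v : ScrollVar n} {g : ScrollType t} (hg : g ∈ varMultiples v)
    (h : ScrollVar n →₀ ℕ) : (scrollWeight n).wt h + g ∈ varMultiples v := by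
  refine forall_wt (p := fun ω => ω + g ∈ varMultiples v) (fun d w hw => ?_) h
  obtain ⟨h1, h2, h3⟩ := hg
  refine ⟨?_, ?_, ?_⟩
  · simp only [Prod.fst_add, Pi.add_apply]; omega
  · simp only [Prod.snd_add]; omega
  · simp only [Prod.snd_add, Prod.fst_add, map_add]; omega

theorem liveSet_convex (V : Set (ScrollVar n)) : (scrollWeight n).IsConvex (liveSet V) := by
  intro ω hω a b hab
  refine ⟨?_, fun v hv h => hab.2 v hv (add_mem_varMultiples h a)⟩
  have := scrollWeight_le n b
  have := hω.1
  simp only [Prod.snd_add, Prod.fst_add, map_add]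
  omega

theorem zero_mem_liveSet (V : Set (ScrollVar n)) : (0 : ScrollType t) ∈ liveSet V :=
  ⟨by simp, fun v _ h => h.1 rfl⟩

/-- The inequalities in `varMultiples` say that subtracting the weight of v leaves a pair within the
bounds of `exists_wt_eq`, so they characterize divisibility by v. -/
theorem exists_wt_of_mem_varMultiples {v : ScrollVar n} {g : ScrollType t}
    (hg : g ∈ varMultiples v) : ∃ h, (scrollWeight n).wt (Finsupp.single v 1 + h) = g := by
  obtain ⟨d, w⟩ := g
  obtain ⟨h1, h2, h3⟩ := hg
  obtain ⟨d, rfl⟩ := exists_add_single h1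
  simp only [maxIndex_single_add] at h2 h3
  obtain ⟨m, hm⟩ := exists_wt_eq n (d := d) (w := w - v.2) (by omega)
  refine ⟨m, ?_⟩
  rw [map_add, scrollWeight_single, hm]
  refine Prod.ext rfl ?_
  change (v.2 : ℕ) + (w - v.2) = w
  omega

theorem varWeight_mem_varMultiples (v : ScrollVar n) : varWeight n v ∈ varMultiples v := by
  refine ⟨?_, le_rfl, ?_⟩
  · simp [varWeight]
  · simp only [varWeight, maxIndex_single]
    omega

/-- The quotient of the coordinate ring of a scroll by an ideal generated by coordinates has the
live weights as a basis. -/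
theorem monPresentation_of_ker {A : Type u} [CommRing A] [Algebra k A]
    [Algebra (MvPolynomial (ScrollVar n) k) A] [IsScalarTower k (MvPolynomial (ScrollVar n) k) A]
    (hA : Function.Surjective (algebraMap (MvPolynomial (ScrollVar n) k) A)) (V : Set (ScrollVar n))
    (hker : RingHom.ker (algebraMap (MvPolynomial (ScrollVar n) k) A)
      = minorsIdeal (scrollMatrix k n) ⊔ Ideal.span (MvPolynomial.X '' V)) :
    MonPresentation k A ⟨liveSet V, liveSet_convex V⟩ where
  surj := hA
  zero_mem := zero_mem_liveSet V
  gen := fun ω hω => exists_wt_eq n hω.1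
  ker := by
    set φ := algebraMap (MvPolynomial (ScrollVar n) k) A with hφ
    set Ω : ConvexSet (scrollWeight n) := ⟨liveSet V, liveSet_convex V⟩
    have hminor : ∀ h h' : ScrollVar n →₀ ℕ, (scrollWeight n).wt h = (scrollWeight n).wt h' →
        φ (MvPolynomial.monomial h 1) = φ (MvPolynomial.monomial h' 1) := by
      intro h h' hh
      have h1 := scrollMon_eq_of_wt_eq k n hh
      rw [scrollMon, scrollMon, Ideal.Quotient.eq] at h1
      rw [← sub_eq_zero, ← map_sub, ← RingHom.mem_ker, hker]
      exact Ideal.mem_sup_left h1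
    have hdead : ∀ h : ScrollVar n →₀ ℕ, (scrollWeight n).wt h ∉ liveSet V →
        φ (MvPolynomial.monomial h 1) = 0 := by
      intro h hh
      obtain ⟨v, hv, hm⟩ : ∃ v ∈ V, (scrollWeight n).wt h ∈ varMultiples v := by
        by_contra! h1
        exact hh ⟨scrollWeight_le n h, h1⟩
      obtain ⟨g, hg⟩ := exists_wt_of_mem_varMultiples hm
      rw [hminor h _ hg.symm, ← one_mul (1 : k), ← MvPolynomial.monomial_mul, map_mul]
      have : φ (MvPolynomial.monomial (Finsupp.single v 1) 1) = 0 := by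
        rw [← RingHom.mem_ker, hker]
        exact Ideal.mem_sup_right (Ideal.subset_span ⟨v, hv, rfl⟩)
      rw [this, zero_mul]
    -- Choose a monomial for each live weight. The resulting map ψ sends p · 1 to the class of p,
    -- because monomials of equal weight agree and dead monomials vanish in A. Hence nothing outside
    -- the kernel of φ annihilates the generator.
    choose! s hs using fun (ω : ScrollType t) (hω : ω ∈ liveSet V) => exists_wt_eq n hω.1
    let ψ : MonModule k Ω →ₗ[k] A :=
      MonModule.lift fun ω => φ (MvPolynomial.monomial (s ω) 1)
    have hψ : ∀ p : MvPolynomial (ScrollVar n) k, ψ (p • bas k Ω 0) = φ p := by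
      intro p
      induction p using MvPolynomial.induction_on' with
      | monomial h c =>
        rw [monomial_smul_bas _ _ (zero_mem_liveSet V), add_zero, map_smul]
        have h2 : φ (MvPolynomial.monomial h c) = c • φ (MvPolynomial.monomial h 1) := by
          rw [hφ, ← mul_one c, ← smul_eq_mul, ← MvPolynomial.smul_monomial, Algebra.smul_def,
            map_mul, ← IsScalarTower.algebraMap_apply, ← Algebra.smul_def, smul_eq_mul, mul_one]
        rw [h2]
        congr 1
        by_cases hh : (scrollWeight n).wt h ∈ liveSet V
        · rw [MonModule.lift_bas _ hh]
          exact hminor _ _ (hs _ hh)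
        · rw [bas_eq_zero hh, map_zero, hdead h hh]
      | add p q hp hq => rw [add_smul, map_add, hp, hq, map_add]
    intro p
    constructor
    · intro hp
      rw [← RingHom.mem_ker, hker] at hp
      have hle : minorsIdeal (scrollMatrix k n) ⊔ Ideal.span (MvPolynomial.X '' V)
          ≤ LinearMap.ker (LinearMap.toSpanSingleton (MvPolynomial (ScrollVar n) k) _
            (bas k Ω 0)) := by
        refine sup_le (fun q hq => minorsIdeal_smul Ω hq _) (Ideal.span_le.mpr ?_)
        rintro _ ⟨v, hv, rfl⟩
        change (MvPolynomial.X v : MvPolynomial (ScrollVar n) k) • bas k Ω 0 = 0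
        rw [MvPolynomial.X, monomial_smul_bas _ _ (zero_mem_liveSet V), add_zero,
          scrollWeight_single, bas_eq_zero, smul_zero]
        exact fun h => h.2 v hv (varWeight_mem_varMultiples v)
      exact hle hp
    · intro hp
      rw [← hψ p, hp, map_zero]

theorem monPresentation_scroll : MonPresentation k (Scroll k n)
    ⟨liveSet (∅ : Set (ScrollVar n)), liveSet_convex ∅⟩ :=
  monPresentation_of_ker Ideal.Quotient.mk_surjective ∅ (by
    rw [Set.image_empty, Ideal.span_empty, sup_bot_eq]
    exact Ideal.mk_ker)

theorem monPresentation_quotient {Y : Set (Scroll k n)} (hY : Y ⊆ naturalCoordinates k n) :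
    MonPresentation k (Scroll k n ⧸ Ideal.span Y)
      ⟨liveSet {v | Ideal.Quotient.mk (minorsIdeal (scrollMatrix k n)) (.X v) ∈ Y},
        liveSet_convex _⟩ := by
  refine monPresentation_of_ker
    (Ideal.Quotient.mk_surjective.comp Ideal.Quotient.mk_surjective) _ ?_
  have h1 : algebraMap (MvPolynomial (ScrollVar n) k) (Scroll k n ⧸ Ideal.span Y)
      = (Ideal.Quotient.mk (Ideal.span Y)).comp
        (Ideal.Quotient.mk (minorsIdeal (scrollMatrix k n))) := rfl
  have h2 : Y = Ideal.Quotient.mk (minorsIdeal (scrollMatrix k n)) '' (MvPolynomial.X ''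
      {v | Ideal.Quotient.mk (minorsIdeal (scrollMatrix k n)) (.X v) ∈ Y}) := by
    ext y
    constructor
    · intro hy
      obtain ⟨v, rfl⟩ := hY hy
      exact ⟨_, ⟨v, hy, rfl⟩, rfl⟩
    · rintro ⟨_, ⟨v, hv, rfl⟩, rfl⟩
      exact hv
  rw [h1, ← RingHom.comap_ker, Ideal.mk_ker]
  conv_lhs => rw [h2, ← Ideal.map_span]
  rw [Ideal.comap_map_of_surjective _ Ideal.Quotient.mk_surjective, sup_comm, ← RingHom.ker_eq_comap_bot,
    Ideal.mk_ker]

end ScrollModule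

/-! ### Sets of weights -/

section WeightSets

variable {t : ℕ} {n : Fin t → ℕ}

/-- The degrees are concentrated in the blocks in `T`. -/
def SuppIn (T : Finset (Fin t)) (d : Fin t → ℕ) : Prop := ∀ i ∉ T, d i = 0

theorem suppIn_add {T : Finset (Fin t)} {d d' : Fin t → ℕ} :
    SuppIn T (d + d') ↔ SuppIn T d ∧ SuppIn T d' := by
  refine ⟨fun h => ⟨fun i hi => ?_, fun i hi => ?_⟩, fun h i hi => ?_⟩
  · have := h i hi; rw [Pi.add_apply] at this; omega
  · have := h i hi; rw [Pi.add_apply] at this; omega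
  · rw [Pi.add_apply, h.1 i hi, h.2 i hi]

theorem suppIn_single {T : Finset (Fin t)} {i : Fin t} (hi : i ∈ T) :
    SuppIn T (Pi.single i 1) := fun j hj =>
  Pi.single_eq_of_ne (fun h : j = i => hj (h ▸ hi)) 1

theorem suppIn_zero (T : Finset (Fin t)) : SuppIn T 0 := fun _ _ => rfl

theorem suppIn_empty {d : Fin t → ℕ} : SuppIn ∅ d ↔ d = 0 :=
  ⟨fun h => funext fun i => h i (by simp), fun h => h ▸ suppIn_zero _⟩

theorem suppIn_univ (d : Fin t → ℕ) : SuppIn Finset.univ d := fun i hi => absurd (Finset.mem_univ i) hi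

theorem suppIn_erase {T : Finset (Fin t)} {i : Fin t} {d : Fin t → ℕ} :
    SuppIn (T.erase i) d ↔ SuppIn T d ∧ d i = 0 := by
  refine ⟨fun h => ⟨fun j hj => h j fun h1 => hj (Finset.mem_of_mem_erase h1), h i (by simp)⟩,
    fun h j hj => ?_⟩
  by_cases hji : j = i
  · rw [hji, h.2]
  · exact h.1 j fun h1 => hj (Finset.mem_erase.mpr ⟨hji, h1⟩)

variable (n)

/-- The weights in the blocks `T` whose index is at most `e` above the maximum. -/
def belowSet (T : Finset (Fin t)) (e : ℕ) : Set (ScrollType t) :=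
  {g | SuppIn T g.1 ∧ g.2 ≤ maxIndex n g.1 + e}

/-- The weights in the blocks `T` whose index is at least `a` below the maximum. -/
def deepSet (T : Finset (Fin t)) (a : ℕ) : Set (ScrollType t) :=
  {g | SuppIn T g.1 ∧ g.2 + a ≤ maxIndex n g.1}

/-- The weights in the blocks `T` of index zero. -/
def firstSet (T : Finset (Fin t)) : Set (ScrollType t) := {g | SuppIn T g.1 ∧ g.2 = 0}

/-- The weights in the blocks `T` of maximal index. -/
def lastSet (T : Finset (Fin t)) : Set (ScrollType t) := {g | SuppIn T g.1 ∧ g.2 = maxIndex n g.1}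

/-- The weights in the blocks `T` whose index is below `q` and less than `p` away from the maximum. -/
def shallowSet (T : Finset (Fin t)) (p q : ℕ) : Set (ScrollType t) :=
  {g | SuppIn T g.1 ∧ g.2 ≤ maxIndex n g.1 ∧ maxIndex n g.1 < g.2 + p ∧ g.2 < q}

variable {n}

theorem mem_translate {a b d : Fin t → ℕ} {c w : ℕ} {Ω : Set (ScrollType t)} (h : d = a + b) :
    (d, w) ∈ (fun ω => ((a, c) : ScrollType t) + ω) '' Ω ↔ ∃ w', w = c + w' ∧ (b, w') ∈ Ω := by
  subst h
  constructor
  · rintro ⟨⟨d', w'⟩, h1, h2⟩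
    obtain ⟨h3, h4⟩ := Prod.mk.injEq .. ▸ h2
    have : d' = b := add_left_cancel h3
    exact ⟨w', h4.symm, this ▸ h1⟩
  · rintro ⟨w', rfl, h1⟩
    exact ⟨_, h1, rfl⟩

theorem of_mem_translate_single {i : Fin t} {d : Fin t → ℕ} {c w : ℕ} {Ω : Set (ScrollType t)}
    (h : (d, w) ∈ (fun ω => ((Pi.single i 1, c) : ScrollType t) + ω) '' Ω) : d i ≠ 0 := by
  obtain ⟨⟨d', w'⟩, -, h2⟩ := h
  obtain ⟨rfl, -⟩ := Prod.mk.injEq .. ▸ h2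
  simp

/-- Two sets of weights agree if they agree after subtracting a basis vector. -/
theorem inter_eq_translate_single {i : Fin t} {c : ℕ} {Ω Ω' U : Set (ScrollType t)}
    (hU : ∀ g ∈ Ω, g ∈ U → g.1 i ≠ 0)
    (h : ∀ d w, ((Pi.single i 1 + d, w) ∈ Ω ∧ (Pi.single i 1 + d, w) ∈ U) ↔
      ∃ w', w = c + w' ∧ (d, w') ∈ Ω') :
    Ω ∩ U = (fun ω => ((Pi.single i 1, c) : ScrollType t) + ω) '' Ω' := by
  ext ⟨d, w⟩
  constructor
  · intro hg
    obtain ⟨d, rfl⟩ := exists_add_single (hU _ hg.1 hg.2)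
    exact (mem_translate rfl).mpr ((h d w).mp hg)
  · intro hg
    obtain ⟨d, rfl⟩ := exists_add_single (of_mem_translate_single hg)
    exact (h d w).mpr ((mem_translate rfl).mp hg)

theorem inter_eq_translate_zero {c : ℕ} {Ω Ω' U : Set (ScrollType t)}
    (h : ∀ d w, ((d, w) ∈ Ω ∧ (d, w) ∈ U) ↔ ∃ w', w = c + w' ∧ (d, w') ∈ Ω') :
    Ω ∩ U = (fun ω => ((0, c) : ScrollType t) + ω) '' Ω' := by
  ext ⟨d, w⟩
  exact (h d w).trans (mem_translate (zero_add d).symm).symm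

theorem belowSet_convex (T : Finset (Fin t)) (e : ℕ) :
    (scrollWeight n).IsConvex (belowSet n T e) := by
  rintro ⟨d, w⟩ hω a b hab
  have h1 := scrollWeight_le n b
  obtain ⟨h2, h3⟩ := hω
  obtain ⟨h4, h5⟩ := hab
  simp only [Prod.fst_add, Prod.snd_add, suppIn_add, map_add] at *
  exact ⟨suppIn_add.mpr h4.2, by simp only [Prod.fst_add, Prod.snd_add, map_add]; omega⟩

theorem deepSet_convex (T : Finset (Fin t)) (a : ℕ) :
    (scrollWeight n).IsConvex (deepSet n T a) := by
  rintro ⟨d, w⟩ hω a b hab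
  have h1 := scrollWeight_le n b
  obtain ⟨h2, h3⟩ := hω
  obtain ⟨h4, h5⟩ := hab
  simp only [Prod.fst_add, Prod.snd_add, suppIn_add, map_add] at *
  exact ⟨suppIn_add.mpr h4.2, by simp only [Prod.fst_add, Prod.snd_add, map_add]; omega⟩

theorem firstSet_convex (T : Finset (Fin t)) : (scrollWeight n).IsConvex (firstSet T) := by
  rintro ⟨d, w⟩ hω a b hab
  obtain ⟨h4, h5⟩ := hab
  simp only [Prod.fst_add, Prod.snd_add, suppIn_add] at *
  exact ⟨suppIn_add.mpr h4.2, by simp only [Prod.snd_add]; omega⟩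

theorem lastSet_convex (T : Finset (Fin t)) : (scrollWeight n).IsConvex (lastSet n T) := by
  rintro ⟨d, w⟩ hω a b hab
  have h1 := scrollWeight_le n b
  have h0 := scrollWeight_le n a
  obtain ⟨h2, h3⟩ := hω
  obtain ⟨h4, h5⟩ := hab
  simp only [Prod.fst_add, Prod.snd_add, suppIn_add, map_add] at *
  exact ⟨suppIn_add.mpr h4.2, by simp only [Prod.fst_add, Prod.snd_add, map_add]; omega⟩

theorem isUpperIn_ne_zero (Ω : Set (ScrollType t)) (i : Fin t) :
    (scrollWeight n).IsUpperIn Ω {g | g.1 i ≠ 0} := by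
  intro ω _ h a _
  simp only [Set.mem_ofPred_eq, Prod.fst_add, Pi.add_apply] at *
  omega

theorem isUpperIn_le_index (Ω : Set (ScrollType t)) (q : ℕ) :
    (scrollWeight n).IsUpperIn Ω {g | q ≤ g.2} := by
  intro ω _ h a _
  simp only [Set.mem_ofPred_eq, Prod.snd_add] at *
  omega

theorem isUpperIn_le_depth (Ω : Set (ScrollType t)) (p : ℕ) :
    (scrollWeight n).IsUpperIn Ω {g | g.2 + p ≤ maxIndex n g.1} := by
  intro ω _ h a _
  have := scrollWeight_le n a
  simp only [Set.mem_ofPred_eq, Prod.snd_add, Prod.fst_add, map_add] at *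
  omega

theorem belowSet_inter_index (T : Finset (Fin t)) (e : ℕ) :
    belowSet n T (e + 1) ∩ {g | 1 ≤ g.2} = (fun ω => ((0, 1) : ScrollType t) + ω) '' belowSet n T e :=
  inter_eq_translate_zero fun d w =>
    ⟨fun ⟨⟨h1, h2⟩, h3⟩ => ⟨w - 1, by change 1 ≤ w at h3; omega, h1, by
      simp only [Set.mem_ofPred_eq] at *; omega⟩,
    by rintro ⟨w', rfl, h1, h2⟩
       exact ⟨⟨h1, by simp only at *; omega⟩, Nat.le_add_right 1 w'⟩⟩

theorem belowSet_diff_index (T : Finset (Fin t)) (e : ℕ) :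
    belowSet n T e \ {g | 1 ≤ g.2} = firstSet T := by
  ext ⟨d, w⟩
  simp only [belowSet, firstSet, Set.mem_sdiff, Set.mem_ofPred_eq]
  exact ⟨fun h => ⟨h.1.1, by omega⟩, fun h => ⟨⟨h.1, by omega⟩, by omega⟩⟩

theorem belowSet_zero_inter_index (T : Finset (Fin t)) (q : ℕ) :
    belowSet n T 0 ∩ {g | q ≤ g.2} = (fun ω => ((0, q) : ScrollType t) + ω) '' deepSet n T q :=
  inter_eq_translate_zero fun d w =>
    ⟨fun ⟨⟨h1, h2⟩, h3⟩ => ⟨w - q, by change q ≤ w at h3; omega, h1, by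
      simp only [Set.mem_ofPred_eq] at *; omega⟩,
    by rintro ⟨w', rfl, h1, h2⟩
       exact ⟨⟨h1, by simp only at *; omega⟩, Nat.le_add_right q w'⟩⟩

theorem deepSet_inter_index (T : Finset (Fin t)) (p q : ℕ) :
    deepSet n T p ∩ {g | q ≤ g.2} = (fun ω => ((0, q) : ScrollType t) + ω) '' deepSet n T (p + q) :=
  inter_eq_translate_zero fun d w =>
    ⟨fun ⟨⟨h1, h2⟩, h3⟩ => ⟨w - q, by change q ≤ w at h3; omega, h1, by
      simp only [Set.mem_ofPred_eq] at *; omega⟩,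
    by rintro ⟨w', rfl, h1, h2⟩
       exact ⟨⟨h1, by simp only at *; omega⟩, Nat.le_add_right q w'⟩⟩

theorem belowSet_zero_inter_depth (T : Finset (Fin t)) (p : ℕ) :
    belowSet n T 0 ∩ {g | g.2 + p ≤ maxIndex n g.1} = deepSet n T p := by
  ext ⟨d, w⟩
  simp only [belowSet, deepSet, Set.mem_inter_iff, Set.mem_ofPred_eq]
  exact ⟨fun h => ⟨h.1.1, h.2⟩, fun h => ⟨⟨h.1, by omega⟩, h.2⟩⟩

theorem belowSet_zero_diff_depth (T : Finset (Fin t)) :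
    belowSet n T 0 \ {g | g.2 + 1 ≤ maxIndex n g.1} = lastSet n T := by
  ext ⟨d, w⟩
  simp only [belowSet, lastSet, Set.mem_sdiff, Set.mem_ofPred_eq]
  exact ⟨fun h => ⟨h.1.1, by omega⟩, fun h => ⟨⟨h.1, by omega⟩, by omega⟩⟩

/-- Splitting off one unit of degree in block i with index 0 lowers the bound D by n_i, which
becomes slack for the remaining weight. -/
theorem belowSet_inter_ne_zero {T : Finset (Fin t)} {i : Fin t} (hi : i ∈ T) :
    belowSet n T 0 ∩ {g | g.1 i ≠ 0}
      = (fun ω => ((Pi.single i 1, 0) : ScrollType t) + ω) '' belowSet n T (n i) :=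
  inter_eq_translate_single (fun _ _ h => h) fun d w => by
    simp only [belowSet, Set.mem_ofPred_eq, suppIn_add, maxIndex_single_add]
    refine ⟨fun h => ⟨w, by omega, h.1.1.2, by omega⟩, ?_⟩
    rintro ⟨w', rfl, h1, h2⟩
    exact ⟨⟨⟨suppIn_single hi, h1⟩, by omega⟩, by simp⟩

theorem belowSet_diff_ne_zero (T : Finset (Fin t)) (i : Fin t) :
    belowSet n T 0 \ {g | g.1 i ≠ 0} = belowSet n (T.erase i) 0 := by
  ext ⟨d, w⟩
  simp only [belowSet, Set.mem_sdiff, Set.mem_ofPred_eq, suppIn_erase]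
  tauto

theorem deepSet_diff_ne_zero (T : Finset (Fin t)) (a : ℕ) (i : Fin t) :
    deepSet n T a \ {g | g.1 i ≠ 0} = deepSet n (T.erase i) a := by
  ext ⟨d, w⟩
  simp only [deepSet, Set.mem_sdiff, Set.mem_ofPred_eq, suppIn_erase]
  tauto

/-- The n_i units of slack first pay for the depth a. Here some slack n_i - a is left; in the next
lemma it is a depth a - n_i that is left. -/
theorem deepSet_inter_ne_zero {T : Finset (Fin t)} {i : Fin t} (hi : i ∈ T) {a : ℕ}
    (ha : a ≤ n i) : deepSet n T a ∩ {g | g.1 i ≠ 0}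
      = (fun ω => ((Pi.single i 1, 0) : ScrollType t) + ω) '' belowSet n T (n i - a) :=
  inter_eq_translate_single (fun _ _ h => h) fun d w => by
    simp only [belowSet, deepSet, Set.mem_ofPred_eq, suppIn_add, maxIndex_single_add]
    refine ⟨fun h => ⟨w, by omega, h.1.1.2, by omega⟩, ?_⟩
    rintro ⟨w', rfl, h1, h2⟩
    exact ⟨⟨⟨suppIn_single hi, h1⟩, by omega⟩, by simp⟩

theorem deepSet_inter_ne_zero' {T : Finset (Fin t)} {i : Fin t} (hi : i ∈ T) {a : ℕ}
    (ha : n i ≤ a) : deepSet n T a ∩ {g | g.1 i ≠ 0}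
      = (fun ω => ((Pi.single i 1, 0) : ScrollType t) + ω) '' deepSet n T (a - n i) :=
  inter_eq_translate_single (fun _ _ h => h) fun d w => by
    simp only [deepSet, Set.mem_ofPred_eq, suppIn_add, maxIndex_single_add]
    refine ⟨fun h => ⟨w, by omega, h.1.1.2, by omega⟩, ?_⟩
    rintro ⟨w', rfl, h1, h2⟩
    exact ⟨⟨⟨suppIn_single hi, h1⟩, by omega⟩, by simp⟩

theorem deepSet_empty {a : ℕ} (ha : 1 ≤ a) : deepSet n ∅ a = ∅ := by
  refine Set.eq_empty_of_forall_notMem fun g hg => ?_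
  obtain ⟨h1, h2⟩ := hg
  rw [suppIn_empty.mp h1, map_zero] at h2
  omega

theorem belowSet_univ : belowSet n Finset.univ 0 = liveSet (∅ : Set (ScrollVar n)) := by
  ext g
  simp [belowSet, liveSet, suppIn_univ]

end WeightSets

/-! ### Linear resolutions over the coordinate ring of the scroll -/

section OverScroll

variable {k : Type u} [Field k] {t : ℕ} {n : Fin t → ℕ}

variable (k n) in
/-- The vanishing of `Tor` over the coordinate ring of the scroll. -/
abbrev TorScroll (Ω : Set (ScrollType t)) (i j : ℕ) : Prop :=
  TorMon (scrollWeight n) k (Scroll k n) Ω i j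

theorem scroll_surjective :
    Function.Surjective (algebraMap (MvPolynomial (ScrollVar n) k) (Scroll k n)) :=
  Ideal.Quotient.mk_surjective

variable (k n) in
/-- The grading of the coordinate ring of a scroll. -/
def scrollGrading : ConnectedGrading (quotientGrading k (ScrollVar n) (Scroll k n)) :=
  monPresentation_scroll.grading

theorem TorScroll.translate_single {Ω : Set (ScrollType t)} {i j : ℕ} (h : TorScroll k n Ω i j)
    (a : Fin t) (c : ℕ) :
    TorScroll k n ((fun ω => ((Pi.single a 1, c) : ScrollType t) + ω) '' Ω) i (j + 1) := by
  have := TorMon.translate scroll_surjective h ((Pi.single a 1, c) : ScrollType t)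
  rwa [scrollWeight_deg, Finset.sum_pi_single', if_pos (Finset.mem_univ a)] at this

theorem TorScroll.translate_zero {Ω : Set (ScrollType t)} {i j : ℕ} (h : TorScroll k n Ω i j)
    (c : ℕ) : TorScroll k n ((fun ω => ((0, c) : ScrollType t) + ω) '' Ω) i j := by
  have := TorMon.translate scroll_surjective h ((0, c) : ScrollType t)
  rwa [scrollWeight_deg, Finset.sum_eq_zero (f := (0 : Fin t → ℕ)) fun i _ => rfl, add_zero] at this

/-- A weight of depth a ≥ 1 has positive degree. Filtering by the blocks that occur gives
subquotients that are modules `belowSet` shifted by one degree, provided a is at most the size of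
each block. -/
theorem torScroll_deepSet_of_belowSet {i : ℕ}
    (h : ∀ T e j, i < j → TorScroll k n (belowSet n T e) i j) (T : Finset (Fin t)) {a : ℕ}
    (ha : 1 ≤ a) (haT : ∀ s ∈ T, a ≤ n s) {j : ℕ} (hj : i + 1 < j) :
    TorScroll k n (deepSet n T a) i j := by
  induction T using Finset.induction_on with
  | empty => rw [deepSet_empty ha]; exact torMon_empty i j
  | insert s T hs ih =>
    refine TorMon.mid scroll_surjective (scrollGrading k n) (deepSet_convex _ _)
      (isUpperIn_ne_zero _ s) ?_ ?_
    · rw [deepSet_inter_ne_zero (Finset.mem_insert_self s T) (haT s (Finset.mem_insert_self s T))]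
      obtain ⟨j, rfl⟩ := Nat.exists_eq_add_of_lt hj
      exact (h _ _ (i + 1 + j) (by omega)).translate_single s 0
    · rw [deepSet_diff_ne_zero, Finset.erase_insert hs]
      exact ih fun s' hs' => haT s' (Finset.mem_insert_of_mem hs')

/-- For all blocks the module is R itself, which is free. Removing a block divides by a `belowSet`
shifted by one degree, whose Tor_i enters into Tor_{i+1} of the quotient. -/
theorem torScroll_belowSet_zero {i : ℕ}
    (h : ∀ T e j, i < j → TorScroll k n (belowSet n T e) i j) (T : Finset (Fin t)) {j : ℕ}
    (hj : i + 1 < j) : TorScroll k n (belowSet n T 0) (i + 1) j := by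
  have key : ∀ T' : Finset (Fin t), TorScroll k n (belowSet n (Finset.univ \ T') 0) (i + 1) j := by
    intro T'
    induction T' using Finset.induction_on with
    | empty =>
      rw [Finset.sdiff_empty, belowSet_univ]
      exact MonPresentation.torMon_self scroll_surjective (scrollGrading k n) monPresentation_scroll
        (by simp)
    | insert s T' hs ih =>
      rw [Finset.sdiff_insert, ← belowSet_diff_ne_zero]
      refine TorMon.quot scroll_surjective (scrollGrading k n) (isUpperIn_ne_zero _ s) ih ?_
      rw [belowSet_inter_ne_zero (by simp [hs])]
      obtain ⟨j, rfl⟩ := Nat.exists_eq_add_of_lt hj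
      exact (h _ _ (i + 1 + j) (by omega)).translate_single s 0
  have := key (Finset.univ \ T)
  rwa [sdiff_sdiff_right_self, Finset.inf_eq_inter, Finset.univ_inter] at this

theorem torScroll_belowSet_zero_zero (T : Finset (Fin t)) {j : ℕ}
    (hj : 0 < j) : TorScroll k n (belowSet n T 0) 0 j := by
  have key : ∀ T' : Finset (Fin t), TorScroll k n (belowSet n (Finset.univ \ T') 0) 0 j := by
    intro T'
    induction T' using Finset.induction_on with
    | empty =>
      rw [Finset.sdiff_empty, belowSet_univ]
      exact MonPresentation.torMon_self scroll_surjective (scrollGrading k n) monPresentation_scroll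
        (by simp; omega)
    | insert s T' hs ih =>
      rw [Finset.sdiff_insert, ← belowSet_diff_ne_zero]
      exact TorMon.quot_zero scroll_surjective (isUpperIn_ne_zero _ s) ih
  have := key (Finset.univ \ T)
  rwa [sdiff_sdiff_right_self, Finset.inf_eq_inter, Finset.univ_inter] at this

/-- Weights of positive index form a translate with one unit of slack less, and those of index 0
form `firstSet T`. So the slack can be removed one unit at a time. -/
theorem torScroll_belowSet_of_first {T : Finset (Fin t)} {i j : ℕ}
    (h : TorScroll k n (belowSet n T 0) i j) (h1 : TorScroll k n (firstSet T) i j) (e : ℕ) :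
    TorScroll k n (belowSet n T e) i j := by
  induction e with
  | zero => exact h
  | succ e ih =>
    refine TorMon.mid scroll_surjective (scrollGrading k n) (belowSet_convex _ _)
      (isUpperIn_le_index _ 1) ?_ ?_
    · rw [belowSet_inter_index]
      exact ih.translate_zero 1
    · rwa [belowSet_diff_index]

/-- The modules `belowSet` are generated in degree zero and have linear resolutions. -/
theorem torScroll_belowSet (hpos : ∀ s, 1 ≤ n s) (i : ℕ) :
    ∀ T e j, i < j → TorScroll k n (belowSet n T e) i j := by
  induction i with
  | zero =>
    intro T e j hj
    refine torScroll_belowSet_of_first (torScroll_belowSet_zero_zero T hj) ?_ e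
    rw [← belowSet_diff_index (n := n) T 0]
    exact TorMon.quot_zero scroll_surjective (isUpperIn_le_index _ 1)
      (torScroll_belowSet_zero_zero T hj)
  | succ i ih =>
    intro T e j hj
    refine torScroll_belowSet_of_first (torScroll_belowSet_zero ih T hj) ?_ e
    rw [← belowSet_diff_index (n := n) T 0]
    -- `firstSet T` is the quotient of `belowSet n T 0` by a copy of `deepSet n T 1`, whose Tor_i is
    -- controlled by the induction hypothesis for all slacks. The hypothesis 1 ≤ n s is needed for
    -- depth 1.
    refine TorMon.quot scroll_surjective (scrollGrading k n) (isUpperIn_le_index _ 1)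
      (torScroll_belowSet_zero ih T hj) ?_
    rw [belowSet_zero_inter_index]
    exact (torScroll_deepSet_of_belowSet ih T le_rfl (fun s _ => hpos s) hj).translate_zero 1

theorem torScroll_firstSet (hpos : ∀ s, 1 ≤ n s) (T : Finset (Fin t)) {i j : ℕ} (hj : i < j) :
    TorScroll k n (firstSet T) i j := by
  rw [← belowSet_diff_index (n := n) T 0]
  cases i with
  | zero =>
    exact TorMon.quot_zero scroll_surjective (isUpperIn_le_index _ 1)
      (torScroll_belowSet hpos 0 T 0 j hj)
  | succ i =>
    refine TorMon.quot scroll_surjective (scrollGrading k n) (isUpperIn_le_index _ 1)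
      (torScroll_belowSet hpos _ T 0 j hj) ?_
    rw [belowSet_zero_inter_index]
    exact (torScroll_deepSet_of_belowSet (torScroll_belowSet hpos i) T le_rfl
      (fun s _ => hpos s) hj).translate_zero 1

theorem torScroll_lastSet (hpos : ∀ s, 1 ≤ n s) (T : Finset (Fin t)) {i j : ℕ} (hj : i < j) :
    TorScroll k n (lastSet n T) i j := by
  rw [← belowSet_zero_diff_depth]
  cases i with
  | zero =>
    exact TorMon.quot_zero scroll_surjective (isUpperIn_le_depth _ 1)
      (torScroll_belowSet hpos 0 T 0 j hj)
  | succ i =>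
    refine TorMon.quot scroll_surjective (scrollGrading k n) (isUpperIn_le_depth _ 1)
      (torScroll_belowSet hpos _ T 0 j hj) ?_
    rw [belowSet_zero_inter_depth]
    exact torScroll_deepSet_of_belowSet (torScroll_belowSet hpos i) T le_rfl (fun s _ => hpos s) hj

/-- A block smaller than a absorbs at least b units of depth, and the remaining depth a - n_s ≤ b is
absorbed by one further block. So the regularity is at most 2. -/
theorem torScroll_deepSet_two (hpos : ∀ s, 1 ≤ n s) (T : Finset (Fin t)) {a b : ℕ} (ha : 1 ≤ a)
    (hb : ∀ s, b ≤ n s) (hab : a ≤ 2 * b) {i j : ℕ} (hj : i + 2 < j) :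
    TorScroll k n (deepSet n T a) i j := by
  induction T using Finset.induction_on with
  | empty => rw [deepSet_empty ha]; exact torMon_empty i j
  | insert s T hs ih =>
    refine TorMon.mid scroll_surjective (scrollGrading k n) (deepSet_convex _ _)
      (isUpperIn_ne_zero _ s) ?_ ?_
    · obtain ⟨j, rfl⟩ := Nat.exists_eq_add_of_lt hj
      rcases le_or_gt a (n s) with h | h
      · rw [deepSet_inter_ne_zero (Finset.mem_insert_self s T) h]
        exact (torScroll_belowSet hpos _ _ _ (i + 2 + j) (by omega)).translate_single s 0
      · rw [deepSet_inter_ne_zero' (Finset.mem_insert_self s T) h.le]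
        refine (torScroll_deepSet_of_belowSet (torScroll_belowSet hpos i) _ (by omega)
          (fun s' _ => ?_) (j := i + 2 + j) (by omega)).translate_single s 0
        have := hb s'
        have := hb s
        omega
    · rw [deepSet_diff_ne_zero, Finset.erase_insert hs]
      exact ih

/-- Divide `belowSet n T 0` by the weights of index at least q and those of depth at least p. Each
of the two pieces has regularity at most 1 since p, q ≤ b, and their intersection is a copy of
`deepSet n T (p + q)`, of regularity at most 2 since p + q ≤ 2b. This is just enough for the
quotient to have a linear resolution. -/
theorem torScroll_shallowSet (hpos : ∀ s, 1 ≤ n s) (T : Finset (Fin t)) {p q b : ℕ} (hp : 1 ≤ p)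
    (hq : 1 ≤ q) (hb : ∀ s, b ≤ n s) (hpb : p ≤ b) (hqb : q ≤ b) {i j : ℕ} (hj : i < j) :
    TorScroll k n (shallowSet n T p q) i j := by
  -- The union of the two upper sets is resolved by a Mayer–Vietoris argument in two steps: first
  -- cut out w ≥ q, then treat the rest as a quotient of `deepSet n T p`.
  set U : Set (ScrollType t) := {g | q ≤ g.2} ∪ {g | g.2 + p ≤ maxIndex n g.1} with hU
  have hup : ∀ Ω, (scrollWeight n).IsUpperIn Ω U := fun Ω ω hω h a ha =>
    h.imp (fun h => isUpperIn_le_index Ω q ω hω h a ha)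
      (fun h => isUpperIn_le_depth Ω p ω hω h a ha)
  have heq : shallowSet n T p q = belowSet n T 0 \ U := by
    ext ⟨d, w⟩
    simp only [shallowSet, belowSet, hU, Set.mem_sdiff, Set.mem_union, Set.mem_ofPred_eq, not_or]
    exact ⟨fun h => ⟨⟨h.1, h.2.1⟩, by omega, by omega⟩,
      fun h => ⟨h.1.1, h.1.2, by omega, by omega⟩⟩
  rw [heq]
  cases i with
  | zero => exact TorMon.quot_zero scroll_surjective (hup _) (torScroll_belowSet hpos 0 T 0 j hj)
  | succ i =>
    refine TorMon.quot scroll_surjective (scrollGrading k n) (hup _)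
      (torScroll_belowSet hpos _ T 0 j hj) ?_
    refine TorMon.mid scroll_surjective (scrollGrading k n)
      ((belowSet_convex T 0).inter (hup _)) (isUpperIn_le_index _ q) ?_ ?_
    · have : belowSet n T 0 ∩ U ∩ {g | q ≤ g.2} = belowSet n T 0 ∩ {g | q ≤ g.2} := by
        ext g
        simp only [hU, Set.mem_inter_iff, Set.mem_union]
        tauto
      rw [this, belowSet_zero_inter_index]
      exact (torScroll_deepSet_of_belowSet (torScroll_belowSet hpos i) T hq
        (fun s _ => hqb.trans (hb s)) hj).translate_zero q
    · have : (belowSet n T 0 ∩ U) \ {g | q ≤ g.2} = deepSet n T p \ {g | q ≤ g.2} := by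
        rw [← belowSet_zero_inter_depth]
        ext g
        simp only [hU, Set.mem_inter_iff, Set.mem_union, Set.mem_sdiff]
        tauto
      rw [this]
      have hdeep : ∀ i, i + 1 < j → TorScroll k n (deepSet n T p) i j := fun i hi =>
        torScroll_deepSet_of_belowSet (torScroll_belowSet hpos i) T hp
          (fun s _ => hpb.trans (hb s)) hi
      cases i with
      | zero => exact TorMon.quot_zero scroll_surjective (isUpperIn_le_index _ q) (hdeep 0 hj)
      | succ i =>
        refine TorMon.quot scroll_surjective (scrollGrading k n) (isUpperIn_le_index _ q)
          (hdeep _ hj) ?_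
        rw [deepSet_inter_index]
        exact (torScroll_deepSet_two hpos T (by omega) hb (by omega) hj).translate_zero q

end OverScroll

/-! ### Induction over sets of variables -/

section LiveInduction

variable {t : ℕ} {n : Fin t → ℕ}

theorem liveSet_diff (V : Set (ScrollVar n)) (v : ScrollVar n) :
    liveSet V \ varMultiples v = liveSet (insert v V) := by
  ext g
  simp only [liveSet, Set.mem_sdiff, Set.mem_ofPred_eq, Set.forall_mem_insert]
  tauto

theorem isUpperIn_varMultiples (Ω : Set (ScrollType t)) (v : ScrollVar n) :
    (scrollWeight n).IsUpperIn Ω (varMultiples v) := fun _ _ h a _ => add_mem_varMultiples h a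

/-- The indices of the variables in a block that belong to a set. -/
def killed (V : Set (ScrollVar n)) (s : Fin t) (c : ℕ) : Prop :=
  ∃ h : c < n s + 1, (⟨s, ⟨c, h⟩⟩ : ScrollVar n) ∈ V

theorem killed_le {V : Set (ScrollVar n)} {s : Fin t} {c : ℕ} (h : killed V s c) : c ≤ n s :=
  Nat.lt_succ_iff.mp h.1

theorem single_add_ne_zero {s i : Fin t} {d : Fin t → ℕ} :
    (Pi.single s 1 + d : Fin t → ℕ) i ≠ 0 ↔ i = s ∨ d i ≠ 0 := by
  by_cases h : i = s
  · subst h; simp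
  · simp [h]

theorem mem_liveSet_iff {V : Set (ScrollVar n)} {d : Fin t → ℕ} {w : ℕ} :
    (d, w) ∈ liveSet V ↔ w ≤ maxIndex n d ∧
      ∀ i c, killed V i c → d i ≠ 0 → c ≤ w → ¬ w + n i ≤ maxIndex n d + c := by
  refine and_congr Iff.rfl ⟨fun h i c ⟨hc, hv⟩ h1 h2 h3 => h _ hv ⟨h1, h2, h3⟩, ?_⟩
  rintro h ⟨i, ⟨c, hc⟩⟩ hv ⟨h1, h2, h3⟩
  exact h i c ⟨hc, hv⟩ h1 h2 h3

theorem mem_liveSet_single_add {V : Set (ScrollVar n)} {s : Fin t} {d : Fin t → ℕ} {w : ℕ} :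
    (Pi.single s 1 + d, w) ∈ liveSet V ↔ w ≤ n s + maxIndex n d ∧
      (∀ c, killed V s c → c ≤ w → ¬ w ≤ maxIndex n d + c) ∧
      ∀ i c, killed V i c → d i ≠ 0 → c ≤ w → ¬ w + n i ≤ n s + maxIndex n d + c := by
  rw [mem_liveSet_iff, maxIndex_single_add]
  refine and_congr Iff.rfl ⟨fun h => ⟨fun c hc h1 h2 => ?_, fun i c hc h0 => ?_⟩, fun h i c hc h1 => ?_⟩
  · exact h s c hc (single_add_ne_zero.mpr (Or.inl rfl)) h1 (by omega)
  · exact h i c hc (single_add_ne_zero.mpr (Or.inr h0))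
  · rcases single_add_ne_zero.mp h1 with rfl | h1
    · intro h2 h3
      exact h.1 c hc h2 (by omega)
    · exact h.2 i c hc h1

theorem mem_varMultiples_single_add {s : Fin t} {c : ℕ} {hc : c < n s + 1} {d : Fin t → ℕ} {w : ℕ} :
    ((Pi.single s 1 + d, w) : ScrollType t) ∈ varMultiples (⟨s, ⟨c, hc⟩⟩ : ScrollVar n) ↔
      c ≤ w ∧ w ≤ maxIndex n d + c := by
  simp only [varMultiples, Set.mem_ofPred_eq, maxIndex_single_add]
  refine ⟨fun h => ⟨h.2.1, by omega⟩, fun h => ⟨single_add_ne_zero.mpr (Or.inl rfl), h.1, by omega⟩⟩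

-- Write a weight as (e_s + d, w). Not being divisible by y_{s,c} forces w > D(d) + c, and
-- divisibility by y_{s,c+1} forces w ≤ D(d) + c + 1, so w is determined by d. The set T consists of
-- the blocks in which no killed variable divides such a weight.
open Classical in
theorem liveSet_inter_last {V : Set (ScrollVar n)} {s : Fin t} {c : ℕ} (hc : killed V s c)
    (hmax : ∀ c', killed V s c' → c' ≤ c) (hcn : c + 1 < n s + 1) :
    ∃ T, liveSet V ∩ varMultiples (⟨s, ⟨c + 1, hcn⟩⟩ : ScrollVar n)
      = (fun ω => ((Pi.single s 1, c + 1) : ScrollType t) + ω) '' lastSet n T := by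
  refine ⟨Finset.univ.filter fun i => ∀ c', killed V i c' → n s + c' < c + 1 + n i,
    inter_eq_translate_single (fun g _ h => h.1) fun d w => ?_⟩
  rw [mem_liveSet_single_add, mem_varMultiples_single_add]
  constructor
  · rintro ⟨⟨h1, h2, h3⟩, h4, h5⟩
    have h6 := h2 c hc (by omega)
    refine ⟨w - (c + 1), by omega, fun i hi => ?_, by simp only; omega⟩
    by_contra hd
    change d i ≠ 0 at hd
    refine hi (Finset.mem_filter.mpr ⟨Finset.mem_univ i, fun c' hc' => ?_⟩)
    have h7 := killed_le hc'
    have h8 := maxIndex_of_ne (n := n) hd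
    have := h3 i c' hc' hd (by omega)
    omega
  · rintro ⟨w', rfl, h1, h2⟩
    simp only at h2
    refine ⟨⟨by omega, fun c' hc' _ => ?_, fun i c' hc' hd _ => ?_⟩, by omega, by omega⟩
    · have := hmax c' hc'
      omega
    · have hi : i ∈ Finset.univ.filter fun i => ∀ c', killed V i c' → n s + c' < c + 1 + n i := by
        by_contra hi
        exact hd (h1 i hi)
      have := (Finset.mem_filter.mp hi).2 c' hc'
      omega

-- The mirror image of the preceding lemma: the least killed index c + 1 forces w < c + 1, and
-- divisibility by y_{s,c} forces w ≥ c, so the remaining index is 0.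
open Classical in
theorem liveSet_inter_first {V : Set (ScrollVar n)} {s : Fin t} {c : ℕ} (hc : killed V s (c + 1))
    (hmin : ∀ c', killed V s c' → c < c') (hcn : c < n s + 1) :
    ∃ T, liveSet V ∩ varMultiples (⟨s, ⟨c, hcn⟩⟩ : ScrollVar n)
      = (fun ω => ((Pi.single s 1, c) : ScrollType t) + ω) '' firstSet T := by
  refine ⟨Finset.univ.filter fun i => ∀ c', killed V i c' → c < c',
    inter_eq_translate_single (fun g _ h => h.1) fun d w => ?_⟩
  rw [mem_liveSet_single_add, mem_varMultiples_single_add]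
  have hk := killed_le hc
  constructor
  · rintro ⟨⟨h1, h2, h3⟩, h4, h5⟩
    have h6 : w = c := by
      by_contra h
      exact h2 _ hc (by omega) (by omega)
    refine ⟨0, by omega, fun i hi => ?_, rfl⟩
    by_contra hd
    change d i ≠ 0 at hd
    refine hi (Finset.mem_filter.mpr ⟨Finset.mem_univ i, fun c' hc' => ?_⟩)
    by_contra h9
    have h8 := maxIndex_of_ne (n := n) hd
    exact h3 i c' hc' hd (by omega) (by omega)
  · rintro ⟨w', rfl, h1, h2⟩
    simp only at h2
    refine ⟨⟨by omega, fun c' hc' h3 => ?_, fun i c' hc' hd h3 => ?_⟩, by omega, by omega⟩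
    · have := hmin c' hc'
      omega
    · have hi : i ∈ Finset.univ.filter fun i => ∀ c', killed V i c' → c < c' := by
        by_contra hi
        exact hd (h1 i hi)
      have := (Finset.mem_filter.mp hi).2 c' hc'
      omega

-- The killed neighbours c and c + p + q confine w to D(d) + c < w < c + p + q, which after
-- subtracting c + p are the inequalities of `shallowSet`. A block with a killed variable has its
-- index 0 killed, and as w < n_s this excludes it from d.
open Classical in
theorem liveSet_inter_shallow {V : Set (ScrollVar n)}
    (hV : ∀ i c, killed V i c → killed V i 0 ∧ killed V i (n i)) {s : Fin t} {c p q : ℕ}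
    (hc1 : killed V s c) (hc2 : killed V s (c + p + q)) (hp : 1 ≤ p) (hq : 1 ≤ q)
    (hgap : ∀ c', killed V s c' → c' ≤ c ∨ c + p + q ≤ c') (hcn : c + p < n s + 1) :
    ∃ T, liveSet V ∩ varMultiples (⟨s, ⟨c + p, hcn⟩⟩ : ScrollVar n)
      = (fun ω => ((Pi.single s 1, c + p) : ScrollType t) + ω) '' shallowSet n T p q := by
  refine ⟨Finset.univ.filter fun i => ∀ c', ¬ killed V i c',
    inter_eq_translate_single (fun g _ h => h.1) fun d w => ?_⟩
  rw [mem_liveSet_single_add, mem_varMultiples_single_add]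
  have hk := killed_le hc2
  constructor
  · rintro ⟨⟨h1, h2, h3⟩, h4, h5⟩
    have h6 := h2 _ hc1 (by omega)
    have h7 : w < c + p + q := by
      by_contra h
      exact h2 _ hc2 (by omega) (by omega)
    refine ⟨w - (c + p), by omega, fun i hi => ?_, by simp only; omega, by simp only; omega,
      by simp only; omega⟩
    by_contra hd
    change d i ≠ 0 at hd
    refine hi (Finset.mem_filter.mpr ⟨Finset.mem_univ i, fun c' hc' => ?_⟩)
    have h8 := maxIndex_of_ne (n := n) hd
    have := h3 i 0 (hV i c' hc').1 hd (by omega)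
    omega
  · rintro ⟨w', rfl, h1, h2, h3, h4⟩
    simp only at h2 h3 h4
    refine ⟨⟨by omega, fun c' hc' h3 => ?_, fun i c' hc' hd h3 => ?_⟩, by omega, by omega⟩
    · have := hgap c' hc'
      omega
    · have hi : i ∈ Finset.univ.filter fun i => ∀ c', ¬ killed V i c' := by
        by_contra hi
        exact hd (h1 i hi)
      exact absurd hc' ((Finset.mem_filter.mp hi).2 c')

-- A weight with d_i ≠ 0 is divisible by the variable of block i of index min(w, n_i), so a
-- completely killed block cannot occur in a live weight.
open Classical in
theorem liveSet_eq_belowSet {V : Set (ScrollVar n)}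
    (hV : ∀ i c, killed V i c → ∀ c' ≤ n i, killed V i c') :
    liveSet V = belowSet n (Finset.univ.filter fun i => ∀ c', ¬ killed V i c') 0 := by
  ext ⟨d, w⟩
  rw [mem_liveSet_iff]
  constructor
  · rintro ⟨h1, h2⟩
    refine ⟨fun i hi => ?_, h1⟩
    by_contra hd
    change d i ≠ 0 at hd
    refine hi (Finset.mem_filter.mpr ⟨Finset.mem_univ i, fun c hc => ?_⟩)
    have h8 := maxIndex_of_ne (n := n) hd
    rcases le_total w (n i) with h | h
    · exact h2 i w (hV i c hc w h) hd le_rfl (by omega)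
    · exact h2 i (n i) (hV i c hc _ le_rfl) hd h (by omega)
  · rintro ⟨h1, h2⟩
    refine ⟨h2, fun i c hc hd => ?_⟩
    have hi : i ∈ Finset.univ.filter fun i => ∀ c', ¬ killed V i c' := by
      by_contra hi
      exact hd (h1 i hi)
    exact absurd hc ((Finset.mem_filter.mp hi).2 c)

theorem liveSet_eq_singleton {V : Set (ScrollVar n)}
    (hV : ∀ i c, killed V i c → ∀ c' ≤ n i, killed V i c') (hs : ∀ s, ∃ c, killed V s c) :
    liveSet V = {0} := by
  classical
  have hT : (Finset.univ.filter fun i => ∀ c', ¬ killed V i c') = ∅ :=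
    Finset.filter_eq_empty_iff.mpr fun s _ h => (hs s).elim h
  rw [liveSet_eq_belowSet hV, hT]
  ext ⟨d, w⟩
  simp only [belowSet, suppIn_empty, Set.mem_ofPred_eq, Set.mem_singleton_iff, Prod.mk_eq_zero]
  refine and_congr_right ?_
  rintro rfl
  simp

theorem exists_greatest {K : ℕ → Prop} {N : ℕ} (hne : ∃ c, K c) (hN : ∀ c, K c → c ≤ N) :
    ∃ c, K c ∧ ∀ c', K c' → c' ≤ c := by
  classical
  obtain ⟨c, hc⟩ := hne
  exact ⟨Nat.findGreatest K N, Nat.findGreatest_spec (hN c hc) hc,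
    fun c' hc' => Nat.le_findGreatest (hN c' hc') hc'⟩

/-- To prove a property of all quotients of a scroll by coordinates, add coordinates one at a
time, such that the subquotients are of one of three special types. -/
theorem liveSet_induction {P : Set (ScrollType t) → Prop} {b : ℕ} (hb1 : 1 ≤ b)
    (hn : ∀ s, n s ≤ 2 * b)
    (hmid : ∀ (V : Set (ScrollVar n)) v, P (liveSet V ∩ varMultiples v) →
      P (liveSet (insert v V)) → P (liveSet V))
    (hfirst : ∀ (s : Fin t) (c : ℕ) T,
      P ((fun ω => ((Pi.single s 1, c) : ScrollType t) + ω) '' firstSet T))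
    (hlast : ∀ (s : Fin t) (c : ℕ) T,
      P ((fun ω => ((Pi.single s 1, c) : ScrollType t) + ω) '' lastSet n T))
    (hshallow : ∀ (s : Fin t) (c : ℕ) T (p q : ℕ), 1 ≤ p → 1 ≤ q → p ≤ b → q ≤ b → p + q ≤ n s →
      P ((fun ω => ((Pi.single s 1, c) : ScrollType t) + ω) '' shallowSet n T p q))
    (hpure : ∀ V : Set (ScrollVar n), (∀ i c, killed V i c → ∀ c' ≤ n i, killed V i c') →
      (∀ V', V ⊂ V' → P (liveSet V')) → P (liveSet V)) (V : Set (ScrollVar n)) :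
    P (liveSet V) := by
  classical
  induction V using WellFoundedGT.induction with
  | ind V ih =>
  have step : ∀ (s : Fin t) (c : ℕ) (hc : c < n s + 1), ¬ killed V s c →
      P (liveSet V ∩ varMultiples (⟨s, ⟨c, hc⟩⟩ : ScrollVar n)) → P (liveSet V) := by
    intro s c hc hk hP
    exact hmid V _ hP (ih _ (Set.ssubset_insert fun h => hk ⟨hc, h⟩))
  -- Blocks with a killed variable are filled up in three stages: upwards from the greatest killed
  -- index, downwards from the least one, and finally inside the gaps.
  by_cases h1 : ∃ s, (∃ c, killed V s c) ∧ ¬ killed V s (n s)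
  · obtain ⟨s, hne, hs⟩ := h1
    obtain ⟨c, hc, hmax⟩ := exists_greatest hne fun c => killed_le
    have hcn : c + 1 < n s + 1 := by
      have := killed_le hc
      have : c ≠ n s := fun h => hs (h ▸ hc)
      omega
    refine step s (c + 1) hcn (fun h => by have := hmax _ h; omega) ?_
    obtain ⟨T, hT⟩ := liveSet_inter_last hc hmax hcn
    rw [hT]
    exact hlast s _ T
  by_cases h2 : ∃ s, (∃ c, killed V s c) ∧ ¬ killed V s 0
  · obtain ⟨s, hne, hs⟩ := h2
    have hc := Nat.find_spec hne
    have hmin : ∀ c', killed V s c' → Nat.find hne ≤ c' := fun c' hc' => Nat.find_min' hne hc'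
    generalize Nat.find hne = c at hc hmin
    cases c with
    | zero => exact absurd hc hs
    | succ c =>
      have hk := killed_le hc
      refine step s c (by omega) (fun h => by have := hmin _ h; omega) ?_
      obtain ⟨T, hT⟩ := liveSet_inter_first hc (fun c' hc' => hmin c' hc') (by omega)
      rw [hT]
      exact hfirst s _ T
  have hV : ∀ i c, killed V i c → killed V i 0 ∧ killed V i (n i) := fun i c hc =>
    ⟨by by_contra h; exact h2 ⟨i, ⟨c, hc⟩, h⟩, by by_contra h; exact h1 ⟨i, ⟨c, hc⟩, h⟩⟩
  by_cases h3 : ∃ s c, killed V s c ∧ ∃ c' ≤ n s, ¬ killed V s c'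
  · obtain ⟨s, c, hc, c', hc', hk⟩ := h3
    obtain ⟨h0, hn'⟩ := hV s c hc
    obtain ⟨c1, ⟨hc1, hc1'⟩, hmax⟩ := exists_greatest (K := fun a => killed V s a ∧ a ≤ c')
      ⟨0, h0, Nat.zero_le _⟩ (fun a ha => ha.2)
    have hne : ∃ a, killed V s a ∧ c' ≤ a := ⟨n s, hn', hc'⟩
    have hc2 := Nat.find_spec hne
    have hmin : ∀ a, killed V s a ∧ c' ≤ a → Nat.find hne ≤ a := fun a ha => Nat.find_min' hne ha
    generalize Nat.find hne = c2 at hc2 hmin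
    have hlt1 : c1 ≠ c' := fun h => hk (h ▸ hc1)
    have hlt2 : c2 ≠ c' := fun h => hk (h ▸ hc2.1)
    have hle := killed_le hc2.1
    have hns := hn s
    -- The gap between neighbouring killed indices has length at most n_s ≤ 2b and at least 2, so it
    -- splits into two parts between 1 and b.
    obtain ⟨p, q, hp, hq, hpb, hqb, hpq⟩ : ∃ p q, 1 ≤ p ∧ 1 ≤ q ∧ p ≤ b ∧ q ≤ b ∧
        c2 = c1 + p + q := by
      rcases le_total (c2 - c1) (b + 1) with h | h
      · exact ⟨1, c2 - c1 - 1, by omega, by omega, by omega, by omega, by omega⟩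
      · exact ⟨c2 - c1 - b, b, by omega, by omega, by omega, by omega, by omega⟩
    have hgap : ∀ a, killed V s a → a ≤ c1 ∨ c1 + p + q ≤ a := by
      intro a ha
      rcases le_total a c' with h | h
      · exact Or.inl (hmax a ⟨ha, h⟩)
      · have := hmin a ⟨ha, h⟩
        exact Or.inr (by omega)
    refine step s (c1 + p) (by omega) (fun h => by have := hgap _ h; omega) ?_
    obtain ⟨T, hT⟩ := liveSet_inter_shallow hV hc1 (hpq ▸ hc2.1) hp hq hgap (by omega)
    rw [hT]
    exact hshallow s _ T p q hp hq hpb hqb (by omega)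
  · refine hpure V (fun i c hc c' hc' => ?_) ih
    by_contra h
    exact h3 ⟨i, c, hc, c', hc', h⟩

end LiveInduction

/-! ### Regularity of the quotients over the scroll -/

/-- Each variable that is added contributes a module with a linear resolution shifted by one degree,
and the induction ends at a `belowSet`, which has a linear resolution in degree 0. Thus R/(Y) has
regularity at most 1 over R. -/
theorem torScroll_liveSet {k : Type u} [Field k] {t : ℕ} {n : Fin t → ℕ} {b : ℕ} (hb1 : 1 ≤ b)
    (hb : ∀ s, b ≤ n s) (hn : ∀ s, n s ≤ 2 * b) {i j : ℕ} (hj : i + 1 < j)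
    (V : Set (ScrollVar n)) : TorScroll k n (liveSet V) i j := by
  have hpos : ∀ s, 1 ≤ n s := fun s => hb1.trans (hb s)
  obtain ⟨j, rfl⟩ := Nat.exists_eq_add_of_lt hj
  refine liveSet_induction (P := fun Ω => TorScroll k n Ω i (i + 1 + j + 1)) hb1 hn
    (fun V v h1 h2 => ?_) (fun s c T => ?_) (fun s c T => ?_) (fun s c T p q hp hq hpb hqb _ => ?_)
    (fun V hV _ => ?_) V
  · refine TorMon.mid scroll_surjective (scrollGrading k n) (liveSet_convex V)
      (isUpperIn_varMultiples _ v) h1 ?_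
    rwa [liveSet_diff]
  · exact (torScroll_firstSet hpos T (by omega)).translate_single s c
  · exact (torScroll_lastSet hpos T (by omega)).translate_single s c
  · exact (torScroll_shallowSet hpos T hp hq hb hpb hqb (by omega)).translate_single s c
  · rw [liveSet_eq_belowSet hV]
    exact torScroll_belowSet hpos i _ _ _ (by omega)

/-! ### Regularity over the polynomial ring -/

section OverPolynomials

variable {k : Type u} [Field k]

/-- The finest grading of the monomials. -/
def monomialWeight (σ : Type) : WeightMap σ (σ →₀ ℕ) where
  wt := AddMonoidHom.id _
  deg := Finsupp.degree
  deg_wt _ := rfl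

theorem polynomial_surjective {σ : Type} : Function.Surjective
    (algebraMap (MvPolynomial σ k) (MvPolynomial σ k)) := Function.surjective_id

variable (k) in
/-- The standard grading of the polynomial ring. -/
def polynomialGrading' (σ : Type) :
    ConnectedGrading (quotientGrading k σ (MvPolynomial σ k)) :=
  quotientGrading_self (k := k) (σ := σ) ▸ polynomialGrading σ k

theorem coef_smul_bas_zero {σ : Type} (h : (monomialWeight σ).IsConvex Set.univ)
    (p : MvPolynomial σ k) (m : σ →₀ ℕ) : coef m (p • bas k ⟨Set.univ, h⟩ 0) = p.coeff m := by
  classical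
  induction p using MvPolynomial.induction_on' with
  | monomial h c =>
    rw [monomial_smul_bas _ _ (Set.mem_univ _), add_zero, map_smul, coef_bas,
      MvPolynomial.coeff_monomial]
    simp only [Set.mem_univ, and_true]
    change (c • if m = h then (1 : k) else 0) = _
    simp [eq_comm]
  | add p q hp hq => rw [add_smul, map_add, hp, hq, MvPolynomial.coeff_add]

theorem monPresentation_polynomial (σ : Type) : MonPresentation k (MvPolynomial σ k)
    (⟨Set.univ, fun _ _ _ _ _ => Set.mem_univ _⟩ : ConvexSet (monomialWeight σ)) where
  surj := polynomial_surjective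
  zero_mem := Set.mem_univ _
  gen := fun ω _ => ⟨ω, rfl⟩
  ker p := by
    constructor
    · intro hp
      rw [show p = 0 from hp, zero_smul]
    · intro hp
      refine MvPolynomial.ext _ _ fun m => ?_
      have := coef_smul_bas_zero (fun _ _ _ _ _ => Set.mem_univ _) p m
      rw [hp, map_zero] at this
      exact this.symm

/-- The residue class rings modulo variables have linear resolutions. -/
theorem torMon_avoid {σ : Type} [DecidableEq σ] (V : Finset σ) :
    ∀ {i j : ℕ}, i < j → TorMon (monomialWeight σ) k (MvPolynomial σ k) {h | ∀ v ∈ V, h v = 0} i j := by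
  induction V using Finset.induction_on with
  | empty =>
    intro i j hij
    have h1 : {h : σ →₀ ℕ | ∀ v ∈ (∅ : Finset σ), h v = 0} = Set.univ := by ext; simp
    rw [h1]
    refine (monPresentation_polynomial σ).torMon_self polynomial_surjective (polynomialGrading' k σ) ?_
    rintro ⟨⟩
    omega
  | insert v V hv ih =>
    intro i j hij
    have hup : ∀ Ω, (monomialWeight σ).IsUpperIn Ω {h | h v ≠ 0} := by
      intro Ω ω _ hω a _
      change (a + ω) v ≠ 0
      change ω v ≠ 0 at hω
      rw [Finsupp.add_apply]
      omega
    have h1 : {h : σ →₀ ℕ | ∀ u ∈ insert v V, h u = 0} = {h | ∀ v ∈ V, h v = 0} \ {h | h v ≠ 0} := by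
      ext h
      simp only [Set.mem_sdiff, Set.mem_ofPred_eq, Finset.forall_mem_insert, ne_eq, not_not]
      exact and_comm
    have h2 : {h : σ →₀ ℕ | ∀ v ∈ V, h v = 0} ∩ {h | h v ≠ 0}
        = (fun ω => Finsupp.single v 1 + ω) '' {h : σ →₀ ℕ | ∀ v ∈ V, h v = 0} := by
      ext h
      constructor
      · rintro ⟨h3, h4⟩
        refine ⟨h - Finsupp.single v 1, fun w hw => ?_, ?_⟩
        · rw [Finsupp.tsub_apply, h3 w hw, Nat.zero_sub]
        · exact add_tsub_cancel_of_le
            (Finsupp.single_le_iff.mpr (Nat.one_le_iff_ne_zero.mpr h4))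
      · rintro ⟨g, hg, rfl⟩
        refine ⟨fun w hw => ?_, ?_⟩
        · have : w ≠ v := fun h => hv (h ▸ hw)
          simp [hg w hw, this.symm]
        · simp
    rw [h1]
    cases i with
    | zero => exact TorMon.quot_zero polynomial_surjective (hup _) (ih hij)
    | succ i =>
      refine TorMon.quot polynomial_surjective (polynomialGrading' k σ) (hup _) (ih hij) ?_
      rw [h2]
      obtain ⟨j, rfl⟩ := Nat.exists_eq_add_of_lt hij
      have := (ih (i := i) (j := i + 1 + j) (by omega)).translate polynomial_surjective
        (Finsupp.single v 1)
      change TorMon _ _ _ _ _ (_ + Finsupp.degree _) at this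
      rwa [Finsupp.degree_single] at this

variable {t : ℕ} {n : Fin t → ℕ}

variable (k n) in
/-- The vanishing of `Tor` over the polynomial ring. -/
abbrev TorPoly (Ω : Set (ScrollType t)) (i j : ℕ) : Prop :=
  TorMon (scrollWeight n) k (MvPolynomial (ScrollVar n) k) Ω i j

theorem TorPoly.translate_single {Ω : Set (ScrollType t)} {i j : ℕ} (h : TorPoly k n Ω i j)
    (a : Fin t) (c : ℕ) :
    TorPoly k n ((fun ω => ((Pi.single a 1, c) : ScrollType t) + ω) '' Ω) i (j + 1) := by
  have := TorMon.translate polynomial_surjective h ((Pi.single a 1, c) : ScrollType t)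
  rwa [scrollWeight_deg, Finset.sum_pi_single', if_pos (Finset.mem_univ a)] at this

/-- The residue field in the finest grading is obtained from `torMon_avoid` with all variables; it
is transported to the weights of the scroll. -/
theorem torPoly_zero {i j : ℕ} (hij : i < j) : TorPoly k n {0} i j := by
  have h := torMon_avoid (k := k) (σ := ScrollVar n) Finset.univ hij
  have h1 : {h : ScrollVar n →₀ ℕ | ∀ v ∈ Finset.univ, h v = 0} = {0} := by
    ext h
    simp [Finsupp.ext_iff]
  rw [h1] at h
  have := h.of_push (W' := scrollWeight n) (e := 0) polynomial_surjective (Ω' := {0})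
    (φ := (scrollWeight n).wt) ?_ (fun ω _ a => map_add _ _ _) ?_ (Set.injOn_singleton _ _)
    (by simp) ?_
  · exact this
  · rintro ω rfl a b hab
    have h2 : a + b = 0 :=
      (scrollWeight n).eq_zero_of_wt_eq_zero (by rw [map_add]; simpa using hab)
    simp [(add_eq_zero.mp h2).2]
  · rintro ω rfl a ha
    have h2 : a = 0 := (scrollWeight n).eq_zero_of_wt_eq_zero (by simpa using ha)
    simp [h2]
  · rintro ω rfl
    simp

theorem firstSet_empty : firstSet (∅ : Finset (Fin t)) = {0} := by
  ext ⟨d, w⟩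
  simp [firstSet, suppIn_empty, Prod.ext_iff]

theorem lastSet_empty : lastSet n (∅ : Finset (Fin t)) = {0} := by
  ext ⟨d, w⟩
  simp only [lastSet, suppIn_empty, Set.mem_ofPred_eq, Set.mem_singleton_iff, Prod.mk_eq_zero]
  refine and_congr_right ?_
  rintro rfl
  simp

/-- `firstSet T` is the polynomial ring in the first variables of the blocks in T. These act
injectively and are divided out one at a time until only the residue field is left. -/
theorem torPoly_firstSet (T : Finset (Fin t)) {i j : ℕ} (hij : i < j) :
    TorPoly k n (firstSet T) i j := by
  induction T using Finset.induction_on with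
  | empty => rw [firstSet_empty]; exact torPoly_zero hij
  | insert s T hs ih =>
    refine TorMon.of_nonzerodivisor (U := {g | g.1 s ≠ 0}) polynomial_surjective
      (polynomialGrading' k _) ⟨s, 0⟩ (firstSet_convex _) ?_ ?_
    · rw [scrollWeight_single]
      refine (inter_eq_translate_single (fun _ _ h => h) fun d w => ?_).symm
      simp only [firstSet, Set.mem_ofPred_eq, suppIn_add]
      refine ⟨fun h => ⟨w, by simp, h.1.1.2, h.1.2⟩, ?_⟩
      rintro ⟨w', rfl, h1, h2⟩
      exact ⟨⟨⟨suppIn_single (Finset.mem_insert_self s T), h1⟩, by simp [h2]⟩, single_add_ne_zero.mpr (Or.inl rfl)⟩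
    · have : firstSet (insert s T) \ {g | g.1 s ≠ 0} = firstSet T := by
        ext ⟨d, w⟩
        conv_rhs => rw [← Finset.erase_insert hs]
        simp only [firstSet, Set.mem_sdiff, Set.mem_ofPred_eq, suppIn_erase]
        tauto
      rwa [this]

theorem torPoly_lastSet (T : Finset (Fin t)) {i j : ℕ} (hij : i < j) :
    TorPoly k n (lastSet n T) i j := by
  induction T using Finset.induction_on with
  | empty => rw [lastSet_empty]; exact torPoly_zero hij
  | insert s T hs ih =>
    refine TorMon.of_nonzerodivisor (U := {g | g.1 s ≠ 0}) polynomial_surjective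
      (polynomialGrading' k _) ⟨s, Fin.last _⟩ (lastSet_convex _) ?_ ?_
    · rw [scrollWeight_single]
      refine (inter_eq_translate_single (fun _ _ h => h) fun d w => ?_).symm
      simp only [lastSet, Set.mem_ofPred_eq, suppIn_add, maxIndex_single_add, Fin.val_last]
      refine ⟨fun h => ⟨w - n s, by omega, h.1.1.2, by omega⟩, ?_⟩
      rintro ⟨w', rfl, h1, h2⟩
      exact ⟨⟨⟨suppIn_single (Finset.mem_insert_self s T), h1⟩, by omega⟩, single_add_ne_zero.mpr (Or.inl rfl)⟩
    · have : lastSet n (insert s T) \ {g | g.1 s ≠ 0} = lastSet n T := by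
        ext ⟨d, w⟩
        conv_rhs => rw [← Finset.erase_insert hs]
        simp only [lastSet, Set.mem_sdiff, Set.mem_ofPred_eq, suppIn_erase]
        tauto
      rwa [this]

/-- Dividing out the first variable of a block. -/
theorem torPoly_of_insert {V : Set (ScrollVar n)}
    (hV : ∀ i c, killed V i c → ∀ c' ≤ n i, killed V i c') {s : Fin t} (hs : ∀ c, ¬ killed V s c)
    {i j : ℕ} (h : TorPoly k n (liveSet (insert ⟨s, 0⟩ V)) i j) : TorPoly k n (liveSet V) i j := by
  classical
  refine TorMon.of_nonzerodivisor (U := varMultiples ⟨s, 0⟩) polynomial_surjective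
    (polynomialGrading' k _) ⟨s, 0⟩ (liveSet_convex _) ?_ (by rwa [liveSet_diff])
  rw [scrollWeight_single, liveSet_eq_belowSet hV]
  refine (inter_eq_translate_single (fun _ _ h => h.1) fun d w => ?_).symm
  have h0 : ((Pi.single s 1 + d, w) : ScrollType t) ∈ varMultiples (⟨s, 0⟩ : ScrollVar n) ↔
      0 ≤ w ∧ w ≤ maxIndex n d + 0 := mem_varMultiples_single_add
  rw [h0]
  simp only [belowSet, Set.mem_ofPred_eq, suppIn_add, maxIndex_single_add]
  refine ⟨fun h => ⟨w, by simp, h.1.1.2, h.2.2⟩, ?_⟩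
  rintro ⟨w', rfl, h1, h2⟩
  have h3 : (((0 : Fin (n s + 1)) : ℕ) + w') = w' := by simp
  rw [h3]
  exact ⟨⟨⟨suppIn_single (Finset.mem_filter.mpr ⟨Finset.mem_univ s, hs⟩), h1⟩, by omega⟩,
    by omega, h2⟩

/-- The same induction over the polynomial ring, where `firstSet` and `lastSet` still have linear
resolutions and the balance hypothesis trivializes the remaining type of subquotient. -/
theorem torPoly_liveSet {b : ℕ} (hb1 : 1 ≤ b)
    (hb : ∀ s, b ≤ n s) (hn : ∀ s, n s ≤ b + 1) {i j : ℕ} (hj : i + 1 < j)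
    (V : Set (ScrollVar n)) : TorPoly k n (liveSet V) i j := by
  classical
  obtain ⟨j, rfl⟩ := Nat.exists_eq_add_of_lt hj
  refine liveSet_induction (P := fun Ω => TorPoly k n Ω i (i + 1 + j + 1)) hb1
    (fun s => (hn s).trans (by omega))
    (fun V v h1 h2 => ?_) (fun s c T => ?_) (fun s c T => ?_) (fun s c T p q hp hq hpb hqb hpq => ?_)
    (fun V hV ih => ?_) V
  · refine TorMon.mid polynomial_surjective (polynomialGrading' k _) (liveSet_convex V)
      (isUpperIn_varMultiples _ v) h1 ?_
    rwa [liveSet_diff]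
  · exact (torPoly_firstSet T (by omega)).translate_single s c
  · exact (torPoly_lastSet T (by omega)).translate_single s c
  -- The inequalities give D(d) ≤ p + q - 2 ≤ b - 1, whereas D(d) ≥ b for every nonzero d.
  · have h0 : shallowSet n T p q = {0} := by
      ext ⟨d, w⟩
      simp only [shallowSet, Set.mem_ofPred_eq, Set.mem_singleton_iff, Prod.mk_eq_zero]
      constructor
      · rintro ⟨h1, h2, h3, h4⟩
        have hd : d = 0 := by
          by_contra hd
          obtain ⟨i, hi⟩ := Function.ne_iff.mp hd
          have := maxIndex_of_ne (n := n) hi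
          have := hb i
          have := hn s
          omega
        subst hd
        rw [map_zero] at h2
        exact ⟨rfl, by omega⟩
      · rintro ⟨rfl, rfl⟩
        rw [map_zero]
        exact ⟨suppIn_zero T, le_rfl, by omega, by omega⟩
    rw [h0]
    exact (torPoly_zero (by omega)).translate_single s c
  -- The first variable of an untouched block is a nonzerodivisor, so killing it is harmless and
  -- leads to a larger V. If there is no untouched block, only the residue field remains.
  · by_cases hs : ∃ s, ∀ c, ¬ killed V s c
    · obtain ⟨s, hs⟩ := hs
      exact torPoly_of_insert hV hs (ih _ (Set.ssubset_insert fun h => hs 0 ⟨by omega, h⟩))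
    · rw [liveSet_eq_singleton hV fun s => not_forall_not.mp fun h => hs ⟨s, h⟩]
      exact torPoly_zero (by omega)

end OverPolynomials

/-! ### The residue field as a monomial module -/

section Residue

variable {σ G : Type} [AddCommMonoid G] {W : WeightMap σ G} {k : Type u} [Field k]
  {A : Type u} [CommRing A] [Algebra k A] [Algebra (MvPolynomial σ k) A]
  [IsScalarTower k (MvPolynomial σ k) A]

variable (W) in
theorem WeightMap.isConvex_zero : W.IsConvex {0} := by
  rintro ω rfl a b hab
  have h2 : a + b = 0 := W.eq_zero_of_wt_eq_zero (by rw [map_add]; simpa using hab)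
  have h3 : b = 0 := (add_eq_zero.mp h2).2
  simp [h3]

theorem smul_bas_zero_singleton (p : MvPolynomial σ k) :
    p • bas k ⟨{0}, W.isConvex_zero⟩ 0 = p.coeff 0 • bas k ⟨{0}, W.isConvex_zero⟩ 0 := by
  classical
  induction p using MvPolynomial.induction_on' with
  | monomial h c =>
    rw [monomial_smul_bas _ _ (Set.mem_singleton _), add_zero, MvPolynomial.coeff_monomial]
    split_ifs with h0
    · rw [h0, map_zero]
    · rw [bas_eq_zero, smul_zero, zero_smul]
      exact fun h1 => h0 (W.eq_zero_of_wt_eq_zero h1)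
  | add p q hp hq => rw [add_smul, hp, hq, MvPolynomial.coeff_add, add_smul]

theorem bas_ne_zero {Ω : ConvexSet W} {ω : G} (hω : ω ∈ Ω.carrier) : bas k Ω ω ≠ 0 := by
  classical
  intro h
  have := congrArg (coef ω) h
  rw [coef_bas, if_pos ⟨rfl, hω⟩, map_zero] at this
  exact one_ne_zero this

theorem algebraMap_sub_coeff_mem (p : MvPolynomial σ k) :
    algebraMap (MvPolynomial σ k) A p - algebraMap k A (p.coeff 0)
      ∈ irrelevantIdeal (quotientGrading k σ A) := by
  classical
  induction p using MvPolynomial.induction_on' with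
  | monomial h c =>
    rw [MvPolynomial.coeff_monomial]
    split_ifs with h0
    · rw [h0, IsScalarTower.algebraMap_apply k (MvPolynomial σ k) A, MvPolynomial.algebraMap_eq,
        MvPolynomial.C_apply, sub_self]
      exact Ideal.zero_mem _
    · rw [map_zero, sub_zero]
      refine mem_irrelevantIdeal (d := h.degree) ?_
        ⟨_, MvPolynomial.isHomogeneous_monomial c rfl, rfl⟩
      exact Nat.pos_of_ne_zero fun h1 => h0 ((Finsupp.degree_eq_zero_iff h).mp h1)
  | add p q hp hq =>
    rw [map_add, MvPolynomial.coeff_add, map_add, add_sub_add_comm]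
    exact Ideal.add_mem _ hp hq

namespace MonPresentation

variable {Ω : ConvexSet W}

theorem nontrivial (h : MonPresentation k A Ω) : Nontrivial A := by
  refine ⟨⟨1, 0, fun h1 => ?_⟩⟩
  have h2 := h.equiv_algebraMap 1
  rw [map_one, h1, map_zero, one_smul] at h2
  exact bas_ne_zero h.zero_mem h2.symm

theorem algebraMap_mem_irrelevantIdeal (h : MonPresentation k A Ω) {p : MvPolynomial σ k} :
    algebraMap (MvPolynomial σ k) A p ∈ irrelevantIdeal (quotientGrading k σ A) ↔
      p.coeff 0 = 0 := by
  have h1 := algebraMap_sub_coeff_mem (A := A) p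
  constructor
  · intro hp
    by_contra h0
    have h2 : algebraMap k A (p.coeff 0) ∈ irrelevantIdeal (quotientGrading k σ A) := by
      simpa using Ideal.sub_mem _ hp h1
    have h3 : (1 : A) ∈ irrelevantIdeal (quotientGrading k σ A) := by
      have := Ideal.mul_mem_left _ (algebraMap k A (p.coeff 0)⁻¹) h2
      rwa [← map_mul, inv_mul_cancel₀ h0, map_one] at this
    have := h.nontrivial
    exact one_ne_zero (h.grading.eq_zero_of_mem_zero h3 h.grading.one_mem)
  · intro h0
    rwa [h0, map_zero, sub_zero] at h1

theorem residue (h : MonPresentation k A Ω) :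
    MonPresentation k (A ⧸ irrelevantIdeal (quotientGrading k σ A))
      (⟨{0}, W.isConvex_zero⟩ : ConvexSet W) where
  surj := Ideal.Quotient.mk_surjective.comp h.surj
  zero_mem := rfl
  gen := by
    rintro ω rfl
    exact ⟨0, map_zero _⟩
  ker p := by
    have h1 : algebraMap (MvPolynomial σ k) (A ⧸ irrelevantIdeal (quotientGrading k σ A)) p
      = Ideal.Quotient.mk _ (algebraMap (MvPolynomial σ k) A p) := rfl
    rw [h1, Ideal.Quotient.eq_zero_iff_mem, h.algebraMap_mem_irrelevantIdeal,
      smul_bas_zero_singleton]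
    exact (smul_eq_zero_iff_left (bas_ne_zero (Set.mem_singleton _))).symm

end MonPresentation

theorem quotientGrading_residue :
    quotientGrading k σ (A ⧸ irrelevantIdeal (quotientGrading k σ A))
      = residueGrading (quotientGrading k σ A) := by
  funext d
  ext x
  constructor
  · rintro ⟨p, hp, rfl⟩
    exact ⟨_, ⟨p, hp, rfl⟩, rfl⟩
  · rintro ⟨_, ⟨p, hp, rfl⟩, rfl⟩
    exact ⟨p, hp, rfl⟩

theorem finite_quotientGrading [Finite σ] (d : ℕ) : Module.Finite k (quotientGrading k σ A d) := by
  rw [Module.Finite.iff_fg]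
  exact (MvPolynomial.homogeneousSubmodule_fg σ k d).map _

/-- R₊ lives in positive degrees, so a tensor with i factors from R₊ has degree at least i. This
disposes of the part of Tor below the diagonal. -/
theorem ConnectedGrading.barDeg_eq_bot {R : Type u} [CommRing R] [Algebra k R]
    {𝒜 : ℕ → Submodule k R} (GA : ConnectedGrading 𝒜) {M : Type u} [AddCommGroup M] [Module k M]
    [Module R M] [IsScalarTower k R M] (ℳ : ℕ → Submodule k M) {i j : ℕ} (h : j < i) :
    barDeg 𝒜 ℳ i j = ⊥ := by
  induction i generalizing j with
  | zero => omega
  | succ i ih =>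
    refine eq_bot_iff.mpr fun z hz => ?_
    refine barDeg_succ_le 𝒜 (φ := LinearMap.id) (Q := ⊥) (fun a b hab r hr y hy => ?_) hz
    change (r ⊗ₜ[k] y : irrelevantIdeal 𝒜 ⊗[k] barObj 𝒜 M i) ∈ (⊥ : Submodule k _)
    rw [Submodule.mem_bot]
    rcases Nat.eq_zero_or_pos a with rfl | ha
    · rw [show r = 0 from Subtype.ext (GA.eq_zero_of_mem_zero r.2 hr), TensorProduct.zero_tmul]
    · rw [ih (j := b) (by omega)] at hy
      rw [(Submodule.mem_bot k).mp hy, TensorProduct.tmul_zero]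

theorem ConnectedGrading.torZero_of_lt {R : Type u} [CommRing R] [Algebra k R]
    {𝒜 : ℕ → Submodule k R} (GA : ConnectedGrading 𝒜) {M : Type u} [AddCommGroup M] [Module k M]
    [Module R M] [IsScalarTower k R M] (ℳ : ℕ → Submodule k M) {i j : ℕ} (h : j < i) :
    TorZero 𝒜 ℳ i j := by
  intro z hz
  have h1 := barCycles_le_barDeg 𝒜 ℳ i j hz
  rw [GA.barDeg_eq_bot ℳ h] at h1
  rw [(Submodule.mem_bot k).mp h1]
  exact Submodule.zero_mem _

end Residue

/-! ### Koszulness and regularity of the quotients -/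

section Quotients

variable {k : Type u} [Field k] {t : ℕ} {n : Fin t → ℕ}

theorem torScroll_zero (hpos : ∀ s, 1 ≤ n s) {i j : ℕ} (hij : i < j) : TorScroll k n {0} i j := by
  rw [← firstSet_empty]
  exact torScroll_firstSet hpos ∅ hij

/-- Change of rings along R → R/(Y), applied to k with generator degree 0: R/(Y) has regularity at
most 1 over R, and k has a linear resolution over R. -/
theorem isKoszul_quotient {b : ℕ} (hb1 : 1 ≤ b) (hb : ∀ s, b ≤ n s) (hn : ∀ s, n s ≤ 2 * b)
    {Y : Set (Scroll k n)} (hY : Y ⊆ naturalCoordinates k n) :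
    IsKoszul (quotientGrading k (ScrollVar n) (Scroll k n ⧸ Ideal.span Y)) := by
  have hA := monPresentation_quotient hY
  have hN := hA.residue
  intro i j hij
  rw [← torZero_iff, ← quotientGrading_residue]
  rcases lt_or_gt_of_ne hij with h | h
  · exact hA.grading.torZero_of_lt _ h
  · refine TorZero.change_of_rings (scrollGrading k n) hA.grading ?_
      (fun d => finite_quotientGrading d) (fun i j hij => ?_) i 0 _ _ hN.grading.proj ?_
      (fun d => finite_quotientGrading d) (fun j hj => absurd hj (Nat.not_lt_zero j))
      (fun i j hij => ?_) j h
    · rintro d _ ⟨p, hp, rfl⟩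
      exact ⟨p, hp, rfl⟩
    · exact (hA.torZero_iff scroll_surjective i j).mpr (torScroll_liveSet hb1 hb hn hij _)
    · rintro a b _ ⟨p, hp, rfl⟩ _ ⟨q, hq, rfl⟩
      refine ⟨p * q, hp.mul hq, ?_⟩
      exact map_mul (algebraMap (MvPolynomial (ScrollVar n) k) _) p q
    · exact (hN.torZero_iff scroll_surjective i j).mpr
        (torScroll_zero (fun s => hb1.trans (hb s)) hij)

theorem absReg_le {σ : Type} {A : Type u} [CommRing A] [Algebra k A] [Algebra (MvPolynomial σ k) A]
    [IsScalarTower k (MvPolynomial σ k) A] {r : ℕ}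
    (h : ∀ i j, i + r < j →
      TorZero (MvPolynomial.homogeneousSubmodule σ k) (quotientGrading k σ A) i j) :
    absReg k σ A ≤ ((r : ℝ) : EReal) := by
  refine sSup_le ?_
  rintro _ ⟨i, j, hij, rfl⟩
  have h1 : j ≤ i + r := by
    by_contra h2
    exact not_nontrivial_iff_subsingleton.mpr ((torZero_iff _ _ i j).mp (h i j (by omega))) hij
  have h2 : (j : ℝ) ≤ i + r := by exact_mod_cast h1
  exact EReal.coe_le_coe_iff.mpr (by linarith)

theorem le_absReg {σ : Type} {A : Type u} [CommRing A] [Algebra k A] [Algebra (MvPolynomial σ k) A]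
    [IsScalarTower k (MvPolynomial σ k) A] {r i : ℕ}
    (h : ¬ TorZero (MvPolynomial.homogeneousSubmodule σ k) (quotientGrading k σ A) i (i + r)) :
    ((r : ℝ) : EReal) ≤ absReg k σ A := by
  refine le_sSup ⟨i, i + r, ?_, ?_⟩
  · rwa [torZero_iff, not_subsingleton_iff_nontrivial] at h
  · rw [Nat.cast_add, add_sub_cancel_left]

theorem MonPresentation.torPoly_iff {A : Type u} [CommRing A] [Algebra k A]
    [Algebra (MvPolynomial (ScrollVar n) k) A] [IsScalarTower k (MvPolynomial (ScrollVar n) k) A]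
    {Ω : ConvexSet (scrollWeight n)} (h : MonPresentation k A Ω) (i j : ℕ) :
    TorZero (MvPolynomial.homogeneousSubmodule (ScrollVar n) k)
      (quotientGrading k (ScrollVar n) A) i j ↔ TorPoly k n Ω.carrier i j := by
  have h1 := h.torZero_iff (E := MvPolynomial (ScrollVar n) k) polynomial_surjective i j
  rwa [quotientGrading_self] at h1

theorem absReg_quotient_le_one {b : ℕ} (hb1 : 1 ≤ b) (hb : ∀ s, b ≤ n s) (hn : ∀ s, n s ≤ b + 1)
    {Y : Set (Scroll k n)} (hY : Y ⊆ naturalCoordinates k n) :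
    absReg k (ScrollVar n) (Scroll k n ⧸ Ideal.span Y) ≤ ((1 : ℕ) : ℝ) :=
  absReg_le fun i j hij => ((monPresentation_quotient hY).torPoly_iff i j).mpr
    (torPoly_liveSet hb1 hb hn hij _)

/-- If in each block an initial segment is killed, the regularity is at most one. -/
theorem torPoly_liveSet_initial {i j : ℕ} (hj : i + 1 < j) (V : Set (ScrollVar n))
    (hV : ∀ s c, killed V s c → ∀ c' ≤ c, killed V s c') : TorPoly k n (liveSet V) i j := by
  classical
  induction V using WellFoundedGT.induction with
  | ind V ih =>
  have hins : ∀ (s : Fin t) (c : ℕ) (hc : c < n s + 1) (a : Fin t) (c' : ℕ),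
      killed (insert ⟨s, ⟨c, hc⟩⟩ V) a c' ↔ (a = s ∧ c' = c) ∨ killed V a c' := by
    intro s c hc a c'
    constructor
    · rintro ⟨h, h1 | h1⟩
      · obtain ⟨rfl, h2⟩ := Sigma.mk.inj_iff.mp h1
        exact Or.inl ⟨rfl, Fin.mk.inj_iff.mp (eq_of_heq h2)⟩
      · exact Or.inr ⟨h, h1⟩
    · rintro (⟨rfl, rfl⟩ | ⟨h, h1⟩)
      · exact ⟨hc, Set.mem_insert _ _⟩
      · exact ⟨h, Set.mem_insert_of_mem _ h1⟩
  -- Extending an initial segment by its next variable keeps it initial, so only subquotients of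
  -- type `lastSet` occur, and no condition on the sizes of the blocks is needed.
  by_cases h1 : ∃ s, (∃ c, killed V s c) ∧ ¬ killed V s (n s)
  · obtain ⟨s, hne, hs⟩ := h1
    obtain ⟨c, hc, hmax⟩ := exists_greatest hne fun c => killed_le
    have hcn : c + 1 < n s + 1 := by
      have := killed_le hc
      have : c ≠ n s := fun h => hs (h ▸ hc)
      omega
    refine TorMon.mid (U := varMultiples ⟨s, ⟨c + 1, hcn⟩⟩) polynomial_surjective
      (polynomialGrading' k _) (liveSet_convex V) (isUpperIn_varMultiples _ _) ?_ ?_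
    · obtain ⟨T, hT⟩ := liveSet_inter_last hc hmax hcn
      rw [hT]
      obtain ⟨j, rfl⟩ := Nat.exists_eq_add_of_lt hj
      exact (torPoly_lastSet T (by omega)).translate_single s _
    · rw [liveSet_diff]
      refine ih _ (Set.ssubset_insert fun h => ?_) fun a c' h c'' hc'' => ?_
      · have := hmax _ ⟨hcn, h⟩
        omega
      · rw [hins] at h ⊢
        rcases h with ⟨rfl, rfl⟩ | h
        · rcases Nat.lt_or_ge c'' (c + 1) with h2 | h2
          · exact Or.inr (hV _ c hc c'' (by omega))
          · exact Or.inl ⟨rfl, by omega⟩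
        · exact Or.inr (hV a c' h c'' hc'')
  · have hpure : ∀ i c, killed V i c → ∀ c' ≤ n i, killed V i c' := fun i c hc c' hc' => by
      refine hV i (n i) ?_ c' hc'
      by_contra h
      exact h1 ⟨i, ⟨c, hc⟩, h⟩
    by_cases hs : ∃ s, ∀ c, ¬ killed V s c
    · obtain ⟨s, hs⟩ := hs
      refine torPoly_of_insert hpure hs (ih _ (Set.ssubset_insert fun h => hs 0 ⟨by omega, h⟩)
        fun a c' h c'' hc'' => ?_)
      have h0 := hins s 0 (Nat.succ_pos _)
      rw [show (⟨0, Nat.succ_pos _⟩ : Fin (n s + 1)) = 0 from rfl] at h0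
      rw [h0] at h ⊢
      rcases h with ⟨rfl, rfl⟩ | h
      · exact Or.inl ⟨rfl, by omega⟩
      · exact Or.inr (hV a c' h c'' hc'')
    · rw [liveSet_eq_singleton hpure fun s => not_forall_not.mp fun h => hs ⟨s, h⟩]
      exact torPoly_zero (by omega)

theorem absReg_scroll_le_one : absReg k (ScrollVar n) (Scroll k n) ≤ ((1 : ℕ) : ℝ) :=
  absReg_le fun i j hij => (monPresentation_scroll.torPoly_iff i j).mpr
    (torPoly_liveSet_initial hij ∅ fun _ _ h => h.2.elim)

theorem zero_le_absReg_scroll : ((0 : ℕ) : ℝ) ≤ absReg k (ScrollVar n) (Scroll k n) := by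
  have hS := monPresentation_scroll (k := k) (n := n)
  refine le_absReg (i := 0) fun h => ?_
  obtain ⟨c, hc, hc1⟩ := h (show (1 : Scroll k n) ∈ _ from hS.grading.one_mem)
  rw [SetLike.mem_coe, (polynomialGrading (ScrollVar n) k).barDeg_eq_bot _ Nat.zero_lt_one,
    Submodule.mem_bot] at hc
  rw [hc, map_zero] at hc1
  have := hS.nontrivial
  exact zero_ne_one hc1

end Quotients

/-! ### Quadratic relations force positive regularity -/

section Quadric

variable {σ : Type} {k : Type u} [Field k] {A : Type u} [CommRing A] [Algebra k A]
  [Algebra (MvPolynomial σ k) A] [IsScalarTower k (MvPolynomial σ k) A]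

open MvPolynomial in
/-- The part of degree at most one of a polynomial. -/
def affinePart (k : Type u) [Field k] (σ : Type) : MvPolynomial σ k →ₗ[k] MvPolynomial σ k :=
  homogeneousComponent 0 + homogeneousComponent 1

theorem sub_affinePart_mem (p : MvPolynomial σ k) :
    p - affinePart k σ p ∈ MvPolynomial.idealOfVars σ k ^ 2 := by
  rw [MvPolynomial.mem_pow_idealOfVars_iff']
  intro x hx
  rw [affinePart, LinearMap.add_apply, MvPolynomial.coeff_sub, MvPolynomial.coeff_add,
    MvPolynomial.coeff_homogeneousComponent, MvPolynomial.coeff_homogeneousComponent]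
  rcases (by omega : x.degree = 0 ∨ x.degree = 1) with h | h <;> simp [h]

theorem affinePart_eq_zero {p : MvPolynomial σ k} (hp : p ∈ MvPolynomial.idealOfVars σ k ^ 2) :
    affinePart k σ p = 0 := by
  rw [MvPolynomial.mem_pow_idealOfVars_iff'] at hp
  refine MvPolynomial.ext _ _ fun x => ?_
  rw [affinePart, LinearMap.add_apply, MvPolynomial.coeff_add,
    MvPolynomial.coeff_homogeneousComponent, MvPolynomial.coeff_homogeneousComponent]
  have := hp x
  split_ifs with h1 h2 h2
  · omega
  · simp [hp x (by omega)]
  · simp [hp x (by omega)]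
  · simp

theorem affinePart_X (v : σ) : affinePart k σ (MvPolynomial.X v) = MvPolynomial.X v := by
  rw [affinePart, LinearMap.add_apply,
    MvPolynomial.homogeneousComponent_eq_self (MvPolynomial.isHomogeneous_X k v),
    MvPolynomial.homogeneousComponent_of_mem (MvPolynomial.isHomogeneous_X k v), if_neg (by simp),
    zero_add]

/-- All relations of A lie in the square of the ideal of the variables, so the part of degree at
most 1 of a representative depends only on its class in A. -/
theorem exists_affineLift (hA : Function.Surjective (algebraMap (MvPolynomial σ k) A))
    (hker : ∀ p, algebraMap (MvPolynomial σ k) A p = 0 → p ∈ MvPolynomial.idealOfVars σ k ^ 2) :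
    ∃ ℓ : A →ₗ[k] MvPolynomial σ k, ∀ p, ℓ (algebraMap (MvPolynomial σ k) A p) = affinePart k σ p := by
  have key : ∀ p q, algebraMap (MvPolynomial σ k) A p = algebraMap (MvPolynomial σ k) A q →
      affinePart k σ p = affinePart k σ q := by
    intro p q hpq
    rw [← sub_eq_zero, ← map_sub]
    exact affinePart_eq_zero (hker _ (by rw [map_sub, hpq, sub_self]))
  refine ⟨{ toFun := fun a => affinePart k σ (Function.surjInv hA a)
            map_add' := fun a b => ?_
            map_smul' := fun c a => ?_ }, fun p => key _ _ (Function.surjInv_eq hA _)⟩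
  · rw [← map_add]
    refine key _ _ ?_
    rw [map_add]
    simp only [Function.surjInv_eq hA]
  · rw [RingHom.id_apply, ← map_smul]
    refine key _ _ ?_
    rw [Algebra.smul_def c (Function.surjInv hA a), map_mul, ← IsScalarTower.algebraMap_apply, ← Algebra.smul_def]
    simp only [Function.surjInv_eq hA]

theorem irrelevantIdeal_le_idealOfVars :
    irrelevantIdeal (MvPolynomial.homogeneousSubmodule σ k) ≤ MvPolynomial.idealOfVars σ k := by
  refine Ideal.span_le.mpr ?_
  rintro p ⟨d, hd, hp⟩
  rw [SetLike.mem_coe, ← pow_one (MvPolynomial.idealOfVars σ k),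
    MvPolynomial.mem_pow_idealOfVars_iff']
  intro x hx
  exact MvPolynomial.IsHomogeneous.coeff_eq_zero hp (by omega)

/-- A binomial relation between quadratic monomials gives a nonzero element of `Tor₁`. -/
theorem not_torZero_one_two (hA : Function.Surjective (algebraMap (MvPolynomial σ k) A))
    (hker : ∀ p, algebraMap (MvPolynomial σ k) A p = 0 → p ∈ MvPolynomial.idealOfVars σ k ^ 2)
    {a b c d : σ} (hrel : algebraMap (MvPolynomial σ k) A (.X a * .X b - .X c * .X d) = 0)
    (hne : (Finsupp.single a 1 + Finsupp.single b 1 : σ →₀ ℕ)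
      ≠ Finsupp.single c 1 + Finsupp.single d 1) :
    ¬ TorZero (MvPolynomial.homogeneousSubmodule σ k) (quotientGrading k σ A) 1 2 := by
  classical
  obtain ⟨ℓ, hℓ⟩ := exists_affineLift hA hker
  set e : σ →₀ ℕ := Finsupp.single a 1 + Finsupp.single b 1 with he
  have hedeg : e.degree = 2 := by rw [he, map_add, Finsupp.degree_single, Finsupp.degree_single]
  -- The functional r ⊗ m ↦ coefficient of x_a x_b in r · ℓ(m) separates the syzygy `z` below from
  -- the boundaries.
  let lam : barObj (MvPolynomial.homogeneousSubmodule σ k) A 1 →ₗ[k] k :=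
    TensorProduct.lift (LinearMap.mk₂ k
      (fun (r : irrelevantIdeal (MvPolynomial.homogeneousSubmodule σ k)) (m : A) =>
        MvPolynomial.coeff e ((r : MvPolynomial σ k) * ℓ m))
      (fun r s m => by simp [add_mul]) (fun c r m => by simp)
      (fun r m m' => by simp [mul_add]) (fun c r m => by simp))
  have hlam : ∀ (r : irrelevantIdeal (MvPolynomial.homogeneousSubmodule σ k)) (m : A),
      lam (r ⊗ₜ[k] m) = MvPolynomial.coeff e ((r : MvPolynomial σ k) * ℓ m) := fun _ _ => rfl
  have hbd : lam ∘ₗ barD (MvPolynomial.homogeneousSubmodule σ k) A 1 = 0 := by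
    refine TensorProduct.ext' fun r y => ?_
    rw [LinearMap.comp_apply, barD_tmul, map_sub, LinearMap.zero_apply]
    induction y using TensorProduct.induction_on with
    | zero => simp
    | add x y hx hy =>
      rw [map_add, map_add, map_add, TensorProduct.tmul_add, map_add, add_sub_add_comm, hx, hy,
        add_zero]
    | tmul s m =>
      obtain ⟨p, rfl⟩ := hA m
      rw [barMul_tmul, barD_tmul_zero, hlam, hlam, Algebra.smul_def, ← map_mul, hℓ, hℓ, ← MvPolynomial.coeff_sub]
      have hr := irrelevantIdeal_le_idealOfVars r.2
      have hs := irrelevantIdeal_le_idealOfVars s.2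
      have h1 := sub_affinePart_mem ((s : MvPolynomial σ k) * p)
      have h2 : (s : MvPolynomial σ k) * (p - affinePart k σ p) ∈ MvPolynomial.idealOfVars σ k ^ 2 :=
        Ideal.mul_mem_left _ _ (sub_affinePart_mem p)
      -- The value on a boundary is the coefficient, at a monomial of degree 2, of r times an
      -- element of the squared ideal of the variables, which has order at least 3.
      have h3 : (((r : MvPolynomial σ k) • s : irrelevantIdeal _) : MvPolynomial σ k)
            * affinePart k σ p - r * affinePart k σ (s * p)
          = r * ((s * p - affinePart k σ (s * p)) - s * (p - affinePart k σ p)) := by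
        change (r * s : MvPolynomial σ k) * affinePart k σ p - r * affinePart k σ (s * p) = _
        ring
      rw [h3]
      refine (MvPolynomial.mem_pow_idealOfVars_iff' 3 _).mp ?_ e (by omega)
      rw [pow_succ' (MvPolynomial.idealOfVars σ k) 2]
      exact Ideal.mul_mem_mul hr (Ideal.sub_mem _ h1 h2)
  have hX : ∀ v, (MvPolynomial.X v : MvPolynomial σ k)
      ∈ MvPolynomial.homogeneousSubmodule σ k 1 := fun v => MvPolynomial.isHomogeneous_X k v
  have hXA : ∀ v, algebraMap (MvPolynomial σ k) A (.X v) ∈ quotientGrading k σ A 1 :=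
    fun v => ⟨_, hX v, rfl⟩
  let z : barObj (MvPolynomial.homogeneousSubmodule σ k) A 1 :=
    varPlus a ⊗ₜ[k] algebraMap (MvPolynomial σ k) A (.X b)
      - varPlus c ⊗ₜ[k] algebraMap (MvPolynomial σ k) A (.X d)
  have hz : z ∈ barCycles (MvPolynomial.homogeneousSubmodule σ k) (quotientGrading k σ A) 1 2 := by
    refine ⟨?_, Submodule.sub_mem _
      (tmul_mem_barDeg (MvPolynomial.homogeneousSubmodule σ k) (a := 1) (b := 1) (hX a) (hXA b))
      (tmul_mem_barDeg (MvPolynomial.homogeneousSubmodule σ k) (a := 1) (b := 1) (hX c) (hXA d))⟩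
    change barD (MvPolynomial.homogeneousSubmodule σ k) A 0 z = 0
    rw [map_sub, barD_tmul_zero, barD_tmul_zero]
    change (MvPolynomial.X a : MvPolynomial σ k) • _ - (MvPolynomial.X c : MvPolynomial σ k) • _ = 0
    rw [Algebra.smul_def, Algebra.smul_def, ← map_mul, ← map_mul, ← map_sub, hrel]
  intro h
  obtain ⟨y, -, hy⟩ := h hz
  have h1 : lam z = 0 := by
    rw [← hy]
    exact LinearMap.congr_fun hbd y
  rw [map_sub, hlam, hlam, hℓ, hℓ, affinePart_X, affinePart_X] at h1
  change MvPolynomial.coeff e (.X a * .X b) - MvPolynomial.coeff e (.X c * .X d) = 0 at h1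
  simp only [MvPolynomial.X, MvPolynomial.monomial_mul, one_mul, MvPolynomial.coeff_monomial] at h1
  rw [if_pos rfl, if_neg hne.symm, sub_zero] at h1
  exact one_ne_zero h1

end Quadric

section LowRegularity

variable {k : Type u} [Field k] {t : ℕ} {n : Fin t → ℕ}

theorem minorsIdeal_le : minorsIdeal (scrollMatrix k n)
    ≤ MvPolynomial.idealOfVars (ScrollVar n) k ^ 2 := by
  refine Ideal.span_le.mpr ?_
  rintro _ ⟨a, b, rfl⟩
  rw [Matrix.det_fin_two]
  simp only [scrollMatrix, Matrix.submatrix_apply, id_eq, Matrix.of_apply, Matrix.cons_val_zero,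
    Matrix.cons_val_one]
  rw [pow_two]
  exact Ideal.sub_mem _
    (Ideal.mul_mem_mul (Ideal.subset_span ⟨_, rfl⟩) (Ideal.subset_span ⟨_, rfl⟩))
    (Ideal.mul_mem_mul (Ideal.subset_span ⟨_, rfl⟩) (Ideal.subset_span ⟨_, rfl⟩))

/-- Two different columns of the matrix give a minor whose two terms are different quadratic
monomials; they are told apart by the exponent of y_{i,c}. -/
theorem one_le_absReg_scroll {i a : Fin t} {c b : ℕ} (hc : c < n i) (hb : b < n a)
    (hne : ¬ (i = a ∧ c = b)) : ((1 : ℕ) : ℝ) ≤ absReg k (ScrollVar n) (Scroll k n) := by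
  classical
  refine le_absReg (i := 1) (not_torZero_one_two scroll_surjective
    (fun p hp => minorsIdeal_le (Ideal.Quotient.eq_zero_iff_mem.mp hp))
    (Ideal.Quotient.eq_zero_iff_mem.mpr (scroll_relation k n hc hb)) fun h => ?_)
  have h1 := DFunLike.congr_fun h (⟨i, ⟨c, by omega⟩⟩ : ScrollVar n)
  simp only [Finsupp.add_apply, Finsupp.single_apply] at h1
  have h2 : ¬ ((⟨i, ⟨c + 1, by omega⟩⟩ : ScrollVar n) = ⟨i, ⟨c, by omega⟩⟩) := by
    intro h
    obtain ⟨-, h⟩ := Sigma.mk.inj_iff.mp h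
    have := Fin.mk.inj_iff.mp (eq_of_heq h)
    omega
  have h3 : ¬ ((⟨a, ⟨b, by omega⟩⟩ : ScrollVar n) = ⟨i, ⟨c, by omega⟩⟩) := by
    intro h
    obtain ⟨rfl, h⟩ := Sigma.mk.inj_iff.mp h
    have := Fin.mk.inj_iff.mp (eq_of_heq h)
    exact hne ⟨rfl, this.symm⟩
  rw [if_neg h2, if_neg h3] at h1
  simp only [if_true] at h1
  omega

/-- For a single block of size 1 the matrix has one column, so R is a polynomial ring in two
variables with reg R = 0. Regularity at most 1 would not suffice for its quotients, but these are
polynomial rings in the remaining variables. -/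
theorem torPoly_liveSet_line {s : Fin t} (hs : ∀ i, i = s) (hn : n s = 1) {i j : ℕ} (hij : i < j)
    (V : Set (ScrollVar n)) : TorPoly k n (liveSet V) i j := by
  have hD : ∀ d, maxIndex n d = d s := by
    intro d
    change ∑ i, d i * n i = d s
    rw [Fintype.sum_eq_single s (fun i hi => absurd (hs i) hi), hn, mul_one]
  have hle : ∀ i c, killed V i c → c = 0 ∨ c = 1 := by
    intro i c hc
    have := killed_le hc
    rw [hs i, hn] at this
    omega
  have hlast : ∀ V : Set (ScrollVar n), killed V s 0 → ¬ killed V s 1 →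
      TorPoly k n (liveSet V) i j := by
    intro V h0 h1
    have : liveSet V = lastSet n Finset.univ := by
      ext ⟨d, w⟩
      rw [mem_liveSet_iff]
      simp only [lastSet, Set.mem_ofPred_eq, suppIn_univ, true_and, hD]
      constructor
      · rintro ⟨h2, h3⟩
        by_contra h4
        have := h3 s 0 h0 (by omega) (by omega)
        omega
      · rintro rfl
        refine ⟨le_rfl, fun i c hc hd _ => ?_⟩
        obtain rfl := hs i
        have := killed_le hc
        have : c ≠ 1 := fun h => h1 (h ▸ hc)
        omega
    rw [this]
    exact torPoly_lastSet _ hij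
  by_cases h0 : killed V s 0
  · by_cases h1 : killed V s 1
    · rw [liveSet_eq_singleton (fun i c _ c' hc' => ?_) fun i => ⟨0, hs i ▸ h0⟩]
      · exact torPoly_zero hij
      · obtain rfl := hs i
        rcases (by omega : c' = 0 ∨ c' = 1) with rfl | rfl
        · exact h0
        · exact h1
    · exact hlast V h0 h1
  · by_cases h1 : killed V s 1
    · have : liveSet V = firstSet Finset.univ := by
        ext ⟨d, w⟩
        rw [mem_liveSet_iff]
        simp only [firstSet, Set.mem_ofPred_eq, suppIn_univ, true_and, hD]
        constructor
        · rintro ⟨h2, h3⟩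
          by_contra h4
          have := h3 s 1 h1 (by omega) (by omega)
          omega
        · rintro rfl
          refine ⟨Nat.zero_le _, fun i c hc hd h5 => ?_⟩
          obtain rfl := hs i
          exact absurd ((Nat.le_zero.mp h5) ▸ hc) h0
      rw [this]
      exact torPoly_firstSet _ hij
    · have hno : ∀ i c, ¬ killed V i c := by
        intro i c hc
        obtain rfl := hs i
        rcases hle _ c hc with rfl | rfl
        · exact h0 hc
        · exact h1 hc
      refine torPoly_of_insert (s := s) (fun i c hc => absurd hc (hno i c)) (hno s)
        (hlast _ ⟨by omega, Set.mem_insert _ _⟩ ?_)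
      rintro ⟨h2, h3 | h3⟩
      · obtain ⟨-, h4⟩ := Sigma.mk.inj_iff.mp h3
        have := congrArg Fin.val (eq_of_heq h4)
        simp at this
      · exact h1 ⟨h2, h3⟩

theorem absReg_quotient_line {s : Fin t} (hs : ∀ i, i = s) (hn : n s = 1)
    {Y : Set (Scroll k n)} (hY : Y ⊆ naturalCoordinates k n) :
    absReg k (ScrollVar n) (Scroll k n ⧸ Ideal.span Y) ≤ ((0 : ℕ) : ℝ) :=
  absReg_le fun i j hij => ((monPresentation_quotient hY).torPoly_iff i j).mpr
    (torPoly_liveSet_line hs hn (by omega) _)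

end LowRegularity

/-! ### Quotients by chosen coordinates -/

section Chosen

variable {k : Type u} [Field k] {t : ℕ} {n : Fin t → ℕ}

variable (k) in
/-- The coordinates belonging to a set of variables. -/
def coordinates (V : Set (ScrollVar n)) : Set (Scroll k n) :=
  (fun v : ScrollVar n => Ideal.Quotient.mk (minorsIdeal (scrollMatrix k n)) (.X v)) '' V

theorem coordinates_subset (V : Set (ScrollVar n)) : coordinates k V ⊆ naturalCoordinates k n :=
  Set.image_subset_range _ _

/-- Different variables have different weights. Hence the variables whose classes lie in
`coordinates k V` are exactly those of V. -/
theorem coordinate_injective : Function.Injective fun v : ScrollVar n =>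
    Ideal.Quotient.mk (minorsIdeal (scrollMatrix k n)) (.X v) := by
  classical
  intro v v' h
  have hS := monPresentation_scroll (k := k) (n := n)
  have key : ∀ v : ScrollVar n, hS.equiv
      (Ideal.Quotient.mk (minorsIdeal (scrollMatrix k n)) (.X v))
        = bas k ⟨liveSet ∅, liveSet_convex ∅⟩ (varWeight n v) := by
    intro v
    refine (hS.equiv_algebraMap (.X v)).trans ?_
    rw [MvPolynomial.X, monomial_smul_bas _ _ hS.zero_mem, one_smul, add_zero, scrollWeight_single]
  have hmem : varWeight n v' ∈ liveSet (∅ : Set (ScrollVar n)) := by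
    refine ⟨?_, fun _ h => h.elim⟩
    have := scrollWeight_le n (Finsupp.single v' 1)
    rwa [scrollWeight_single] at this
  have h1 := congrArg (coef (varWeight n v')) ((key v).symm.trans ((congrArg hS.equiv h).trans (key v')))
  have h2 : varWeight n v' = varWeight n v := by
    by_contra h2
    rw [coef_bas, coef_bas, if_neg fun h3 => h2 h3.1, if_pos ⟨rfl, hmem⟩] at h1
    exact zero_ne_one h1
  obtain ⟨i, c⟩ := v
  obtain ⟨i', c'⟩ := v'
  have h3 : i' = i := by
    by_contra h4
    have := congrFun (congrArg Prod.fst h2) i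
    simp [varWeight, Pi.single_eq_of_ne' h4] at this
  subst h3
  have h4 : (c' : ℕ) = c := congrArg Prod.snd h2
  rw [Fin.ext h4]

theorem monPresentation_coordinates (V : Set (ScrollVar n)) :
    MonPresentation k (Scroll k n ⧸ Ideal.span (coordinates k V))
      ⟨liveSet V, liveSet_convex V⟩ := by
  have h := monPresentation_quotient (coordinates_subset (k := k) V)
  have h1 : {v | Ideal.Quotient.mk (minorsIdeal (scrollMatrix k n)) (.X v) ∈ coordinates k V} = V := by
    ext v
    exact coordinate_injective.mem_set_image
  simpa only [h1] using h

theorem two_le_absReg_of_socle {V : Set (ScrollVar n)} {g : ScrollType t} (hg : g ∈ liveSet V)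
    (hdeg : (scrollWeight n).deg g = 2) (hs : ∀ v, varWeight n v + g ∉ liveSet V) :
    ((2 : ℕ) : ℝ) ≤ absReg k (ScrollVar n) (Scroll k n ⧸ Ideal.span (coordinates k V)) := by
  obtain ⟨i, hi⟩ := exists_not_torZero_of_socle (k := k) (σ := ScrollVar n)
    (ℳ := monGrading k ⟨liveSet V, liveSet_convex V⟩) (bas_ne_zero hg) (fun v => by
      rw [MvPolynomial.X, monomial_smul_bas _ _ hg, scrollWeight_single, bas_eq_zero (hs v),
        smul_zero]) (hdeg ▸ bas_mem_monGrading g)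
  refine le_absReg (i := i) fun h => hi ?_
  rw [(monPresentation_coordinates V).torPoly_iff] at h
  obtain ⟨_, h⟩ := h
  rwa [quotientGrading_self] at h

end Chosen

/-! ### Quotients supported on two blocks -/

section TwoBlocks

variable {t : ℕ} {n : Fin t → ℕ}

variable (n) in
/-- The variables outside of the blocks `x` and `z`, and those of the block `z` whose index is not
in the interval from `1` to `N - 1`. -/
def gapVars (x z : Fin t) (N : ℕ) : Set (ScrollVar n) :=
  {v | (v.1 ≠ x ∧ v.1 ≠ z) ∨ (v.1 = z ∧ ((v.2 : ℕ) = 0 ∨ N ≤ v.2))}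

theorem killed_gapVars {x z : Fin t} {N : ℕ} {i : Fin t} {c : ℕ} :
    killed (gapVars n x z N) i c ↔
      c ≤ n i ∧ ((i ≠ x ∧ i ≠ z) ∨ (i = z ∧ (c = 0 ∨ N ≤ c))) :=
  ⟨fun ⟨h, h1⟩ => ⟨Nat.lt_succ_iff.mp h, h1⟩, fun ⟨h, h1⟩ => ⟨Nat.lt_succ_iff.mpr h, h1⟩⟩

/-- The weights supported on two blocks. -/
def pairType (x z : Fin t) (a b w : ℕ) : ScrollType t := (Pi.single x a + Pi.single z b, w)

theorem pairType_add (x z : Fin t) (a b w a' b' w' : ℕ) :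
    pairType x z a b w + pairType x z a' b' w' = pairType x z (a + a') (b + b') (w + w') := by
  refine Prod.ext ?_ rfl
  change Pi.single x a + Pi.single z b + (Pi.single x a' + Pi.single z b')
    = (Pi.single x (a + a') + Pi.single z (b + b') : Fin t → ℕ)
  rw [Pi.single_add, Pi.single_add, add_add_add_comm]

theorem pairType_inj {x z : Fin t} {a b w w' : ℕ} :
    pairType x z a b w = pairType x z a b w' ↔ w = w' := by simp [pairType]

theorem maxIndex_single' (i : Fin t) (a : ℕ) : maxIndex n (Pi.single i a) = a * n i := by
  change ∑ j, (Pi.single i a : Fin t → ℕ) j * n j = a * n i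
  rw [Fintype.sum_eq_single i fun j hj => by rw [Pi.single_eq_of_ne hj, zero_mul],
    Pi.single_eq_same]

theorem maxIndex_pairType (x z : Fin t) (a b w : ℕ) :
    maxIndex n (pairType x z a b w).1 = a * n x + b * n z := by
  rw [pairType, map_add, maxIndex_single', maxIndex_single']

theorem pairType_fst_left {x z : Fin t} (hxz : x ≠ z) (a b w : ℕ) :
    (pairType x z a b w).1 x = a := by
  simp [pairType, Pi.single_eq_of_ne hxz]

theorem pairType_fst_right {x z : Fin t} (hxz : x ≠ z) (a b w : ℕ) :
    (pairType x z a b w).1 z = b := by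
  simp [pairType, Pi.single_eq_of_ne hxz.symm]

theorem pairType_fst_other {x z i : Fin t} (hx : i ≠ x) (hz : i ≠ z) (a b w : ℕ) :
    (pairType x z a b w).1 i = 0 := by
  simp [pairType, Pi.single_eq_of_ne hx, Pi.single_eq_of_ne hz]

theorem varWeight_eq_left (x z : Fin t) (c : Fin (n x + 1)) :
    varWeight n ⟨x, c⟩ = pairType x z 1 0 c := by simp [varWeight, pairType]

theorem varWeight_eq_right (x z : Fin t) (c : Fin (n z + 1)) :
    varWeight n ⟨z, c⟩ = pairType x z 0 1 c := by simp [varWeight, pairType]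

/-- If z occurs, the killed index 0 in z rules out w ≤ D(d) - n_z, and the killed indices from N on
rule out w ≥ N. If z does not occur, nothing is killed. -/
theorem pairType_mem_liveSet {x z : Fin t} (hxz : x ≠ z) {N : ℕ} (hN : N ≤ n z) {a b w : ℕ} :
    pairType x z a b w ∈ liveSet (gapVars n x z N) ↔ w ≤ a * n x + b * n z ∧
      (b ≠ 0 → a * n x + b * n z < w + n z ∧ w < N) := by
  have hD := maxIndex_pairType (n := n) x z a b w
  change ((pairType x z a b w).1, w) ∈ _ ↔ _
  rw [mem_liveSet_iff, hD]
  refine and_congr_right fun hw => ⟨fun h hb => ?_, fun h i c hc hd hcw hle => ?_⟩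
  · have hb' : (pairType x z a b w).1 z ≠ 0 := by rwa [pairType_fst_right hxz]
    have h1 := h z 0 (killed_gapVars.mpr ⟨by omega, Or.inr ⟨rfl, Or.inl rfl⟩⟩) hb' (by omega)
    have h2 : n z ≤ b * n z := Nat.le_mul_of_pos_left _ (Nat.pos_of_ne_zero hb)
    refine ⟨by omega, ?_⟩
    by_contra h3
    -- For w ≥ N the index min(w, n_z) is at least N because N ≤ n_z, so this variable is killed; it
    -- divides the weight.
    refine h z (min w (n z)) (killed_gapVars.mpr ⟨by omega, Or.inr ⟨rfl, Or.inr (by omega)⟩⟩) hb'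
      (by omega) ?_
    omega
  · obtain ⟨h1, ⟨h2, h3⟩ | ⟨rfl, h2⟩⟩ := killed_gapVars.mp hc
    · exact hd (pairType_fst_other h2 h3 _ _ _)
    · rw [pairType_fst_right hxz] at hd
      have := h hd
      omega

/-- In degree (a, b) with b ≥ 1 the live weights satisfy a·n_x + (b-1)·n_z < w < n_x + 2. This
leaves only w = n_x + 1 in degree (1,1) and nothing in the degrees (2,1) and (1,2), by n_x ≥ 1. -/
theorem socle_gapVars {x z : Fin t} (hxz : x ≠ z) (hx : 1 ≤ n x) (hz : n x + 2 ≤ n z)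
    (v : ScrollVar n) :
    varWeight n v + pairType x z 1 1 (n x + 1) ∉ liveSet (gapVars n x z (n x + 2)) := by
  obtain ⟨i, c⟩ := v
  intro h
  have hc := Nat.lt_succ_iff.mp c.2
  by_cases h1 : i = x
  · subst h1
    rw [varWeight_eq_left i z, pairType_add, pairType_mem_liveSet hxz hz] at h
    have := h.2 (by omega)
    omega
  · by_cases h2 : i = z
    · subst h2
      rw [varWeight_eq_right x, pairType_add, pairType_mem_liveSet hxz hz] at h
      have := h.2 (by omega)
      omega
    · obtain ⟨m, hm⟩ := exists_wt_eq n (d := (pairType x z 1 1 (n x + 1)).1) (w := n x + 1)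
        (by rw [maxIndex_pairType]; omega)
      refine h.2 ⟨i, c⟩ (Or.inl ⟨h1, h2⟩) ?_
      rw [show pairType x z 1 1 (n x + 1) = (scrollWeight n).wt m from hm.symm, add_comm]
      exact add_mem_varMultiples (varWeight_mem_varMultiples _) m

theorem two_le_absReg_gapVars {k : Type u} [Field k] {x z : Fin t} (hxz : x ≠ z) (hx : 1 ≤ n x)
    (hz : n x + 2 ≤ n z) : ((2 : ℕ) : ℝ) ≤ absReg k (ScrollVar n)
      (Scroll k n ⧸ Ideal.span (coordinates k (gapVars n x z (n x + 2)))) := by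
  refine two_le_absReg_of_socle (g := pairType x z 1 1 (n x + 1))
    ((pairType_mem_liveSet hxz hz).mpr ⟨by omega, fun _ => by omega⟩) ?_ (socle_gapVars hxz hx hz)
  rw [scrollWeight_deg]
  simp [pairType, Finset.sum_add_distrib]

end TwoBlocks

/-! ### A functional on the bar complex -/

section Functional

variable {t : ℕ} {n : Fin t → ℕ}

variable (n) in
/-- The indicator of the monomials in the block `x` of large index. -/
def largeIndex (x z : Fin t) (g : ScrollType t) : ℤ :=
  if g.1 z = 0 ∧ n x * g.1 x < g.2 + n x then 1 else 0

theorem largeIndex_pairType {x z : Fin t} (hxz : x ≠ z) (a b w : ℕ) :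
    largeIndex n x z (pairType x z a b w) = if b = 0 ∧ n x * a < w + n x then 1 else 0 := by
  rw [largeIndex, pairType_fst_left hxz, pairType_fst_right hxz]
  rfl

open Classical in
variable (n) in
/-- The functional on words of three monomials. -/
def wordValue (x z : Fin t) (Ω : Set (ScrollType t)) (g₁ g₂ g₃ : ScrollType t) : ℤ :=
  if g₁ + g₂ + g₃ = pairType x z 3 1 (2 * n x + 1) ∧ g₁ ∈ Ω ∧ g₂ ∈ Ω ∧ g₃ ∈ Ω then
    largeIndex n x z g₁ - largeIndex n x z g₃ else 0

theorem exists_eq_single {d : Fin t → ℕ} (hd : ∑ i, d i = 1) : ∃ i, d = Pi.single i 1 := by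
  obtain ⟨i, hi⟩ : ∃ i, d i ≠ 0 := by
    by_contra! h
    rw [Finset.sum_eq_zero fun i _ => h i] at hd
    omega
  obtain ⟨d', rfl⟩ := exists_add_single hi
  refine ⟨i, ?_⟩
  have h1 : ∑ j, (Pi.single i 1 + d' : Fin t → ℕ) j = 1 + ∑ j, d' j := by
    simp [Finset.sum_add_distrib]
  have h2 : ∑ j, d' j = 0 := by omega
  have h3 : d' = 0 := funext fun j => Finset.sum_eq_zero_iff.mp h2 j (Finset.mem_univ j)
  rw [h3, add_zero]

/-- A letter of a word of total weight in two blocks belongs to one of the blocks. -/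
theorem eq_pairType {x z : Fin t} {a b w : ℕ} {g g' : ScrollType t}
    (hg : (scrollWeight n).deg g = 1) (h : g + g' = pairType x z a b w) :
    g = pairType x z 1 0 g.2 ∨ g = pairType x z 0 1 g.2 := by
  obtain ⟨d, w'⟩ := g
  obtain ⟨i, rfl⟩ := exists_eq_single hg
  have h1 := congrFun (congrArg Prod.fst h) i
  by_cases hx : i = x
  · left; subst hx; simp [pairType]
  · by_cases hz : i = z
    · right; subst hz; simp [pairType]
    · rw [pairType_fst_other hx hz] at h1
      simp at h1

/-- The total weight has exactly one letter in z, so the identity splits into four cases by its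
position. Products containing z are live only in the window of `pairType_mem_liveSet`; since the
total index is 2n_x + 1, two complementary pairs of letters cannot both have index sum at most n_x
or both above it, which balances the values of `largeIndex`. -/
theorem wordValue_boundary_aux {x z : Fin t} (hxz : x ≠ z) (hz : 2 * n x + 1 ≤ n z)
    {g₁ g₂ g₃ g₄ : ScrollType t} (h1 : (scrollWeight n).deg g₁ = 1)
    (h2 : (scrollWeight n).deg g₂ = 1) (h3 : (scrollWeight n).deg g₃ = 1)
    (h4 : (scrollWeight n).deg g₄ = 1)
    (htot : g₁ + g₂ + g₃ + g₄ = pairType x z 3 1 (2 * n x + 1))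
    (hl : ∀ g ∈ [g₁, g₂, g₃, g₄], g ∈ liveSet (gapVars n x z (2 * n x + 1))) :
    wordValue n x z (liveSet (gapVars n x z (2 * n x + 1))) (g₁ + g₂) g₃ g₄
      - wordValue n x z (liveSet (gapVars n x z (2 * n x + 1))) g₁ (g₂ + g₃) g₄
      + wordValue n x z (liveSet (gapVars n x z (2 * n x + 1))) g₁ g₂ (g₃ + g₄) = 0 := by
  have e2 : g₁ + g₂ + (g₃ + g₄) = pairType x z 3 1 (2 * n x + 1) := by
    rw [← htot, add_assoc (g₁ + g₂) g₃ g₄]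
  simp only [List.mem_cons, List.not_mem_nil, or_false, forall_eq_or_imp, forall_eq] at hl
  obtain ⟨l1, l2, l3, l4⟩ := hl
  simp only [wordValue]
  have hz' := congrFun (congrArg Prod.fst htot) z
  have hw := congrArg Prod.snd htot
  simp only [Prod.fst_add, Prod.snd_add, Pi.add_apply, pairType_fst_right hxz] at hz' hw
  change _ = 2 * n x + 1 at hw
  have p1 := eq_pairType h1 (g' := g₂ + (g₃ + g₄)) (by rw [← e2, add_assoc])
  have p2 := eq_pairType h2 (g' := g₁ + (g₃ + g₄)) (by rw [← e2, add_left_comm, add_assoc])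
  have p3 := eq_pairType h3 (g' := g₁ + g₂ + g₄) (by rw [← htot]; abel)
  have p4 := eq_pairType h4 (g' := g₁ + g₂ + g₃) (by rw [← htot]; abel)
  clear h1 h2 h3 h4 htot e2
  generalize g₁.2 = w₁ at *
  generalize g₂.2 = w₂ at *
  generalize g₃.2 = w₃ at *
  generalize g₄.2 = w₄ at *
  rcases p1 with rfl | rfl <;> rcases p2 with rfl | rfl <;> rcases p3 with rfl | rfl <;>
    rcases p4 with rfl | rfl <;> simp only [pairType_fst_right hxz] at hz' <;>
    first
    | (exfalso; omega)
    | (simp [pairType_add, pairType_inj, pairType_mem_liveSet hxz hz, largeIndex_pairType hxz] at *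
       split_ifs <;> omega)

/-- Four nontrivial monomials of total degree 4 are four variables, so the preceding lemma applies
whenever the total weight is the prescribed one. Otherwise, or if some letter is dead, all three
terms are zero. -/
theorem wordValue_boundary {x z : Fin t} (hxz : x ≠ z) (hz : 2 * n x + 1 ≤ n z)
    {h₁ h₂ h₃ h₄ : ScrollVar n →₀ ℕ} (n1 : h₁ ≠ 0) (n2 : h₂ ≠ 0) (n3 : h₃ ≠ 0) (n4 : h₄ ≠ 0) :
    wordValue n x z (liveSet (gapVars n x z (2 * n x + 1)))
        ((scrollWeight n).wt h₁ + (scrollWeight n).wt h₂) ((scrollWeight n).wt h₃)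
        ((scrollWeight n).wt h₄)
      - wordValue n x z (liveSet (gapVars n x z (2 * n x + 1))) ((scrollWeight n).wt h₁)
        ((scrollWeight n).wt h₂ + (scrollWeight n).wt h₃) ((scrollWeight n).wt h₄)
      + wordValue n x z (liveSet (gapVars n x z (2 * n x + 1))) ((scrollWeight n).wt h₁)
        ((scrollWeight n).wt h₂) ((scrollWeight n).wt h₃ + (scrollWeight n).wt h₄) = 0 := by
  set Ω := liveSet (gapVars n x z (2 * n x + 1)) with hΩ
  have hlow : ∀ a b : ScrollVar n →₀ ℕ, (scrollWeight n).wt a + (scrollWeight n).wt b ∈ Ω →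
      (scrollWeight n).wt a ∈ Ω ∧ (scrollWeight n).wt b ∈ Ω := by
    intro a b hab
    constructor
    · have := liveSet_convex (gapVars n x z (2 * n x + 1)) 0 (zero_mem_liveSet _) b a
        (by rw [add_zero, add_comm ((scrollWeight n).wt b)]; exact hab)
      rwa [add_zero] at this
    · have := liveSet_convex (gapVars n x z (2 * n x + 1)) 0 (zero_mem_liveSet _) a b
        (by rw [add_zero]; exact hab)
      rwa [add_zero] at this
  by_cases hl : ∀ g ∈ [(scrollWeight n).wt h₁, (scrollWeight n).wt h₂, (scrollWeight n).wt h₃,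
      (scrollWeight n).wt h₄], g ∈ Ω
  · by_cases htot : (scrollWeight n).wt h₁ + (scrollWeight n).wt h₂ + (scrollWeight n).wt h₃
        + (scrollWeight n).wt h₄ = pairType x z 3 1 (2 * n x + 1)
    · have hd := congrArg (scrollWeight n).deg htot
      have hd' : (scrollWeight n).deg (pairType x z 3 1 (2 * n x + 1)) = 4 := by
        rw [scrollWeight_deg]
        simp [pairType, Finset.sum_add_distrib]
      rw [hd', map_add, map_add, map_add] at hd
      have hpos : ∀ h : ScrollVar n →₀ ℕ, h ≠ 0 →
          (scrollWeight n).deg ((scrollWeight n).wt h) ≠ 0 := by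
        intro h hh h0
        rw [(scrollWeight n).deg_wt] at h0
        exact hh ((Finsupp.degree_eq_zero_iff h).mp h0)
      have := hpos _ n1
      have := hpos _ n2
      have := hpos _ n3
      have := hpos _ n4
      exact wordValue_boundary_aux hxz hz (by omega) (by omega) (by omega) (by omega) htot hl
    · have e1 : ¬ (scrollWeight n).wt h₁ + ((scrollWeight n).wt h₂ + (scrollWeight n).wt h₃)
          + (scrollWeight n).wt h₄ = pairType x z 3 1 (2 * n x + 1) := by rwa [← add_assoc]
      have e2 : ¬ (scrollWeight n).wt h₁ + (scrollWeight n).wt h₂ + ((scrollWeight n).wt h₃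
          + (scrollWeight n).wt h₄) = pairType x z 3 1 (2 * n x + 1) := by rwa [← add_assoc]
      rw [wordValue, wordValue, wordValue, if_neg fun h => htot h.1, if_neg fun h => e1 h.1,
        if_neg fun h => e2 h.1]
      rfl
  · simp only [List.mem_cons, List.not_mem_nil, or_false, forall_eq_or_imp, forall_eq] at hl
    rw [wordValue, wordValue, wordValue, if_neg, if_neg, if_neg]
    · rfl
    · rintro ⟨-, a, b, c⟩
      exact hl ⟨a, b, (hlow _ _ c).1, (hlow _ _ c).2⟩
    · rintro ⟨-, a, b, c⟩
      exact hl ⟨a, (hlow _ _ b).1, (hlow _ _ b).2, c⟩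
    · rintro ⟨-, a, b, c⟩
      exact hl ⟨(hlow _ _ a).1, (hlow _ _ a).2, b, c⟩

end Functional

/-! ### Detecting nonzero classes of homological degree three -/

section Cocycle

variable {k : Type u} [Field k] {R : Type u} [CommRing R] [Algebra k R] (𝒜 : ℕ → Submodule k R)
  {N : Type u} [AddCommGroup N] [Module k N] [Module R N] [IsScalarTower k R N]

/-- The linear form `r₁ ⊗ r₂ ⊗ r₃ ⊗ m ↦ T r₁ r₂ r₃ * ε m` on the bar complex. -/
def barForm (T : irrelevantIdeal 𝒜 →ₗ[k] irrelevantIdeal 𝒜 →ₗ[k] irrelevantIdeal 𝒜 →ₗ[k] k)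
    (ε : N →ₗ[k] k) : barObj 𝒜 N 3 →ₗ[k] k :=
  let U₁ : (irrelevantIdeal 𝒜 →ₗ[k] k) →ₗ[k] (irrelevantIdeal 𝒜 ⊗[k] N →ₗ[k] k) :=
    TensorProduct.uncurry (RingHom.id k) (irrelevantIdeal 𝒜) N k ∘ₗ
      LinearMap.compRight k (LinearMap.toSpanSingleton k (N →ₗ[k] k) ε)
  let U₂ : (irrelevantIdeal 𝒜 →ₗ[k] irrelevantIdeal 𝒜 →ₗ[k] k) →ₗ[k]
      (irrelevantIdeal 𝒜 ⊗[k] (irrelevantIdeal 𝒜 ⊗[k] N) →ₗ[k] k) :=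
    TensorProduct.uncurry (RingHom.id k) (irrelevantIdeal 𝒜) (irrelevantIdeal 𝒜 ⊗[k] N) k ∘ₗ LinearMap.compRight k U₁
  TensorProduct.lift (U₂ ∘ₗ T)

theorem barForm_tmul
    (T : irrelevantIdeal 𝒜 →ₗ[k] irrelevantIdeal 𝒜 →ₗ[k] irrelevantIdeal 𝒜 →ₗ[k] k)
    (ε : N →ₗ[k] k) (r₁ r₂ r₃ : irrelevantIdeal 𝒜) (m : N) :
    barForm 𝒜 T ε (r₁ ⊗ₜ[k] (r₂ ⊗ₜ[k] (r₃ ⊗ₜ[k] m))) = T r₁ r₂ r₃ * ε m := rfl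

/-- As R₊ annihilates N, the last term of the differential drops out, and the others cancel by the
cocycle identity `hT`. -/
theorem barForm_barD
    {T : irrelevantIdeal 𝒜 →ₗ[k] irrelevantIdeal 𝒜 →ₗ[k] irrelevantIdeal 𝒜 →ₗ[k] k}
    (hT : ∀ r₁ r₂ r₃ r₄ : irrelevantIdeal 𝒜,
      T ((r₁ : R) • r₂) r₃ r₄ - T r₁ ((r₂ : R) • r₃) r₄ + T r₁ r₂ ((r₃ : R) • r₄) = 0)
    (hN : ∀ (r : irrelevantIdeal 𝒜) (m : N), (r : R) • m = 0) (ε : N →ₗ[k] k)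
    (b : barObj 𝒜 N 4) : barForm 𝒜 T ε (barD 𝒜 N 3 b) = 0 := by
  induction b using TensorProduct.induction_on with
  | zero => rw [map_zero, map_zero]
  | add x y hx hy => rw [map_add, map_add, hx, hy, add_zero]
  | tmul r₁ b =>
  induction b using TensorProduct.induction_on with
  | zero => rw [TensorProduct.tmul_zero, map_zero, map_zero]
  | add x y hx hy => rw [TensorProduct.tmul_add, map_add, map_add, hx, hy, add_zero]
  | tmul r₂ b =>
  induction b using TensorProduct.induction_on with
  | zero => rw [TensorProduct.tmul_zero, TensorProduct.tmul_zero, map_zero, map_zero]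
  | add x y hx hy =>
    rw [TensorProduct.tmul_add, TensorProduct.tmul_add, map_add, map_add, hx, hy, add_zero]
  | tmul r₃ b =>
  induction b using TensorProduct.induction_on with
  | zero =>
    rw [TensorProduct.tmul_zero, TensorProduct.tmul_zero, TensorProduct.tmul_zero, map_zero,
      map_zero]
  | add x y hx hy =>
    rw [TensorProduct.tmul_add, TensorProduct.tmul_add, TensorProduct.tmul_add, map_add, map_add,
      hx, hy, add_zero]
  | tmul r₄ m =>
  have h : barD 𝒜 N 3 (r₁ ⊗ₜ[k] (r₂ ⊗ₜ[k] (r₃ ⊗ₜ[k] (r₄ ⊗ₜ[k] m))))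
      = ((r₁ : R) • r₂) ⊗ₜ[k] (r₃ ⊗ₜ[k] (r₄ ⊗ₜ[k] m))
        - r₁ ⊗ₜ[k] (((r₂ : R) • r₃) ⊗ₜ[k] (r₄ ⊗ₜ[k] m)
          - r₂ ⊗ₜ[k] (((r₃ : R) • r₄) ⊗ₜ[k] m - r₃ ⊗ₜ[k] ((r₄ : R) • m))) := rfl
  rw [h, hN, TensorProduct.tmul_zero, sub_zero, TensorProduct.tmul_sub, map_sub, map_sub]
  have h1 := barForm_tmul 𝒜 T ε
  erw [h1, h1, h1]
  linear_combination ε m * hT r₁ r₂ r₃ r₄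

/-- Because r u = s u = 0 and r s = s r, the antisymmetrized tensor r ⊗ s ⊗ u ⊗ e - s ⊗ r ⊗ u ⊗ e is
a cycle. The form vanishes on boundaries but not on this cycle. -/
theorem not_torZero_of_barForm
    {T : irrelevantIdeal 𝒜 →ₗ[k] irrelevantIdeal 𝒜 →ₗ[k] irrelevantIdeal 𝒜 →ₗ[k] k}
    (hT : ∀ r₁ r₂ r₃ r₄ : irrelevantIdeal 𝒜,
      T ((r₁ : R) • r₂) r₃ r₄ - T r₁ ((r₂ : R) • r₃) r₄ + T r₁ r₂ ((r₃ : R) • r₄) = 0)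
    (hN : ∀ (r : irrelevantIdeal 𝒜) (m : N), (r : R) • m = 0) (ε : N →ₗ[k] k)
    {𝒩 : ℕ → Submodule k N} {a c : ℕ} {r s u : irrelevantIdeal 𝒜} {e : N}
    (hr : (r : R) ∈ 𝒜 a) (hs : (s : R) ∈ 𝒜 a) (hu : (u : R) ∈ 𝒜 c) (he : e ∈ 𝒩 0)
    (hru : (r : R) * u = 0) (hsu : (s : R) * u = 0)
    (hv : (T r s u - T s r u) * ε e ≠ 0) : ¬ TorZero 𝒜 𝒩 3 (a + (a + (c + 0))) := by
  intro h
  have hdeg : ∀ {r s : irrelevantIdeal 𝒜}, (r : R) ∈ 𝒜 a → (s : R) ∈ 𝒜 a →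
      (r ⊗ₜ[k] (s ⊗ₜ[k] (u ⊗ₜ[k] e)) : barObj 𝒜 N 3) ∈ barDeg 𝒜 𝒩 3 (a + (a + (c + 0))) :=
    fun hr hs => tmul_mem_barDeg 𝒜 hr (tmul_mem_barDeg 𝒜 hs (tmul_mem_barDeg 𝒜 hu he))
  have hd : ∀ {r s : irrelevantIdeal 𝒜}, (s : R) * u = 0 →
      barD 𝒜 N 2 (r ⊗ₜ[k] (s ⊗ₜ[k] (u ⊗ₜ[k] e))) = ((r : R) • s) ⊗ₜ[k] (u ⊗ₜ[k] e) := by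
    intro r s hsu
    have h : barD 𝒜 N 2 (r ⊗ₜ[k] (s ⊗ₜ[k] (u ⊗ₜ[k] e)))
        = ((r : R) • s) ⊗ₜ[k] (u ⊗ₜ[k] e)
          - r ⊗ₜ[k] (((s : R) • u) ⊗ₜ[k] e - s ⊗ₜ[k] ((u : R) • e)) := rfl
    rw [h, hN, show (s : R) • u = 0 from Subtype.ext hsu, TensorProduct.zero_tmul,
      TensorProduct.tmul_zero, sub_zero, TensorProduct.tmul_zero, sub_zero]
  have hz : (r ⊗ₜ[k] (s ⊗ₜ[k] (u ⊗ₜ[k] e)) - s ⊗ₜ[k] (r ⊗ₜ[k] (u ⊗ₜ[k] e)) : barObj 𝒜 N 3)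
      ∈ barCycles 𝒜 𝒩 3 (a + (a + (c + 0))) := by
    refine ⟨?_, Submodule.sub_mem _ (hdeg hr hs) (hdeg hs hr)⟩
    change barD 𝒜 N 2 _ = 0
    rw [map_sub]
    erw [hd hsu, hd hru]
    rw [show (r : R) • s = (s : R) • r from Subtype.ext (mul_comm (r : R) (s : R)), sub_self]
  obtain ⟨b, -, hb⟩ := h hz
  refine hv ?_
  have h1 := barForm_barD 𝒜 hT hN ε b
  rw [hb, map_sub] at h1
  have h2 := barForm_tmul 𝒜 T ε
  erw [h2, h2] at h1
  linear_combination h1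

end Cocycle

/-! ### A quotient that is not Koszul -/

@[elab_as_elim]
theorem MvPolynomial.induction_of_coeff_zero {σ R : Type*} [CommSemiring R]
    {P : MvPolynomial σ R → Prop} (p : MvPolynomial σ R) (hp : p.coeff 0 = 0) (zero : P 0)
    (add : ∀ p q, P p → P q → P (p + q))
    (monomial : ∀ h ≠ 0, ∀ c, P (MvPolynomial.monomial h c)) : P p := by
  rw [p.as_sum]
  refine Finset.sum_induction _ P add zero fun h hh => monomial h ?_ _
  rintro rfl
  exact MvPolynomial.mem_support_iff.mp hh hp

section NotKoszul

variable {k : Type u} [Field k] {t : ℕ} {n : Fin t → ℕ}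

variable (k) in
/-- The trilinear form on a monomial module with values `wordValue` on the basis. -/
def wordForm (x z : Fin t) (Ω : ConvexSet (scrollWeight n)) :
    MonModule k Ω →ₗ[k] MonModule k Ω →ₗ[k] MonModule k Ω →ₗ[k] k :=
  MonModule.lift fun g₁ => MonModule.lift fun g₂ => MonModule.lift fun g₃ =>
    (wordValue n x z Ω.carrier g₁ g₂ g₃ : k)

theorem wordForm_bas (x z : Fin t) (Ω : ConvexSet (scrollWeight n)) (g₁ g₂ g₃ : ScrollType t) :
    wordForm k x z Ω (bas k Ω g₁) (bas k Ω g₂) (bas k Ω g₃)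
      = (wordValue n x z Ω.carrier g₁ g₂ g₃ : k) := by
  by_cases h1 : g₁ ∈ Ω.carrier
  · by_cases h2 : g₂ ∈ Ω.carrier
    · by_cases h3 : g₃ ∈ Ω.carrier
      · rw [wordForm, MonModule.lift_bas _ h1, MonModule.lift_bas _ h2, MonModule.lift_bas _ h3]
      · rw [bas_eq_zero h3, map_zero, wordValue, if_neg fun h => h3 h.2.2.2, Int.cast_zero]
    · rw [bas_eq_zero h2, map_zero, LinearMap.zero_apply, wordValue, if_neg fun h => h2 h.2.2.1,
        Int.cast_zero]
  · rw [bas_eq_zero h1, map_zero, LinearMap.zero_apply, LinearMap.zero_apply, wordValue,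
      if_neg fun h => h1 h.2.1, Int.cast_zero]

/-- The identity is multilinear, so it reduces to monomials different from 1, where it is
`wordValue_boundary`. -/
theorem wordForm_boundary {x z : Fin t} (hxz : x ≠ z) (hz : 2 * n x + 1 ≤ n z)
    {Ω : ConvexSet (scrollWeight n)} (hΩ : Ω.carrier = liveSet (gapVars n x z (2 * n x + 1)))
    {p₁ p₂ p₃ p₄ : MvPolynomial (ScrollVar n) k} (h1 : p₁.coeff 0 = 0) (h2 : p₂.coeff 0 = 0)
    (h3 : p₃.coeff 0 = 0) (h4 : p₄.coeff 0 = 0) :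
    wordForm k x z Ω ((p₁ * p₂) • bas k Ω 0) (p₃ • bas k Ω 0) (p₄ • bas k Ω 0)
      - wordForm k x z Ω (p₁ • bas k Ω 0) ((p₂ * p₃) • bas k Ω 0) (p₄ • bas k Ω 0)
      + wordForm k x z Ω (p₁ • bas k Ω 0) (p₂ • bas k Ω 0) ((p₃ * p₄) • bas k Ω 0) = 0 := by
  refine MvPolynomial.induction_of_coeff_zero p₁ h1 (by simp) (fun p q hp hq => ?_)
    fun m₁ n1 c₁ => ?_
  · simp only [add_mul, add_smul, map_add, LinearMap.add_apply]
    linear_combination hp + hq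
  refine MvPolynomial.induction_of_coeff_zero p₂ h2 (by simp) (fun p q hp hq => ?_)
    fun m₂ n2 c₂ => ?_
  · simp only [add_mul, mul_add, add_smul, map_add, LinearMap.add_apply]
    linear_combination hp + hq
  refine MvPolynomial.induction_of_coeff_zero p₃ h3 (by simp) (fun p q hp hq => ?_)
    fun m₃ n3 c₃ => ?_
  · simp only [add_mul, mul_add, add_smul, map_add, LinearMap.add_apply]
    linear_combination hp + hq
  refine MvPolynomial.induction_of_coeff_zero p₄ h4 (by simp) (fun p q hp hq => ?_)
    fun m₄ n4 c₄ => ?_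
  · simp only [mul_add, add_smul, map_add]
    linear_combination hp + hq
  have h0 : (0 : ScrollType t) ∈ Ω.carrier := hΩ ▸ zero_mem_liveSet _
  simp only [MvPolynomial.monomial_mul, monomial_smul_bas _ _ h0, add_zero, map_smul,
    LinearMap.smul_apply, wordForm_bas, map_add, smul_eq_mul]
  have key := congrArg (Int.cast : ℤ → k) (wordValue_boundary hxz hz n1 n2 n3 n4)
  rw [← hΩ] at key
  push_cast at key
  linear_combination c₁ * c₂ * c₃ * c₄ * key

theorem not_isKoszul_gapVars {x z : Fin t} (hxz : x ≠ z) (hx : 1 ≤ n x) (hz : 2 * n x + 1 ≤ n z) :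
    ¬ IsKoszul (quotientGrading k (ScrollVar n)
      (Scroll k n ⧸ Ideal.span (coordinates k (gapVars n x z (2 * n x + 1))))) := by
  intro hK
  have hA := monPresentation_coordinates (k := k) (gapVars n x z (2 * n x + 1))
  set A := Scroll k n ⧸ Ideal.span (coordinates k (gapVars n x z (2 * n x + 1))) with hAdef
  set Ω : ConvexSet (scrollWeight n) :=
    ⟨liveSet (gapVars n x z (2 * n x + 1)), liveSet_convex _⟩ with hΩ
  set 𝒜 := quotientGrading k (ScrollVar n) A with h𝒜
  have hK' := (torZero_iff 𝒜 (residueGrading 𝒜) 3 4).mpr (hK 3 4 (by omega))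
  let κ : irrelevantIdeal 𝒜 →ₗ[k] MonModule k Ω :=
    hA.equivₖ.toLinearMap ∘ₗ ((irrelevantIdeal 𝒜).subtype.restrictScalars k)
  have hκ : ∀ (r : irrelevantIdeal 𝒜) p, algebraMap (MvPolynomial (ScrollVar n) k) A p = r →
      κ r = p • bas k Ω 0 := fun r p hp => by
    rw [← hA.equiv_algebraMap, hp]
    rfl
  let T : irrelevantIdeal 𝒜 →ₗ[k] irrelevantIdeal 𝒜 →ₗ[k] irrelevantIdeal 𝒜 →ₗ[k] k :=
    LinearMap.mk₂ k (fun r s => wordForm k x z Ω (κ r) (κ s) ∘ₗ κ)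
      (fun r r' s => by rw [map_add, map_add]; rfl) (fun c r s => by rw [map_smul, map_smul]; rfl)
      (fun r s s' => by rw [map_add, map_add]; rfl) (fun c r s => by rw [map_smul, map_smul]; rfl)
  have hTapp : ∀ r s u, T r s u = wordForm k x z Ω (κ r) (κ s) (κ u) := fun r s u => rfl
  have hT : ∀ r₁ r₂ r₃ r₄ : irrelevantIdeal 𝒜,
      T ((r₁ : A) • r₂) r₃ r₄ - T r₁ ((r₂ : A) • r₃) r₄ + T r₁ r₂ ((r₃ : A) • r₄) = 0 := by
    intro r₁ r₂ r₃ r₄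
    obtain ⟨p₁, hp₁⟩ := hA.surj r₁
    obtain ⟨p₂, hp₂⟩ := hA.surj r₂
    obtain ⟨p₃, hp₃⟩ := hA.surj r₃
    obtain ⟨p₄, hp₄⟩ := hA.surj r₄
    have hm : ∀ (r s : irrelevantIdeal 𝒜) p q, algebraMap (MvPolynomial (ScrollVar n) k) A p = r →
        algebraMap (MvPolynomial (ScrollVar n) k) A q = s →
        κ ((r : A) • s) = (p * q) • bas k Ω 0 := fun r s p q hp hq =>
      hκ _ _ (by rw [map_mul, hp, hq]; rfl)
    rw [hTapp, hTapp, hTapp, hm _ _ _ _ hp₁ hp₂, hm _ _ _ _ hp₂ hp₃, hm _ _ _ _ hp₃ hp₄,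
      hκ _ _ hp₁, hκ _ _ hp₂, hκ _ _ hp₃, hκ _ _ hp₄]
    exact wordForm_boundary hxz hz rfl
      (hA.algebraMap_mem_irrelevantIdeal.mp (hp₁ ▸ r₁.2))
      (hA.algebraMap_mem_irrelevantIdeal.mp (hp₂ ▸ r₂.2))
      (hA.algebraMap_mem_irrelevantIdeal.mp (hp₃ ▸ r₃.2))
      (hA.algebraMap_mem_irrelevantIdeal.mp (hp₄ ▸ r₄.2))
  have hN : ∀ (r : irrelevantIdeal 𝒜) (m : A ⧸ irrelevantIdeal 𝒜), (r : A) • m = 0 := by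
    intro r m
    obtain ⟨m, rfl⟩ := Ideal.Quotient.mk_surjective m
    exact Ideal.Quotient.eq_zero_iff_mem.mpr (Ideal.mul_mem_right m _ r.2)
  let ε : A ⧸ irrelevantIdeal 𝒜 →ₗ[k] k := coef 0 ∘ₗ hA.residue.equivₖ.toLinearMap
  have hε : ε 1 = 1 := by
    have h1 := hA.residue.equiv_algebraMap 1
    rw [map_one, one_smul] at h1
    change coef 0 (hA.residue.equiv 1) = 1
    rw [h1, coef_bas, if_pos ⟨rfl, rfl⟩]
  have hmem : ∀ (h : ScrollVar n →₀ ℕ), h ≠ 0 →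
      algebraMap (MvPolynomial (ScrollVar n) k) A (MvPolynomial.monomial h 1)
        ∈ irrelevantIdeal 𝒜 := fun h hh =>
    hA.algebraMap_mem_irrelevantIdeal.mpr (by rw [MvPolynomial.coeff_monomial, if_neg hh])
  have hgr : ∀ (h : ScrollVar n →₀ ℕ) (d : ℕ), h.degree = d →
      algebraMap (MvPolynomial (ScrollVar n) k) A (MvPolynomial.monomial h 1) ∈ 𝒜 d :=
    fun h d hd => mem_quotientGrading.mpr ⟨_, MvPolynomial.isHomogeneous_monomial 1 hd, rfl⟩
  have h0 : (0 : ScrollType t) ∈ Ω.carrier := zero_mem_liveSet _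
  have hκm : ∀ (h : ScrollVar n →₀ ℕ) (hh : h ≠ 0), κ ⟨_, hmem h hh⟩
      = bas k Ω ((scrollWeight n).wt h) := fun h hh => by
    rw [hκ _ _ rfl, monomial_smul_bas _ _ h0, one_smul, add_zero]
  have hprod : ∀ h h' : ScrollVar n →₀ ℕ,
      (scrollWeight n).wt h + (scrollWeight n).wt h' ∉ Ω.carrier →
      algebraMap (MvPolynomial (ScrollVar n) k) A (MvPolynomial.monomial h 1)
        * algebraMap (MvPolynomial (ScrollVar n) k) A (MvPolynomial.monomial h' 1) = 0 := by
    intro h h' hh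
    rw [← map_mul, hA.ker, MvPolynomial.monomial_mul, monomial_smul_bas _ _ h0, add_zero, map_add,
      bas_eq_zero hh, smul_zero]
  -- The class uses r = y_{x,1}, s = y_{x,0} and u = y_{x,0} y_{z,2n_x}. In degree (2,1) the window
  -- 2n_x < w < 2n_x + 1 is empty, so r u = s u = 0. The form takes the value 1 on r ⊗ s ⊗ u and 0
  -- on s ⊗ r ⊗ u.
  let h₀ : ScrollVar n →₀ ℕ := Finsupp.single ⟨x, ⟨0, by omega⟩⟩ 1
  let h₁ : ScrollVar n →₀ ℕ := Finsupp.single ⟨x, ⟨1, by omega⟩⟩ 1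
  let h₂ : ScrollVar n →₀ ℕ := h₀ + Finsupp.single ⟨z, ⟨2 * n x, by omega⟩⟩ 1
  have w₀ : (scrollWeight n).wt h₀ = pairType x z 1 0 0 := by
    rw [scrollWeight_single, varWeight_eq_left x z]
  have w₁ : (scrollWeight n).wt h₁ = pairType x z 1 0 1 := by
    rw [scrollWeight_single, varWeight_eq_left x z]
  have w₂ : (scrollWeight n).wt h₂ = pairType x z 1 1 (2 * n x) := by
    rw [map_add, w₀, scrollWeight_single, varWeight_eq_right x z, pairType_add]
    simp
  have d₀ : h₀.degree = 1 := Finsupp.degree_single _ _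
  have d₁ : h₁.degree = 1 := Finsupp.degree_single _ _
  have d₂ : h₂.degree = 2 := by rw [map_add, d₀, Finsupp.degree_single]
  have n₀ : h₀ ≠ 0 := fun h => by rw [h, map_zero] at d₀; omega
  have n₁ : h₁ ≠ 0 := fun h => by rw [h, map_zero] at d₁; omega
  have n₂ : h₂ ≠ 0 := fun h => by rw [h, map_zero] at d₂; omega
  refine not_torZero_of_barForm 𝒜 hT hN ε (𝒩 := residueGrading 𝒜) (r := ⟨_, hmem h₁ n₁⟩) (s := ⟨_, hmem h₀ n₀⟩)
    (u := ⟨_, hmem h₂ n₂⟩) (e := 1) (hgr _ 1 d₁) (hgr _ 1 d₀) (hgr _ 2 d₂)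
    ⟨1, hA.grading.one_mem, rfl⟩ (hprod _ _ ?_) (hprod _ _ ?_) ?_ hK'
  · rw [w₁, w₂, pairType_add]
    intro h
    have := ((pairType_mem_liveSet hxz hz).mp h).2 (by omega)
    omega
  · rw [w₀, w₂, pairType_add]
    intro h
    have := ((pairType_mem_liveSet hxz hz).mp h).2 (by omega)
    omega
  · have l₀ : pairType x z 1 0 0 ∈ Ω.carrier :=
      (pairType_mem_liveSet hxz hz).mpr ⟨by omega, fun h => absurd rfl h⟩
    have l₁ : pairType x z 1 0 1 ∈ Ω.carrier :=
      (pairType_mem_liveSet hxz hz).mpr ⟨by omega, fun h => absurd rfl h⟩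
    have l₂ : pairType x z 1 1 (2 * n x) ∈ Ω.carrier :=
      (pairType_mem_liveSet hxz hz).mpr ⟨by omega, fun _ => by omega⟩
    rw [hTapp, hTapp, hκm _ n₀, hκm _ n₁, hκm _ n₂, wordForm_bas, wordForm_bas, w₀, w₁, w₂, hε, wordValue,
      wordValue, if_pos, if_pos]
    · simp only [largeIndex_pairType hxz]
      simp
    · exact ⟨by rw [pairType_add, pairType_add, pairType_inj]; omega, l₀, l₁, l₂⟩
    · exact ⟨by rw [pairType_add, pairType_add, pairType_inj]; omega, l₁, l₀, l₂⟩

end NotKoszul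

end

/-! ### The two equivalences. -/

theorem theorem1p2 (k : Type u) [Field k] {t : ℕ} (n : Fin (t + 1) → ℕ) (hn : Monotone n)
    (hpos : 1 ≤ n 0) :
    ((∀ Y : Set (Scroll k n), Y ⊆ naturalCoordinates k n →
        absReg k (ScrollVar n) (Scroll k n ⧸ Ideal.span Y) ≤ absReg k (ScrollVar n) (Scroll k n)) ↔
      n (Fin.last t) ≤ n 0 + 1) ∧
    ((∀ Y : Set (Scroll k n), Y ⊆ naturalCoordinates k n →
        IsKoszul (quotientGrading k (ScrollVar n) (Scroll k n ⧸ Ideal.span Y))) ↔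
      n (Fin.last t) ≤ 2 * n 0) := by
  have hlow : ∀ s, n 0 ≤ n s := fun s => hn (Fin.zero_le s)
  have hhigh : ∀ s, n s ≤ n (Fin.last t) := fun s => hn (Fin.le_last s)
  have hne : ∀ {N : ℕ}, n 0 < N → N ≤ n (Fin.last t) → (0 : Fin (t + 1)) ≠ Fin.last t :=
    fun h1 h2 h => by rw [← h] at h2; omega
  refine ⟨⟨fun h => ?_, fun h Y hY => ?_⟩, ⟨fun h => ?_, fun h Y hY => ?_⟩⟩
  · by_contra hc
    have h1 := two_le_absReg_gapVars (k := k) (hne (N := n 0 + 2) (by omega) (by omega)) hpos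
      (by omega)
    have h2 := h1.trans ((h _ (coordinates_subset _)).trans absReg_scroll_le_one)
    have h3 : ((2 : ℕ) : ℝ) ≤ ((1 : ℕ) : ℝ) := EReal.coe_le_coe_iff.mp h2
    norm_num at h3
  -- Only in this case does the matrix lack two different columns; then reg R = 0 and the general
  -- bound 1 is too weak.
  · by_cases hline : t = 0 ∧ n 0 = 1
    · obtain ⟨rfl, h1⟩ := hline
      exact (absReg_quotient_line (s := 0) (fun i => Fin.ext (by omega)) h1 hY).trans
        zero_le_absReg_scroll
    · refine (absReg_quotient_le_one hpos hlow (fun s => (hhigh s).trans h) hY).trans ?_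
      -- Two different columns: the first two of a single block of size at least 2, or the first
      -- columns of two blocks.
      by_cases ht : t = 0
      · exact one_le_absReg_scroll (i := 0) (a := 0) (c := 0) (b := 1) (by omega) (by omega)
          (by simp)
      · have h0 : (0 : Fin (t + 1)) ≠ Fin.last t := fun h => ht (by simpa using congrArg Fin.val h.symm)
        exact one_le_absReg_scroll (i := 0) (a := Fin.last t) (c := 0) (b := 0) hpos
          (hpos.trans (hlow _)) fun h => h0 h.1
  · by_contra hc
    exact not_isKoszul_gapVars (hne (N := 2 * n 0 + 1) (by omega) (by omega)) hpos (by omega)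
      (h _ (coordinates_subset _))
  · exact isKoszul_quotient hpos hlow (fun s => (hhigh s).trans h) hY
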